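/- **Setting.** For $m\ge 3$ let $P_m$ be the $m$-gon with edges $E_1,\dots,E_m$ in cyclic order, let $P=P_{m_1}\times\cdots\times P_{m_n}$ with all $m_i\ge 3$, and let $F_{i,j}$ $(1\le i\le n,\ 1\le j\le m_i)$ be the facet of $P$ on which the $i$-th coordinate lies in $E_j\subset P_{m_i}$. A *characteristic matrix* on a simple polytope $Q$ of dimension $d$ is a $d\times\#\{\text{facets}\}$ matrix $\lambda$ over $\mathbb Z_2=\mathbb Z/2$ such that the columns $\lambda_{F}$ of any finite set of facets with a common point are linearly independent. The *small cover* is $$M(Q,\lambda)=(\mathbb Z_2^{d}\times Q)/\sim,\qquad (g,p)\sim(h,q)\iff p=q \text{ and } g-h\in\langle \lambda_F : p\in F\rangle,$$ with the action $h\cdot[g,p]=[h+g,p]$ of $\mathbb Z_2^{d}$ and orbit map $[g,p]\mapsto p$ (equivalently, it is the quotient of the real moment-angle manifold of $Q$ by $\ker\lambda$). Two small covers over the same $Q$ are *Davis–Januszkiewicz (D–J) equivalent* if there are a homeomorphism $h$ between them covering $\mathrm{id}_Q$ and an automorphism $\theta$ of $\mathbb Z_2^{d}$ with $h(g\cdot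 x)=\theta(g)\cdot h(x)$. **Square regrouping.** Each square factor ($m_i=4$) has two interval directions, with opposite facets $\{F_{i,1},F_{i,3}\}$ and $\{F_{i,2},F_{i,4}\}$. A *square regrouping* is a permutation of the set of all interval directions of the square factors; it relabels the facets of $P$ so that each square factor consists of two interval directions again, while the other factors are unchanged. It is *compatible* with a characteristic matrix $\lambda$ on $P$ if, after the relabelling, for every factor $i$ the indicator vector $\chi_i=F_{i,1}+\cdots+F_{i,m_i}\in\mathbb Z_2^{m_1+\cdots+m_n}$ lies in the row space of $\lambda$. The small cover $M(P,\lambda)$ is *factor-compatible* if a compatible square regrouping exists; such a regrouping is then fixed, and it may be any of the compatible ones. **Bundles and surfaces.** An *equivariant bundle* with fiber a $K$-space $Y$ is a locally trivial fiber bundle $f:E\to B$ from a $G_E$-space to a $G_B$-space with fiber $Y$, equivariant with respect to a surjective homomorphism $\rho:G_E\to G_B$, with an identification $\ker\rho\cong K$ and local trivializations respecting the action of $\ker\rho\cong K$ along the fibers. A *closed connected orientable surface of genus $g$* is a space with a finite triangulation that is a connected closed combinatorial surface, admits a coherent orientation of its triangles, and has Euler characteristic $2-2g$. **Statement.** Let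 $M(P,\lambda)$ be factor-compatible with fixed compatible square regrouping. Then there are a reordering of the polygon factors, after which the factors are again denoted $P_{m_1},\dots,P_{m_n}$, and a $2n\times(m_1+\cdots+m_n)$ matrix $\lambda'$ over $\mathbb Z_2$ with the following properties. 1. Let $\lambda^{\circ}$ be $\lambda$ with its columns relabelled by the regrouping and reordering. Then $\lambda^{\circ}$ is a characteristic matrix on the resulting product, and there is a homeomorphism from $P$ to the resulting product that carries facets to facets according to the relabelling and is covered by a weakly equivariant homeomorphism from $M(P,\lambda)$ to the small cover of $\lambda^{\circ}$. The small cover of $\lambda^{\circ}$ is D–J equivalent to that of $\lambda'$. 2. $\lambda'$ is block lower triangular: with rows divided into $n$ blocks of size $2$ and columns according to the polygon factors, its $2\times m_j$ blocks $\Lambda_{ij}$ vanish for $i<j$. For $0\le t\le n$ the part of $\lambda'$ consisting of the first $t$ row and column blocks is a characteristic matrix on $P_{m_1}\times\cdots\times P_{m_t}$; let $M_t$ be its small cover. So $M_n$ is the small cover of $\lambda'$, and $M_0$ is a point. 3. There is a tower $M_n\to M_{n-1}\to\cdots\to M_1\to M_0=\mathrm{pt}$ in which each map $M_i\to M_{i-1}$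 covers the projection $P_{m_1}\times\cdots\times P_{m_i}\to P_{m_1}\times\cdots\times P_{m_{i-1}}$ and is an equivariant bundle with fiber the small cover $M(P_{m_i},\Lambda_{ii})$ with its $\mathbb Z_2^2$-action. 4. For each $i$, $\Lambda_{ii}$ is a characteristic matrix on $P_{m_i}$, the number $m_i$ is even, and the fiber $M(P_{m_i},\Lambda_{ii})$ is a closed connected orientable surface of genus $(m_i-2)/2$. -/

import Mathlib

/-! ### Small covers over a polytope with prescribed facets -/

/-- The identification on `ℤ₂^ρ × P`: `(g, p) ∼ (h, p)` when `g - h` lies in the span of the columns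
of `lam` indexed by the facets that contain `p`. -/
def smallCoverSetoid {P κ ρ : Type} (F : κ → Set P) (lam : Matrix ρ κ (ZMod 2)) :
    Setoid ((ρ → ZMod 2) × P) where
  r a b := a.2 = b.2 ∧ a.1 - b.1 ∈ Submodule.span (ZMod 2) (lam.col '' {k | a.2 ∈ F k})
  iseqv := by
    refine ⟨fun a => ⟨rfl, by simp⟩, ?_, ?_⟩
    · rintro a b ⟨h, h'⟩
      refine ⟨h.symm, ?_⟩
      rw [← h, ← neg_sub]
      exact Submodule.neg_mem _ h'
    · rintro a b c ⟨h, h'⟩ ⟨k, k'⟩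
      refine ⟨h.trans k, ?_⟩
      rw [← h] at k'
      simpa using Submodule.add_mem _ h' k'

/-- The small cover `M(P, lam) = (ℤ₂^ρ × P) / ∼` (Davis--Januszkiewicz construction) of a space `P`
with facets `F k`, `k : κ`, where the column `lam.col k` is the characteristic vector of `F k`.
When the columns of `lam` span, it is the quotient of the real moment-angle space `(ℤ₂^κ × P) / ∼`
by `ker lam`, via `[g, p] ↦ [lam g, p]`. -/
def SmallCover {P κ ρ : Type} (F : κ → Set P) (lam : Matrix ρ κ (ZMod 2)) : Type :=
  Quotient (smallCoverSetoid F lam)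

section
variable {P κ ρ : Type} (F : κ → Set P) (lam : Matrix ρ κ (ZMod 2))

/-- The quotient topology, `ℤ₂^ρ` (`ρ` finite) being discrete. -/
instance [TopologicalSpace P] : TopologicalSpace (SmallCover F lam) :=
  inferInstanceAs (TopologicalSpace (Quotient (smallCoverSetoid F lam)))

/-- The action `h • [g, p] = [h + g, p]` of `ℤ₂^ρ`. -/
instance : AddAction (ρ → ZMod 2) (SmallCover F lam) where
  vadd h := Quotient.map (fun a => (h + a.1, a.2)) (by
    rintro a b ⟨h1, h2⟩
    exact ⟨h1, by simpa using h2⟩)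
  zero_vadd x := by
    induction x using Quotient.inductionOn with
    | h a => exact congrArg (Quotient.mk (smallCoverSetoid F lam)) (by simp)
  add_vadd g h x := by
    induction x using Quotient.inductionOn with
    | h a => exact congrArg (Quotient.mk (smallCoverSetoid F lam)) (by simp [add_assoc])

/-- The orbit map `[g, p] ↦ p`. -/
def SmallCover.orbitMap (x : SmallCover F lam) : P :=
  Quotient.lift (fun a : (ρ → ZMod 2) × P => a.2) (fun a b (h : (smallCoverSetoid F lam).r a b) => h.1) x

/-- The nonsingularity condition: whenever finitely many facets have a common point, their columns
are linearly independent over `ℤ₂`. -/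
def IsCharacteristic : Prop :=
  ∀ S : Finset κ, (⋂ k ∈ S, F k).Nonempty → LinearIndependent (ZMod 2) (fun k : S => lam.col k)

end

/-- `M(P, lam)` and `M(P', lam')` are weakly equivariantly homeomorphic over `φ : P ≃ₜ P'`. -/
def WeaklyEquivariantlyHomeomorphicOver {P P' κ κ' ρ ρ' : Type} [TopologicalSpace P]
    [TopologicalSpace P'] (F : κ → Set P) (F' : κ' → Set P') (lam : Matrix ρ κ (ZMod 2))
    (lam' : Matrix ρ' κ' (ZMod 2)) (φ : P ≃ₜ P') : Prop :=
  ∃ (θ : (ρ → ZMod 2) ≃+ (ρ' → ZMod 2)) (h : SmallCover F lam ≃ₜ SmallCover F' lam'),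
    (∀ g x, h (g +ᵥ x) = θ g +ᵥ h x) ∧
    ∀ x, SmallCover.orbitMap F' lam' (h x) = φ (SmallCover.orbitMap F lam x)

/-- Davis--Januszkiewicz equivalence of two small covers over the same `P`: a weakly equivariant
homeomorphism that covers the identity of `P`. -/
def DJEquivalent {P κ κ' ρ ρ' : Type} [TopologicalSpace P] (F : κ → Set P) (F' : κ' → Set P)
    (lam : Matrix ρ κ (ZMod 2)) (lam' : Matrix ρ' κ' (ZMod 2)) : Prop :=
  WeaklyEquivariantlyHomeomorphicOver F F' lam lam' (Homeomorph.refl P)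

/-! ### Polygons and their products -/

/-- The points `exp (2 π i k / m)`, the vertices of the regular `m`-gon in cyclic order. -/
noncomputable def polygonVertex (m k : ℕ) : ℂ :=
  Complex.exp (2 * Real.pi * Complex.I * k / m)

/-- The `m`-gon `P_m` (used for `3 ≤ m`). -/
abbrev RegularPolygon (m : ℕ) : Type := convexHull ℝ (Set.range (polygonVertex m))

/-- The `j`-th edge of the `m`-gon; the edges `j` and `j + 1` (cyclically) are adjacent. -/
def polygonEdge (m : ℕ) (j : Fin m) : Set (RegularPolygon m) :=
  {p | (p : ℂ) ∈ segment ℝ (polygonVertex m j) (polygonVertex m (j + 1))}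

/-- The product `P_{m_1} × ⋯ × P_{m_n}`. -/
abbrev PolygonProduct {n : ℕ} (m : Fin n → ℕ) : Type := ∀ i, RegularPolygon (m i)

/-- Index set of the facets `F_{i,j}` of the product. -/
abbrev Facet {n : ℕ} (m : Fin n → ℕ) : Type := Σ i, Fin (m i)

/-- The facet `F_{i,j}`: the `i`-th coordinate lies on the `j`-th edge of the `i`-th polygon. -/
def productFacet {n : ℕ} (m : Fin n → ℕ) (k : Facet m) : Set (PolygonProduct m) :=
  {p | p k.1 ∈ polygonEdge (m k.1) k.2}

/-! ### Square regroupings and factor-compatibility -/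

/-- The interval directions of the cube part: the square factor `i` has the direction `(i, 0)` with
opposite facets `F_{i,0}, F_{i,2}` and the direction `(i, 1)` with opposite facets
`F_{i,1}, F_{i,3}`. -/
abbrev IntervalDirection {n : ℕ} (m : Fin n → ℕ) : Type := {i // m i = 4} × Fin 2

/-- For a permutation `π` of the interval directions, the facet of the original product that serves
as the facet `F_{i,j}` of the regrouped product. The regrouped square factor `i` has
`π (i, 0)` and `π (i, 1)` as its interval directions; other factors are unchanged. -/
def regroupFacet {n : ℕ} (m : Fin n → ℕ) (π : Equiv.Perm (IntervalDirection m)) (k : Facet m) :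
    Facet m :=
  if h : m k.1 = 4 then
    let d := π (⟨k.1, h⟩, ⟨k.2.val % 2, Nat.mod_lt _ two_pos⟩)
    ⟨d.1.1, ⟨d.2.val + 2 * (k.2.val / 2), by
      have h1 := d.1.2
      have h2 := k.2.2
      have h3 := d.2.2
      omega⟩⟩
  else k

/-- The total facet weight `χ_i = ∑_j F_{i,j}` of the `i`-th polygon factor. -/
def factorWeight {n : ℕ} (m : Fin n → ℕ) (i : Fin n) : Facet m → ZMod 2 :=
  fun k => if k.1 = i then 1 else 0

/-- After regrouping by `π`, the total facet weight of every polygon factor lies in the row space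
of the characteristic matrix. -/
def IsCompatibleRegrouping {n : ℕ} (m : Fin n → ℕ) (lam : Matrix (Fin n × Fin 2) (Facet m) (ZMod 2))
    (π : Equiv.Perm (IntervalDirection m)) : Prop :=
  ∀ i, factorWeight m i ∈
    Submodule.span (ZMod 2) (Set.range (lam.submatrix id (regroupFacet m π)).row)

/-- The small cover of `lam` over the product of polygons is factor-compatible. -/
def FactorCompatible {n : ℕ} (m : Fin n → ℕ)
    (lam : Matrix (Fin n × Fin 2) (Facet m) (ZMod 2)) : Prop :=
  ∃ π : Equiv.Perm (IntervalDirection m), IsCompatibleRegrouping m lam π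

/-- Reordering of the polygon factors by `s`: the facet `F_{i,j}` of the reordered product is the
facet `F_{s(i),j}` of the original one. -/
def permuteFacet {n : ℕ} (m : Fin n → ℕ) (s : Equiv.Perm (Fin n)) (k : Facet (m ∘ s)) : Facet m :=
  ⟨s k.1, k.2⟩

/-! ### Block lower triangular matrices -/

/-- Rows are divided into `n` blocks of size `2`, columns according to the polygon factors; all
blocks above the diagonal vanish. -/
def IsBlockLowerTriangular {n : ℕ} {m : Fin n → ℕ}
    (lam : Matrix (Fin n × Fin 2) (Facet m) (ZMod 2)) : Prop :=
  ∀ a b : Fin n, a < b → ∀ (r : Fin 2) (j : Fin (m b)), lam (a, r) ⟨b, j⟩ = 0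

/-- The diagonal block `Λ_{ii}`, a `2 × m_i` matrix. -/
def diagonalBlock {n : ℕ} {m : Fin n → ℕ} (lam : Matrix (Fin n × Fin 2) (Facet m) (ZMod 2))
    (i : Fin n) : Matrix (Fin 2) (Fin (m i)) (ZMod 2) :=
  fun r j => lam (i, r) ⟨i, j⟩

/-- The side numbers of the first `t` polygon factors. -/
abbrev firstSides {n : ℕ} (m : Fin n → ℕ) (t : ℕ) (ht : t ≤ n) : Fin t → ℕ :=
  fun i => m (i.castLE ht)

/-- The upper left part of `lam` that belongs to the first `t` polygon factors. -/
def truncation {n : ℕ} {m : Fin n → ℕ} (lam : Matrix (Fin n × Fin 2) (Facet m) (ZMod 2))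
    (t : ℕ) (ht : t ≤ n) : Matrix (Fin t × Fin 2) (Facet (firstSides m t ht)) (ZMod 2) :=
  fun r k => lam (r.1.castLE ht, r.2) ⟨k.1.castLE ht, k.2⟩

/-- The space `M_t` of the tower: the small cover of the truncated matrix over the product of the
first `t` polygons. For `t = n` it is the small cover of `lam` itself. -/
abbrev TowerStage {n : ℕ} {m : Fin n → ℕ} (lam : Matrix (Fin n × Fin 2) (Facet m) (ZMod 2))
    (t : ℕ) (ht : t ≤ n) : Type :=
  SmallCover (productFacet (firstSides m t ht)) (truncation lam t ht)

/-! ### Equivariant bundles -/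

/-- `f : E → B` is a locally trivial fiber bundle with fiber `Y`, equivariant with respect to the
surjective homomorphism `ρ` of the acting groups; the kernel of `ρ` is identified by `ι` with the
group acting on `Y`, and the local trivializations respect its action along the fibers. -/
def IsEquivariantBundle {GE GB GY E B Y : Type} [AddCommGroup GE] [AddCommGroup GB]
    [AddCommGroup GY] [AddAction GE E] [AddAction GB B] [AddAction GY Y] [TopologicalSpace E]
    [TopologicalSpace B] [TopologicalSpace Y] (f : E → B) (ρ : GE →+ GB) (ι : GY →+ GE) : Prop :=
  Continuous f ∧ Function.Surjective f ∧
  Function.Surjective ρ ∧ (∀ g x, f (g +ᵥ x) = ρ g +ᵥ f x) ∧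
  Function.Injective ι ∧ ι.range = ρ.ker ∧
  ∀ b : B, ∃ T : Bundle.Trivialization Y f, b ∈ T.baseSet ∧
    ∀ (c : GY) (x : E), f x ∈ T.baseSet → (T (ι c +ᵥ x)).2 = c +ᵥ (T x).2

/-! ### Closed orientable surfaces -/

/-- The geometric realization of a finite simplicial complex, in barycentric coordinates. -/
def realization {V : Type} [Fintype V] (K : AbstractSimplicialComplex V) : Set (V → ℝ) :=
  {x | x ∈ stdSimplex ℝ V ∧ ∃ s ∈ K.faces, ∀ v, x v ≠ 0 → v ∈ s}

/-- The edge graph of a simplicial complex. -/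
def edgeGraph {V : Type} [DecidableEq V] (K : AbstractSimplicialComplex V) : SimpleGraph V where
  Adj a b := a ≠ b ∧ {a, b} ∈ K.faces
  symm := ⟨fun a b h => ⟨h.1.symm, by rw [Finset.pair_comm]; exact h.2⟩⟩
  loopless := ⟨fun a h => h.1 rfl⟩

/-- The graph of the edges opposite to `v` in the triangles at `v`. -/
def linkGraph {V : Type} [DecidableEq V] (K : AbstractSimplicialComplex V) (v : V) :
    SimpleGraph V where
  Adj a b := a ≠ b ∧ a ≠ v ∧ b ≠ v ∧ {v, a, b} ∈ K.faces
  symm := ⟨fun a b h => ⟨h.1.symm, h.2.2.1, h.2.1, by rw [Finset.pair_comm]; exact h.2.2.2⟩⟩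
  loopless := ⟨fun a h => h.1 rfl⟩

/-- `K` is a connected closed combinatorial surface: it is purely two-dimensional, every edge lies
in exactly two triangles, and the link of every vertex is connected (hence a cycle). -/
structure IsClosedConnectedSurfaceComplex {V : Type} [DecidableEq V]
    (K : AbstractSimplicialComplex V) : Prop where
  card_le : ∀ s ∈ K.faces, s.card ≤ 3
  pure : ∀ s ∈ K.faces, ∃ t ∈ K.faces, s ⊆ t ∧ t.card = 3
  edge : ∀ e ∈ K.faces, e.card = 2 → {t ∈ K.faces | e ⊆ t ∧ t.card = 3}.ncard = 2
  link : ∀ v a b, (edgeGraph K).Adj v a → (edgeGraph K).Adj v b → (linkGraph K v).Reachable a b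
  connected : (edgeGraph K).Connected

/-- `o a b c` says that `(a, b, c)` is a positive vertex order of the triangle `{a, b, c}`. Every
triangle is given exactly one of its two cyclic orders, and no directed edge is induced by two
different triangles, so that adjacent triangles are coherently oriented. -/
structure IsCoherentOrientation {V : Type} [DecidableEq V]
    (K : AbstractSimplicialComplex V) (o : V → V → V → Prop) : Prop where
  triangle : ∀ a b c, o a b c → {a, b, c} ∈ K.faces ∧ a ≠ b ∧ b ≠ c ∧ c ≠ a
  cyclic : ∀ a b c, o a b c → o b c a
  exactly_one : ∀ a b c, {a, b, c} ∈ K.faces → a ≠ b → b ≠ c → c ≠ a → Xor (o a b c) (o b a c)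
  coherent : ∀ a b c d, o a b c → o a b d → c = d

/-- `X` is a closed connected orientable surface of genus `g`: it has a finite triangulation by a
closed connected surface complex that is coherently oriented and has Euler characteristic
`2 - 2 g`. -/
def IsClosedOrientableSurfaceOfGenus (X : Type) [TopologicalSpace X] (g : ℕ) : Prop :=
  ∃ (V : Type) (_ : Fintype V) (_ : DecidableEq V) (K : AbstractSimplicialComplex V)
    (o : V → V → V → Prop),
    IsClosedConnectedSurfaceComplex K ∧ IsCoherentOrientation K o ∧
    ({s ∈ K.faces | s.card = 1}.ncard : ℤ) - {s ∈ K.faces | s.card = 2}.ncard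
      + {s ∈ K.faces | s.card = 3}.ncard = 2 - 2 * g ∧
    Nonempty (X ≃ₜ realization K)

/-! A square regrouping permutes affine coordinates of the square factors, so it is realized by a
homeomorphism of `P`. It therefore suffices to treat a characteristic matrix whose row space
contains every `χ_i`. Taking the columns at one vertex of the product as a basis gives a normal form
`M` (`exists_isNormalized`): the first two columns of each polygon are standard basis vectors, and
compatibility says that the two rows of block `i` add up to `χ_i`.

Since `χ_t` is constant on the facets of each polygon, the sum of two adjacent columns of one
polygon has equal entries in the two rows of every block. After a vertex has been chosen in each
polygon, these sums form an `n × n` matrix `C` (`cornerEntry`), whose column `i` depends only on the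
vertex chosen in polygon `i`. Nonsingularity at the vertices of the product implies that, for every
nonempty set `T` of factors, the `T × T` part of `C` does not kill the all-ones vector
(`exists_sum_cornerEntry_ne_zero`).

For `T = {i}` this gives `C_ii = 1` at every vertex. So the diagonal block alternates between the
two basis vectors, and closing up around the polygon forces `m_i` to be even. For larger `T`, a
minimal failure of triangularity would let the vertices be chosen so that `C` restricted to `T` is
the identity plus a permutation matrix without fixed points, whose row sums vanish
(`exists_minimal`). Hence the interaction relation between factors is well-founded, and sorting by
its rank makes the matrix block lower triangular (`exists_order`).

A block lower triangular matrix gives a projection to the small cover of the first factors. Near a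
point `p₀` of the base, the off-diagonal part can be removed by a linear shear, because the columns
at `p₀` are independent (`BlockSplitting.exists_trivialization`). Each fiber is the small cover of
an even polygon with alternating columns. Its barycentric subdivision is an explicit complex of
flags, oriented by the parity of the copy and the end of the edge; counting its simplices gives the
genus (`isClosedOrientableSurfaceOfGenus_alternating`). -/

open scoped Matrix

/-! ### Small covers: basic facts -/

section SmallCoverBasics

variable {P κ ρ : Type}

theorem mulVec_eq_sum_col [Fintype κ] (A : Matrix ρ κ (ZMod 2)) (v : κ → ZMod 2) :
    A *ᵥ v = ∑ k, v k • A.col k := by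
  funext r
  simp [Matrix.mulVec, dotProduct, mul_comm]

/-- The span of the columns of the facets through a point, in terms of coefficient vectors. -/
theorem mem_span_col_image_iff [Fintype κ] (lam : Matrix ρ κ (ZMod 2)) (s : Set κ)
    (g : ρ → ZMod 2) :
    g ∈ Submodule.span (ZMod 2) (lam.col '' s) ↔
      ∃ w : κ → ZMod 2, (∀ k, w k ≠ 0 → k ∈ s) ∧ lam *ᵥ w = g := by
  classical
  constructor
  · intro h
    induction h using Submodule.span_induction with
    | mem x hx =>
      obtain ⟨k, hk, rfl⟩ := hx
      refine ⟨Pi.single k 1, fun l hl => ?_, by simp⟩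
      by_cases h : l = k
      · exact h ▸ hk
      · simp [h] at hl
    | zero => exact ⟨0, by simp, by simp⟩
    | add x y _ _ hx hy =>
      obtain ⟨w, hw, rfl⟩ := hx
      obtain ⟨v, hv, rfl⟩ := hy
      refine ⟨w + v, fun k hk => ?_, by rw [Matrix.mulVec_add]⟩
      by_cases h : w k = 0
      · exact hv k (by simpa [h] using hk)
      · exact hw k h
    | smul c x _ hx =>
      obtain ⟨w, hw, rfl⟩ := hx
      exact ⟨c • w, fun k hk => hw k fun h => hk (by simp [h]), by rw [Matrix.mulVec_smul]⟩
  · rintro ⟨w, hw, rfl⟩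
    rw [mulVec_eq_sum_col]
    refine Submodule.sum_mem _ fun k _ => ?_
    by_cases h : w k = 0
    · simp [h]
    · exact Submodule.smul_mem _ _ (Submodule.subset_span ⟨k, hw k h, rfl⟩)

/-- Extension by zero turns independence of finite families with a common point into a condition on
coefficient vectors indexed by all facets. Most later uses of nonsingularity exhibit such a vector
in the kernel. -/
theorem isCharacteristic_iff [Fintype κ] (F : κ → Set P) (lam : Matrix ρ κ (ZMod 2)) :
    IsCharacteristic F lam ↔
      ∀ (w : κ → ZMod 2) (p : P), (∀ k, w k ≠ 0 → p ∈ F k) → lam *ᵥ w = 0 → w = 0 := by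
  classical
  constructor
  · intro h w p hp h0
    have hne : (⋂ k ∈ Finset.univ.filter fun k => w k ≠ 0, F k).Nonempty := ⟨p, by simpa using hp⟩
    have hS := h _ hne
    rw [Fintype.linearIndependent_iff] at hS
    funext k
    by_contra hk
    refine hk (hS (fun k => w k) ?_ ⟨k, by simpa using hk⟩)
    rw [← h0, mulVec_eq_sum_col, Finset.sum_coe_sort _ (fun k => w k • lam.col k),
      Finset.sum_filter]
    refine Finset.sum_congr rfl fun k _ => ?_
    by_cases h : w k = 0
    · simp [h]
    · simp [h]
  · rintro h S ⟨p, hp⟩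
    rw [Fintype.linearIndependent_iff]
    intro g hg k
    have hw := h (fun k => if hk : k ∈ S then g ⟨k, hk⟩ else 0) p (fun k hk => by
      by_cases hk' : k ∈ S
      · simp only [Set.mem_iInter] at hp
        exact hp k hk'
      · simp [hk'] at hk) (by
      rw [← hg, mulVec_eq_sum_col, ← Finset.sum_subset (Finset.subset_univ S)
        (fun k _ hk => by simp [hk]), ← Finset.sum_coe_sort]
      exact Finset.sum_congr rfl fun k _ => by simp)
    simpa using congrFun hw k

/-- The class of `(g, p)` in the small cover. -/
def SmallCover.mk (F : κ → Set P) (lam : Matrix ρ κ (ZMod 2)) (a : (ρ → ZMod 2) × P) :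
    SmallCover F lam :=
  Quotient.mk (smallCoverSetoid F lam) a

variable (F : κ → Set P) (lam : Matrix ρ κ (ZMod 2))

theorem SmallCover.mk_surjective : Function.Surjective (SmallCover.mk F lam) :=
  Quotient.mk_surjective

theorem SmallCover.vadd_mk (h : ρ → ZMod 2) (a : (ρ → ZMod 2) × P) :
    h +ᵥ SmallCover.mk F lam a = SmallCover.mk F lam (h + a.1, a.2) := rfl

theorem SmallCover.orbitMap_mk (a : (ρ → ZMod 2) × P) :
    SmallCover.orbitMap F lam (SmallCover.mk F lam a) = a.2 := rfl

theorem SmallCover.mk_eq_iff' {a b : (ρ → ZMod 2) × P} :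
    SmallCover.mk F lam a = SmallCover.mk F lam b ↔
      a.2 = b.2 ∧ a.1 - b.1 ∈ Submodule.span (ZMod 2) (lam.col '' {k | a.2 ∈ F k}) :=
  Quotient.eq

theorem SmallCover.mk_eq_iff [Fintype κ] {a b : (ρ → ZMod 2) × P} :
    SmallCover.mk F lam a = SmallCover.mk F lam b ↔
      a.2 = b.2 ∧ ∃ w : κ → ZMod 2, (∀ k, w k ≠ 0 → a.2 ∈ F k) ∧ lam *ᵥ w = a.1 - b.1 := by
  rw [SmallCover.mk_eq_iff', mem_span_col_image_iff]
  rfl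

variable [TopologicalSpace P]

theorem SmallCover.isQuotientMap_mk : Topology.IsQuotientMap (SmallCover.mk F lam) :=
  isQuotientMap_quotient_mk'

theorem SmallCover.continuous_mk : Continuous (SmallCover.mk F lam) :=
  (SmallCover.isQuotientMap_mk F lam).continuous

theorem SmallCover.continuous_orbitMap : Continuous (SmallCover.orbitMap F lam) :=
  (SmallCover.isQuotientMap_mk F lam).continuous_iff.2 continuous_snd

instance [CompactSpace P] [Finite ρ] : CompactSpace (SmallCover F lam) :=
  inferInstanceAs (CompactSpace (Quotient (smallCoverSetoid F lam)))

variable {F}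

/-- Only finitely many translations `d` and facet sets `S` occur, so the saturation of a closed set
is a finite union of closed sets. -/
theorem SmallCover.isClosedMap_mk [Finite κ] [Finite ρ] (hF : ∀ k, IsClosed (F k)) :
    IsClosedMap (SmallCover.mk F lam) := by
  intro C hC
  rw [← (SmallCover.isQuotientMap_mk F lam).isClosed_preimage]
  have : SmallCover.mk F lam ⁻¹' (SmallCover.mk F lam '' C) =
      ⋃ (d : ρ → ZMod 2), ⋃ (S : Set κ), ⋃ (_ : d ∈ Submodule.span (ZMod 2) (lam.col '' S)),
        ((fun a : (ρ → ZMod 2) × P => (a.1 + d, a.2)) ⁻¹' C ∩ ⋂ k ∈ S, Prod.snd ⁻¹' F k) := by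
    ext a
    simp only [Set.mem_preimage, Set.mem_image, Set.mem_iUnion, Set.mem_inter_iff, Set.mem_iInter]
    constructor
    · rintro ⟨b, hb, hab⟩
      obtain ⟨h1, h2⟩ := (SmallCover.mk_eq_iff' F lam).1 hab
      refine ⟨b.1 - a.1, _, h2, ?_, fun k hk => ?_⟩
      · rw [← h1]
        simpa using hb
      · rw [← h1]
        exact hk
    · rintro ⟨d, S, hd, hC, hS⟩
      refine ⟨_, hC, (SmallCover.mk_eq_iff' F lam).2 ⟨rfl, ?_⟩⟩
      have : S ⊆ {k | a.2 ∈ F k} := fun k hk => hS k hk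
      simpa using Submodule.span_mono (Set.image_mono this) hd
  rw [this]
  refine isClosed_iUnion_of_finite fun d => isClosed_iUnion_of_finite fun S =>
    isClosed_iUnion_of_finite fun _ => IsClosed.inter (hC.preimage ?_) ?_
  · exact (continuous_fst.add continuous_const).prodMk continuous_snd
  · exact isClosed_biInter fun k _ => (hF k).preimage continuous_snd

/-- Closed with finite fibers. Properness, unlike being a quotient map, passes to products; this
gives continuity of maps out of a product of two small covers. -/
theorem SmallCover.isProperMap_mk [Finite κ] [Finite ρ] (hF : ∀ k, IsClosed (F k)) :
    IsProperMap (SmallCover.mk F lam) := by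
  rw [isProperMap_iff_isClosedMap_and_compact_fibers]
  refine ⟨SmallCover.continuous_mk F lam, SmallCover.isClosedMap_mk lam hF, fun y => ?_⟩
  have : SmallCover.mk F lam ⁻¹' {y} ⊆ Set.univ ×ˢ {SmallCover.orbitMap F lam y} := by
    rintro a rfl
    exact ⟨trivial, rfl⟩
  exact ((Set.finite_univ.prod (Set.finite_singleton _)).subset this).isCompact

end SmallCoverBasics

section Transport

variable {P P' κ κ' ρ ρ' : Type}

/-- A dependence at `p` is carried to one at `ψ p`. For this, incidences need to be preserved in one
direction only, and injectivity of `θ` is enough. -/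
theorem IsCharacteristic.transport [Fintype κ] [Fintype κ'] {F : κ → Set P} {F' : κ' → Set P'}
    {lam : Matrix ρ κ (ZMod 2)} {lam' : Matrix ρ' κ' (ZMod 2)} (h : IsCharacteristic F lam)
    (ψ : P' → P) (σ : κ' ≃ κ) (θ : (ρ → ZMod 2) →ₗ[ZMod 2] (ρ' → ZMod 2))
    (hθ : Function.Injective θ) (hF : ∀ k p, p ∈ F' k → ψ p ∈ F (σ k))
    (hlam : ∀ k, θ (lam.col (σ k)) = lam'.col k) : IsCharacteristic F' lam' := by
  rw [isCharacteristic_iff] at h ⊢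
  intro w p hp h0
  have := h (w ∘ σ.symm) (ψ p) (fun k hk => by simpa using hF _ _ (hp _ hk)) (by
    apply hθ
    rw [map_zero, ← h0, mulVec_eq_sum_col, mulVec_eq_sum_col, map_sum,
      ← Equiv.sum_comp σ]
    refine Finset.sum_congr rfl fun k _ => ?_
    simp [← hlam])
  funext k
  simpa using congrFun this (σ k)

/-- A homeomorphism of polytopes that matches the facets, together with a group isomorphism that
matches the characteristic vectors, is covered by a weakly equivariant homeomorphism. -/
theorem weaklyEquivariantlyHomeomorphicOver_of_matching [Finite ρ] [Finite ρ']
    [TopologicalSpace P]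
    [TopologicalSpace P'] {F : κ → Set P} {F' : κ' → Set P'}
    {lam : Matrix ρ κ (ZMod 2)} {lam' : Matrix ρ' κ' (ZMod 2)} (φ : P ≃ₜ P') (σ : κ' ≃ κ)
    (θ : (ρ → ZMod 2) ≃ₗ[ZMod 2] (ρ' → ZMod 2)) (hF : ∀ k, φ '' F (σ k) = F' k)
    (hlam : ∀ k, θ (lam.col (σ k)) = lam'.col k) :
    WeaklyEquivariantlyHomeomorphicOver F F' lam lam' φ := by
  have key : ∀ a b, (smallCoverSetoid F lam).r a b ↔
      (smallCoverSetoid F' lam').r (θ a.1, φ a.2) (θ b.1, φ b.2) := by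
    intro a b
    have hset : lam'.col '' {k | φ a.2 ∈ F' k} = θ '' (lam.col '' {k | a.2 ∈ F k}) := by
      ext v
      constructor
      · rintro ⟨k, hk, rfl⟩
        refine ⟨_, ⟨σ k, ?_, rfl⟩, hlam k⟩
        rw [Set.mem_ofPred_eq, ← hF] at hk
        simpa using hk
      · rintro ⟨_, ⟨k, hk, rfl⟩, rfl⟩
        refine ⟨σ.symm k, ?_, by rw [← hlam]; simp⟩
        rw [Set.mem_ofPred_eq, ← hF]
        simpa using hk
    change (_ ∧ _) ↔ (_ ∧ _)
    refine and_congr (by simp) ?_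
    dsimp only
    rw [hset, ← map_sub]
    rw [show θ '' (lam.col '' {k | a.2 ∈ F k}) = θ.toLinearMap '' (lam.col '' {k | a.2 ∈ F k})
      from rfl, Submodule.span_image]
    simp
  let e : (ρ → ZMod 2) × P ≃ₜ (ρ' → ZMod 2) × P' :=
    { toEquiv := θ.toEquiv.prodCongr φ.toEquiv
      continuous_toFun := by
        exact ((continuous_of_discreteTopology (f := θ)).comp continuous_fst).prodMk
          (φ.continuous.comp continuous_snd)
      continuous_invFun := by
        exact ((continuous_of_discreteTopology (f := θ.symm)).comp continuous_fst).prodMk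
          (φ.symm.continuous.comp continuous_snd) }
  let E : SmallCover F lam ≃ SmallCover F' lam' := Quotient.congr e.toEquiv key
  have hE : ∀ a, E (SmallCover.mk F lam a) = SmallCover.mk F' lam' (e a) := fun a => rfl
  have hE' : ∀ a, E.symm (SmallCover.mk F' lam' a) = SmallCover.mk F lam (e.symm a) :=
    fun a => rfl
  refine ⟨θ.toAddEquiv, { toEquiv := E, continuous_toFun := ?_, continuous_invFun := ?_ }, ?_, ?_⟩
  · refine (SmallCover.isQuotientMap_mk F lam).continuous_iff.2 ?_
    exact (SmallCover.continuous_mk F' lam').comp e.continuous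
  · refine (SmallCover.isQuotientMap_mk F' lam').continuous_iff.2 ?_
    exact (SmallCover.continuous_mk F lam).comp e.symm.continuous
  · intro g x
    obtain ⟨a, rfl⟩ := SmallCover.mk_surjective F lam x
    change E _ = _ +ᵥ E _
    rw [SmallCover.vadd_mk, hE, hE, SmallCover.vadd_mk]
    exact congrArg _ (Prod.ext (map_add θ g a.1) rfl)
  · intro x
    obtain ⟨a, rfl⟩ := SmallCover.mk_surjective F lam x
    rfl

end Transport

/-! ### Block triangular characteristic matrices give equivariant bundles -/

section Bundle

/-- Prescribe the values on the span and extend. This supplies the shear that straightens the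
projection near a point. -/
theorem LinearIndependent.exists_linearMap_eq {K V W ι : Type*} [Field K] [AddCommGroup V]
    [Module K V] [AddCommGroup W] [Module K W] {v : ι → V} (hv : LinearIndependent K v)
    (u : ι → W) : ∃ f : V →ₗ[K] W, ∀ i, f (v i) = u i := by
  obtain ⟨f, hf⟩ := LinearMap.exists_extend ((Finsupp.linearCombination K u).comp hv.repr)
  refine ⟨f, fun i => ?_⟩
  have hi : v i ∈ Submodule.span K (Set.range v) := Submodule.subset_span ⟨i, rfl⟩
  have := LinearMap.congr_fun hf ⟨v i, hi⟩
  simp only [LinearMap.comp_apply, Submodule.subtype_apply] at this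
  rw [this]
  simp [hv.repr_eq_single i ⟨v i, hi⟩ rfl]

variable {P P₁ P₂ κ κ₁ κ₂ ρ ρ₁ ρ₂ : Type}

/-- The data of a polytope that splits as a product, with a characteristic matrix that is block
lower triangular with respect to the splitting. -/
structure BlockSplitting [TopologicalSpace P] [TopologicalSpace P₁] [TopologicalSpace P₂]
    (F : κ → Set P) (F₁ : κ₁ → Set P₁) (F₂ : κ₂ → Set P₂) (lam : Matrix ρ κ (ZMod 2))
    (lam₁ : Matrix ρ₁ κ₁ (ZMod 2)) (lam₂ : Matrix ρ₂ κ₂ (ZMod 2)) where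
  homeo : P ≃ₜ P₁ × P₂
  split : (ρ → ZMod 2) ≃ₗ[ZMod 2] (ρ₁ → ZMod 2) × (ρ₂ → ZMod 2)
  facets : κ₁ ⊕ κ₂ ≃ κ
  mem_left : ∀ k p, p ∈ F (facets (Sum.inl k)) ↔ (homeo p).1 ∈ F₁ k
  mem_right : ∀ k p, p ∈ F (facets (Sum.inr k)) ↔ (homeo p).2 ∈ F₂ k
  col_left : ∀ k, (split (lam.col (facets (Sum.inl k)))).1 = lam₁.col k
  col_right : ∀ k, split (lam.col (facets (Sum.inr k))) = (0, lam₂.col k)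

namespace BlockSplitting

variable [TopologicalSpace P] [TopologicalSpace P₁] [TopologicalSpace P₂]
    {F : κ → Set P} {F₁ : κ₁ → Set P₁} {F₂ : κ₂ → Set P₂} {lam : Matrix ρ κ (ZMod 2)}
    {lam₁ : Matrix ρ₁ κ₁ (ZMod 2)} {lam₂ : Matrix ρ₂ κ₂ (ZMod 2)}
    (S : BlockSplitting F F₁ F₂ lam lam₁ lam₂)

theorem split_mulVec [Fintype κ] [Fintype κ₁] [Fintype κ₂] (w : κ → ZMod 2) :
    S.split (lam *ᵥ w) = (lam₁ *ᵥ (fun k => w (S.facets (Sum.inl k))),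
      ∑ k, w (S.facets (Sum.inl k)) • (S.split (lam.col (S.facets (Sum.inl k)))).2 +
        lam₂ *ᵥ (fun k => w (S.facets (Sum.inr k)))) := by
  rw [mulVec_eq_sum_col lam, mulVec_eq_sum_col lam₁, mulVec_eq_sum_col lam₂, map_sum, ← Equiv.sum_comp S.facets, Fintype.sum_sum_type]
  simp only [map_smul, S.col_right, ← S.col_left]
  ext r <;> simp [Prod.fst_sum, Prod.snd_sum]

theorem continuous_split [Finite ρ] : Continuous S.split := continuous_of_discreteTopology

variable [Fintype κ] [Fintype κ₁] [Fintype κ₂]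

/-- A facet `A` of the first factor has a column of the form `(λ₁ A, v_A)`. When `ψ (λ₁ A) = v_A`
for the facets through `p₀`, the shear `(x, y) ↦ (x, y - ψ x)` turns these columns into `(λ₁ A, 0)`.
So over points with no facets beyond those of `p₀`, the span of the columns is a direct product. -/
theorem mem_span_iff {p₀ : P₁} {ψ : (ρ₁ → ZMod 2) →ₗ[ZMod 2] (ρ₂ → ZMod 2)}
    (hψ : ∀ k, p₀ ∈ F₁ k → ψ (lam₁.col k) = (S.split (lam.col (S.facets (Sum.inl k)))).2)
    {p : P} (hp : ∀ k, (S.homeo p).1 ∈ F₁ k → p₀ ∈ F₁ k) (d : ρ → ZMod 2) :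
    d ∈ Submodule.span (ZMod 2) (lam.col '' {k | p ∈ F k}) ↔
      (S.split d).1 ∈ Submodule.span (ZMod 2) (lam₁.col '' {k | (S.homeo p).1 ∈ F₁ k}) ∧
      (S.split d).2 - ψ (S.split d).1 ∈
        Submodule.span (ZMod 2) (lam₂.col '' {k | (S.homeo p).2 ∈ F₂ k}) := by
  have hsum : ∀ w : κ₁ → ZMod 2, (∀ k, w k ≠ 0 → (S.homeo p).1 ∈ F₁ k) →
      ψ (lam₁ *ᵥ w) = ∑ k, w k • (S.split (lam.col (S.facets (Sum.inl k)))).2 := by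
    intro w hw
    rw [mulVec_eq_sum_col, map_sum]
    refine Finset.sum_congr rfl fun k _ => ?_
    by_cases h : w k = 0
    · simp [h]
    · rw [map_smul, hψ k (hp k (hw k h))]
  simp only [mem_span_col_image_iff]
  constructor
  · rintro ⟨w, hw, rfl⟩
    have hw1 : ∀ k, w (S.facets (Sum.inl k)) ≠ 0 → (S.homeo p).1 ∈ F₁ k :=
      fun k hk => (S.mem_left k p).1 (hw _ hk)
    rw [split_mulVec]
    refine ⟨⟨_, hw1, rfl⟩, _, fun k hk => (S.mem_right k p).1 (hw _ hk), ?_⟩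
    simp only
    rw [hsum _ hw1, add_sub_cancel_left]
  · rintro ⟨⟨w₁, hw₁, h₁⟩, w₂, hw₂, h₂⟩
    refine ⟨Sum.elim w₁ w₂ ∘ S.facets.symm, fun k hk => ?_, ?_⟩
    · obtain ⟨k, rfl⟩ := S.facets.surjective k
      rcases k with k | k
      · exact (S.mem_left k p).2 (hw₁ k (by simpa using hk))
      · exact (S.mem_right k p).2 (hw₂ k (by simpa using hk))
    · apply S.split.injective
      rw [split_mulVec]
      simp only [Function.comp_apply, Equiv.symm_apply_apply, Sum.elim_inl, Sum.elim_inr]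
      rw [← hsum _ hw₁, h₁, h₂]
      ext r <;> simp

/-- The projection of small covers that covers the first projection of polytopes. -/
def proj (x : SmallCover F lam) : SmallCover F₁ lam₁ :=
  Quotient.lift (s := smallCoverSetoid F lam)
    (fun a : (ρ → ZMod 2) × P => SmallCover.mk F₁ lam₁ ((S.split a.1).1, (S.homeo a.2).1)) (by
      rintro a b ⟨h1, h2⟩
      refine (SmallCover.mk_eq_iff _ _).2 ⟨by rw [h1], ?_⟩
      obtain ⟨w, hw, hw'⟩ := (mem_span_col_image_iff _ _ _).1 h2
      refine ⟨_, fun k hk => (S.mem_left k _).1 (hw _ hk), ?_⟩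
      dsimp only
      rw [← Prod.fst_sub, ← map_sub, ← hw', split_mulVec]) x

theorem proj_mk (a : (ρ → ZMod 2) × P) : S.proj (SmallCover.mk F lam a) =
    SmallCover.mk F₁ lam₁ ((S.split a.1).1, (S.homeo a.2).1) := rfl

variable [Finite ρ]

theorem continuous_proj : Continuous S.proj := by
  refine (SmallCover.isQuotientMap_mk F lam).continuous_iff.2 ?_
  refine (SmallCover.continuous_mk F₁ lam₁).comp (Continuous.prodMk ?_ ?_)
  · exact continuous_fst.comp (S.continuous_split.comp continuous_fst)
  · exact continuous_fst.comp (S.homeo.continuous.comp continuous_snd)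

variable [Finite ρ₁] [Finite ρ₂]

theorem isQuotientMap_mk_prod (hF₁ : ∀ k, IsClosed (F₁ k)) (hF₂ : ∀ k, IsClosed (F₂ k)) :
    Topology.IsQuotientMap (Prod.map (SmallCover.mk F₁ lam₁) (SmallCover.mk F₂ lam₂)) :=
  ((SmallCover.isProperMap_mk lam₁ hF₁).prodMap
    (SmallCover.isProperMap_mk lam₂ hF₂)).isClosedMap.isQuotientMap
      ((SmallCover.continuous_mk _ _).prodMap (SmallCover.continuous_mk _ _))
      ((SmallCover.mk_surjective _ _).prodMap (SmallCover.mk_surjective _ _))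

/-- Over the open star of a face the projection is trivial, by a trivialization that respects the
action along the fibers. -/
theorem exists_trivialization (hF₁ : ∀ k, IsClosed (F₁ k)) (hF₂ : ∀ k, IsClosed (F₂ k))
    (hchar : IsCharacteristic F₁ lam₁) (b : SmallCover F₁ lam₁) :
    ∃ T : Bundle.Trivialization (SmallCover F₂ lam₂) S.proj, b ∈ T.baseSet ∧
      ∀ (c : ρ₂ → ZMod 2) (x : SmallCover F lam), S.proj x ∈ T.baseSet →
        (T (S.split.symm (0, c) +ᵥ x)).2 = c +ᵥ (T x).2 := by
  classical
  obtain ⟨⟨g₀, p₀⟩, rfl⟩ := SmallCover.mk_surjective _ _ b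
  -- Nonsingularity of `lam₁` enters here: the columns at `p₀` are independent, so `ψ` may be
  -- prescribed on them.
  obtain ⟨ψ, hψ⟩ : ∃ ψ : (ρ₁ → ZMod 2) →ₗ[ZMod 2] (ρ₂ → ZMod 2), ∀ k, p₀ ∈ F₁ k →
      ψ (lam₁.col k) = (S.split (lam.col (S.facets (Sum.inl k)))).2 := by
    have hne : (⋂ k ∈ Finset.univ.filter fun k => p₀ ∈ F₁ k, F₁ k).Nonempty := ⟨p₀, by simp⟩
    have hli := hchar _ hne
    obtain ⟨ψ, hψ⟩ := hli.exists_linearMap_eq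
      (fun k => (S.split (lam.col (S.facets (Sum.inl k)))).2)
    exact ⟨ψ, fun k hk => hψ ⟨k, by simpa using hk⟩⟩
  -- The complement of the finitely many closed facets that miss `p₀`.
  let U₀ : Set P₁ := {p | ∀ k, p ∈ F₁ k → p₀ ∈ F₁ k}
  have hU₀ : IsOpen U₀ := by
    have : U₀ = ⋂ k ∈ {k | p₀ ∉ F₁ k}, (F₁ k)ᶜ := by
      ext p
      simp only [U₀, Set.mem_ofPred_eq, Set.mem_iInter, Set.mem_compl_iff]
      exact forall_congr' fun k => not_imp_not.symm
    rw [this]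
    exact (Set.toFinite _).isOpen_biInter fun k _ => (hF₁ k).isOpen_compl
  let U : Set (SmallCover F₁ lam₁) := SmallCover.orbitMap F₁ lam₁ ⁻¹' U₀
  have hU : IsOpen U := hU₀.preimage (SmallCover.continuous_orbitMap F₁ lam₁)
  let fib : (ρ → ZMod 2) × P → SmallCover F₂ lam₂ := fun a =>
    SmallCover.mk F₂ lam₂ ((S.split a.1).2 - ψ (S.split a.1).1, (S.homeo a.2).2)
  have hfib : Continuous fib := by
    refine (SmallCover.continuous_mk F₂ lam₂).comp (Continuous.prodMk ?_ ?_)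
    · exact (continuous_of_discreteTopology
        (f := fun g => (S.split g).2 - ψ (S.split g).1)).comp continuous_fst
    · exact continuous_snd.comp (S.homeo.continuous.comp continuous_snd)
  let glue : ((ρ₁ → ZMod 2) × P₁) × ((ρ₂ → ZMod 2) × P₂) → SmallCover F lam := fun y =>
    SmallCover.mk F lam (S.split.symm (y.1.1, y.2.1 + ψ y.1.1), S.homeo.symm (y.1.2, y.2.2))
  have hglue : Continuous glue := by
    refine (SmallCover.continuous_mk F lam).comp (Continuous.prodMk ?_ ?_)
    · exact (continuous_of_discreteTopology (f := fun g : (ρ₁ → ZMod 2) × (ρ₂ → ZMod 2) =>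
        S.split.symm (g.1, g.2 + ψ g.1))).comp
          ((continuous_fst.comp continuous_fst).prodMk (continuous_fst.comp continuous_snd))
    · exact S.homeo.symm.continuous.comp
          ((continuous_snd.comp continuous_fst).prodMk (continuous_snd.comp continuous_snd))
  -- The formulas `fib` and `glue` are known to descend to the quotients only over `U`. Arbitrary
  -- representatives give total functions, and `hT` and `hR` show that over `U` the choice is
  -- irrelevant.
  let T : SmallCover F lam → SmallCover F₁ lam₁ × SmallCover F₂ lam₂ := fun x =>
    (S.proj x, fib (Function.surjInv (SmallCover.mk_surjective F lam) x))
  let R : SmallCover F₁ lam₁ × SmallCover F₂ lam₂ → SmallCover F lam := fun y =>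
    glue (Function.surjInv (SmallCover.mk_surjective F₁ lam₁) y.1,
      Function.surjInv (SmallCover.mk_surjective F₂ lam₂) y.2)
  have hT : ∀ a, (S.homeo a.2).1 ∈ U₀ →
      T (SmallCover.mk F lam a) = (S.proj (SmallCover.mk F lam a), fib a) := by
    intro a ha
    have h := Function.surjInv_eq (SmallCover.mk_surjective F lam) (SmallCover.mk F lam a)
    set b := Function.surjInv (SmallCover.mk_surjective F lam) (SmallCover.mk F lam a) with hb
    obtain ⟨h1, h2⟩ := (SmallCover.mk_eq_iff' F lam).1 h
    refine Prod.ext rfl ((SmallCover.mk_eq_iff' _ _).2 ⟨by rw [← hb, h1], ?_⟩)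
    rw [← hb]
    rw [h1] at h2
    have := ((S.mem_span_iff hψ ha _).1 h2).2
    dsimp only
    rw [h1]
    convert this using 1
    simp only [map_sub, Prod.fst_sub, Prod.snd_sub]
    abel
  have hR : ∀ y, y.1.2 ∈ U₀ → R (SmallCover.mk F₁ lam₁ y.1, SmallCover.mk F₂ lam₂ y.2) = glue y := by
    intro y hy
    have h := Function.surjInv_eq (SmallCover.mk_surjective F₁ lam₁) (SmallCover.mk F₁ lam₁ y.1)
    have h' := Function.surjInv_eq (SmallCover.mk_surjective F₂ lam₂) (SmallCover.mk F₂ lam₂ y.2)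
    change glue (_, _) = _
    dsimp only
    set z₁ := Function.surjInv (SmallCover.mk_surjective F₁ lam₁) (SmallCover.mk F₁ lam₁ y.1)
    set z₂ := Function.surjInv (SmallCover.mk_surjective F₂ lam₂) (SmallCover.mk F₂ lam₂ y.2)
    obtain ⟨h1, h2⟩ := (SmallCover.mk_eq_iff' _ _).1 h
    obtain ⟨h1', h2'⟩ := (SmallCover.mk_eq_iff' _ _).1 h'
    refine (SmallCover.mk_eq_iff' _ _).2 ⟨by rw [← h1, ← h1'], ?_⟩
    refine (S.mem_span_iff hψ (p := S.homeo.symm (z₁.2, z₂.2)) ?_ _).2 ⟨?_, ?_⟩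
    · rw [h1]
      simpa [U₀] using hy
    · simpa using h2
    · convert h2' using 1
      · simp
      · simp only [map_sub, LinearEquiv.apply_symm_apply, Prod.fst_sub, Prod.snd_sub]
        abel
  refine ⟨{ toFun := T, invFun := R, source := S.proj ⁻¹' U, target := U ×ˢ Set.univ
            map_source' := ?_, map_target' := ?_, left_inv' := ?_, right_inv' := ?_
            open_source := hU.preimage S.continuous_proj
            open_target := hU.prod isOpen_univ
            continuousOn_toFun := ?_, continuousOn_invFun := ?_
            baseSet := U, open_baseSet := hU, source_eq := rfl, target_eq := rfl
            proj_toFun := fun x _ => rfl }, fun k hk => hk, ?_⟩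
  · exact fun x hx => ⟨hx, trivial⟩
  · rintro ⟨y₁, y₂⟩ ⟨hy, -⟩
    obtain ⟨y₁, rfl⟩ := SmallCover.mk_surjective _ _ y₁
    obtain ⟨y₂, rfl⟩ := SmallCover.mk_surjective _ _ y₂
    rw [hR (y₁, y₂) hy]
    simpa [glue, proj_mk, U, SmallCover.orbitMap_mk] using hy
  · intro x hx
    obtain ⟨a, rfl⟩ := SmallCover.mk_surjective _ _ x
    have ha : (S.homeo a.2).1 ∈ U₀ := hx
    rw [hT a ha, proj_mk, hR (_, _) ha]
    simp [glue]
  · rintro ⟨y₁, y₂⟩ ⟨hy, -⟩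
    obtain ⟨y₁, rfl⟩ := SmallCover.mk_surjective _ _ y₁
    obtain ⟨y₂, rfl⟩ := SmallCover.mk_surjective _ _ y₂
    have hy : y₁.2 ∈ U₀ := hy
    rw [hR (y₁, y₂) hy, hT _ (by simpa using hy), proj_mk]
    simp [fib]
  · rw [(SmallCover.isQuotientMap_mk F lam).continuousOn_isOpen_iff (hU.preimage S.continuous_proj)]
    have : Continuous fun a => (S.proj (SmallCover.mk F lam a), fib a) :=
      (S.continuous_proj.comp (SmallCover.continuous_mk F lam)).prodMk hfib
    exact this.continuousOn.congr fun a ha => hT a ha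
  · rw [(isQuotientMap_mk_prod hF₁ hF₂).continuousOn_isOpen_iff (hU.prod isOpen_univ)]
    exact hglue.continuousOn.congr fun y hy => hR y hy.1
  · intro c x hx
    obtain ⟨a, rfl⟩ := SmallCover.mk_surjective _ _ x
    have ha : (S.homeo a.2).1 ∈ U₀ := hx
    change (T _).2 = c +ᵥ (T _).2
    rw [SmallCover.vadd_mk, hT a ha, hT (S.split.symm (0, c) + a.1, a.2) ha]
    simp only [fib, SmallCover.vadd_mk, map_add, LinearEquiv.apply_symm_apply, Prod.fst_add,
      Prod.snd_add, zero_add]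
    rw [add_sub_assoc]

theorem isEquivariantBundle_proj [Nonempty P₂] (hF₁ : ∀ k, IsClosed (F₁ k))
    (hF₂ : ∀ k, IsClosed (F₂ k)) (hchar : IsCharacteristic F₁ lam₁) :
    IsEquivariantBundle (Y := SmallCover F₂ lam₂) S.proj
      ((AddMonoidHom.fst _ _).comp S.split.toAddEquiv.toAddMonoidHom)
      (S.split.symm.toAddEquiv.toAddMonoidHom.comp (AddMonoidHom.inr _ _)) := by
  refine ⟨S.continuous_proj, ?_, ?_, ?_, ?_, ?_, S.exists_trivialization hF₁ hF₂ hchar⟩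
  · intro y
    obtain ⟨⟨g, p⟩, rfl⟩ := SmallCover.mk_surjective _ _ y
    obtain ⟨q⟩ := ‹Nonempty P₂›
    exact ⟨SmallCover.mk F lam (S.split.symm (g, 0), S.homeo.symm (p, q)), by simp [proj_mk]⟩
  · intro g
    exact ⟨S.split.symm (g, 0), by simp⟩
  · intro g x
    obtain ⟨a, rfl⟩ := SmallCover.mk_surjective _ _ x
    rw [SmallCover.vadd_mk, proj_mk, proj_mk, SmallCover.vadd_mk]
    simp
  · exact S.split.symm.injective.comp (Prod.mk_right_injective 0)
  · ext g
    rw [AddMonoidHom.mem_range, AddMonoidHom.mem_ker]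
    constructor
    · rintro ⟨c, rfl⟩
      simp
    · intro h
      refine ⟨(S.split g).2, ?_⟩
      apply S.split.injective
      refine Prod.ext ?_ ?_
      · simpa using h.symm
      · simp

end BlockSplitting

end Bundle

/-! ### Coordinates on the regular polygon -/

section PolygonGeometry

/-- The sine of the angle from `polygonVertex m k` to `z`, times the modulus of `z`. -/
noncomputable def vertexCross (m : ℕ) (k : ℤ) (z : ℂ) : ℝ :=
  z.im * Real.cos (2 * Real.pi * k / m) - z.re * Real.sin (2 * Real.pi * k / m)

theorem polygonVertex_re (m k : ℕ) : (polygonVertex m k).re = Real.cos (2 * Real.pi * k / m) := by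
  have : polygonVertex m k = Complex.exp ((2 * Real.pi * k / m : ℝ) * Complex.I) := by
    unfold polygonVertex
    congr 1
    push_cast
    ring
  rw [this, Complex.exp_ofReal_mul_I_re]

theorem polygonVertex_im (m k : ℕ) : (polygonVertex m k).im = Real.sin (2 * Real.pi * k / m) := by
  have : polygonVertex m k = Complex.exp ((2 * Real.pi * k / m : ℝ) * Complex.I) := by
    unfold polygonVertex
    congr 1
    push_cast
    ring
  rw [this, Complex.exp_ofReal_mul_I_im]

theorem polygonVertex_add_self {m : ℕ} (hm : m ≠ 0) (k : ℕ) :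
    polygonVertex m (k + m) = polygonVertex m k := by
  have hm' : (m : ℝ) ≠ 0 := by exact_mod_cast hm
  have : 2 * Real.pi * ((k + m : ℕ) : ℝ) / m = 2 * Real.pi * k / m + 2 * Real.pi := by
    push_cast
    field_simp
  apply Complex.ext
  · rw [polygonVertex_re, polygonVertex_re, this, Real.cos_add_two_pi]
  · rw [polygonVertex_im, polygonVertex_im, this, Real.sin_add_two_pi]

theorem polygonVertex_mod {m : ℕ} (hm : m ≠ 0) (k : ℕ) :
    polygonVertex m (k % m) = polygonVertex m k := by
  conv_rhs => rw [← Nat.mod_add_div k m]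
  generalize k % m = a
  induction k / m with
  | zero => simp
  | succ d ih => rw [ih, Nat.mul_succ, ← add_assoc, polygonVertex_add_self hm]

theorem vertexCross_vertex (m : ℕ) (k : ℤ) (l : ℕ) :
    vertexCross m k (polygonVertex m l) = Real.sin (2 * Real.pi * ((l : ℤ) - k : ℤ) / m) := by
  rw [vertexCross, polygonVertex_re, polygonVertex_im, ← Real.sin_sub]
  congr 1
  push_cast
  ring

theorem vertexCross_combination (m : ℕ) (k : ℤ) (a b : ℝ) (z w : ℂ) :
    vertexCross m k (a • z + b • w) = a * vertexCross m k z + b * vertexCross m k w := by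
  simp [vertexCross]
  ring

theorem continuous_vertexCross (m : ℕ) (k : ℤ) : Continuous (vertexCross m k) := by
  unfold vertexCross
  fun_prop

theorem sin_nonneg_of_le {m : ℕ} (hm : 0 < m) {d : ℤ} (h0 : 0 ≤ d) (h1 : 2 * d ≤ m) :
    0 ≤ Real.sin (2 * Real.pi * d / m) := by
  have hm' : (0 : ℝ) < m := by exact_mod_cast hm
  have h0' : (0 : ℝ) ≤ d := by exact_mod_cast h0
  have h1' : 2 * (d : ℝ) ≤ m := by exact_mod_cast h1
  apply Real.sin_nonneg_of_nonneg_of_le_pi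
  · positivity
  · rw [div_le_iff₀ hm']
    nlinarith [Real.pi_pos]

theorem sin_neg_index (m : ℕ) (d : ℤ) :
    Real.sin (2 * Real.pi * (-d : ℤ) / m) = -Real.sin (2 * Real.pi * d / m) := by
  rw [← Real.sin_neg]
  congr 1
  push_cast
  ring

theorem sin_sub_self {m : ℕ} (hm : 0 < m) (d : ℤ) :
    Real.sin (2 * Real.pi * (d - m : ℤ) / m) = Real.sin (2 * Real.pi * d / m) := by
  have hm' : (m : ℝ) ≠ 0 := by exact_mod_cast hm.ne'
  rw [← Real.sin_sub_two_pi (2 * Real.pi * d / m)]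
  congr 1
  push_cast
  field_simp

theorem sin_nonpos_of_le {m : ℕ} (hm : 0 < m) {d : ℤ} (h0 : (m : ℤ) ≤ 2 * d) (h1 : d ≤ m) :
    Real.sin (2 * Real.pi * d / m) ≤ 0 := by
  have := sin_nonneg_of_le hm (d := -(d - m)) (by omega) (by omega)
  rw [sin_neg_index, sin_sub_self hm] at this
  linarith

theorem sin_two_pi_div_pos {m : ℕ} (hm : 3 ≤ m) : 0 < Real.sin (2 * Real.pi / m) := by
  have hm' : (3 : ℝ) ≤ m := by exact_mod_cast hm
  apply Real.sin_pos_of_pos_of_lt_pi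
  · have := Real.pi_pos
    positivity
  · rw [div_lt_iff₀ (by linarith)]
    nlinarith [Real.pi_pos]

/-- The coefficient of the vertex `j` in the piecewise linear coordinates on the plane with respect
to the fan spanned by the vertices of the regular `m`-gon, `m ≥ 4`. -/
noncomputable def coneCoord (m : ℕ) (j : ℤ) (z : ℂ) : ℝ :=
  max 0 (min (vertexCross m (j - 1) z) (-vertexCross m (j + 1) z) / Real.sin (2 * Real.pi / m))

theorem continuous_coneCoord (m : ℕ) (j : ℤ) : Continuous (coneCoord m j) := by
  unfold coneCoord
  have := continuous_vertexCross m
  fun_prop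

/-- With `s_d = sin (2πd/m)`, the two cross products are `a s₁ + b s₂` and `a s₁`. The minimum is
the second one because `s₂ ≥ 0`, which is where `4 ≤ m` is needed. -/
theorem coneCoord_sector_self {m : ℕ} (hm : 4 ≤ m) (k : ℕ) {a b : ℝ} (ha : 0 ≤ a) (hb : 0 ≤ b) :
    coneCoord m k (a • polygonVertex m k + b • polygonVertex m (k + 1)) = a := by
  have hs := sin_two_pi_div_pos (m := m) (by omega)
  have h2 := sin_nonneg_of_le (m := m) (by omega) (d := 2) (by omega) (by omega)
  have key : min (vertexCross m ((k : ℤ) - 1) (a • polygonVertex m k + b • polygonVertex m (k + 1)))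
      (-vertexCross m ((k : ℤ) + 1) (a • polygonVertex m k + b • polygonVertex m (k + 1))) =
      a * Real.sin (2 * Real.pi / m) := by
    simp only [vertexCross_combination, vertexCross_vertex]
    have e1 : ((k : ℕ) : ℤ) - ((k : ℤ) - 1) = 1 := by ring
    have e2 : ((k + 1 : ℕ) : ℤ) - ((k : ℤ) - 1) = 2 := by push_cast; ring
    have e3 : ((k : ℕ) : ℤ) - ((k : ℤ) + 1) = -1 := by ring
    have e4 : ((k + 1 : ℕ) : ℤ) - ((k : ℤ) + 1) = 0 := by push_cast; ring
    rw [e1, e2, e3, e4, sin_neg_index]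
    have h2' := mul_nonneg hb h2
    rw [min_eq_right]
    · simp
    · simp
      simpa using h2'
  rw [coneCoord, key, mul_div_cancel_right₀ _ hs.ne', max_eq_right ha]

theorem coneCoord_sector_succ {m : ℕ} (hm : 4 ≤ m) (k : ℕ) {a b : ℝ} (ha : 0 ≤ a) (hb : 0 ≤ b) :
    coneCoord m (k + 1) (a • polygonVertex m k + b • polygonVertex m (k + 1)) = b := by
  have hs := sin_two_pi_div_pos (m := m) (by omega)
  have h2 := sin_nonneg_of_le (m := m) (by omega) (d := 2) (by omega) (by omega)
  have key : min (vertexCross m ((k : ℤ) + 1 - 1)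
        (a • polygonVertex m k + b • polygonVertex m (k + 1)))
      (-vertexCross m ((k : ℤ) + 1 + 1) (a • polygonVertex m k + b • polygonVertex m (k + 1))) =
      b * Real.sin (2 * Real.pi / m) := by
    simp only [vertexCross_combination, vertexCross_vertex]
    have e1 : ((k : ℕ) : ℤ) - ((k : ℤ) + 1 - 1) = 0 := by ring
    have e2 : ((k + 1 : ℕ) : ℤ) - ((k : ℤ) + 1 - 1) = 1 := by push_cast; ring
    have e3 : ((k : ℕ) : ℤ) - ((k : ℤ) + 1 + 1) = -2 := by ring
    have e4 : ((k + 1 : ℕ) : ℤ) - ((k : ℤ) + 1 + 1) = -1 := by push_cast; ring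
    rw [e1, e2, e3, e4, sin_neg_index, sin_neg_index]
    have h2' := mul_nonneg ha h2
    rw [min_eq_left]
    · simp
    · simp
      simpa using h2'
  rw [coneCoord, key, mul_div_cancel_right₀ _ hs.ne', max_eq_right hb]

/-- The sector avoids the vertex `j`. It lies at most half a turn ahead of the vertex `j + 1` or at
most half a turn behind the vertex `j - 1`; in either case one of the two terms of the minimum is
nonpositive. -/
theorem coneCoord_sector_other {m : ℕ} (hm : 4 ≤ m) (j : ℤ) (k : ℕ) {a b : ℝ} (ha : 0 ≤ a)
    (hb : 0 ≤ b) (h1 : j < k) (h2 : k + 2 ≤ j + m) :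
    coneCoord m j (a • polygonVertex m k + b • polygonVertex m (k + 1)) = 0 := by
  have hs := sin_two_pi_div_pos (m := m) (by omega)
  rw [coneCoord, max_eq_left]
  apply div_nonpos_of_nonpos_of_nonneg _ hs.le
  simp only [vertexCross_combination, vertexCross_vertex]
  by_cases h : 2 * ((k : ℤ) - j) ≤ m
  · apply min_le_of_right_le
    have := mul_nonneg ha (sin_nonneg_of_le (m := m) (by omega) (d := (k : ℤ) - (j + 1))
      (by omega) (by omega))
    have := mul_nonneg hb (sin_nonneg_of_le (m := m) (by omega) (d := ((k + 1 : ℕ) : ℤ) - (j + 1))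
      (by push_cast; omega) (by push_cast; omega))
    linarith
  · apply min_le_of_left_le
    have := mul_nonneg ha (neg_nonneg.2 (sin_nonpos_of_le (m := m) (by omega)
      (d := (k : ℤ) - (j - 1)) (by omega) (by omega)))
    have := mul_nonneg hb (neg_nonneg.2 (sin_nonpos_of_le (m := m) (by omega)
      (d := ((k + 1 : ℕ) : ℤ) - (j - 1)) (by push_cast; omega) (by push_cast; omega)))
    linarith

theorem coneCoord_periodic {m : ℕ} (hm : m ≠ 0) (j : ℤ) (z : ℂ) :
    coneCoord m (j + m) z = coneCoord m j z := by
  have hm' : (m : ℝ) ≠ 0 := by exact_mod_cast hm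
  have h : ∀ k l : ℤ, l = k + m → vertexCross m l z = vertexCross m k z := by
    rintro k l rfl
    have : 2 * Real.pi * ((k + m : ℤ) : ℝ) / m = 2 * Real.pi * k / m + 2 * Real.pi := by
      push_cast
      field_simp
    rw [vertexCross, vertexCross, this, Real.cos_add_two_pi, Real.sin_add_two_pi]
  rw [coneCoord, coneCoord, h (j - 1) (j + m - 1) (by ring), h (j + 1) (j + m + 1) (by ring)]

/-- Every point of the plane lies in one of the sectors spanned by two adjacent vertices. -/
theorem exists_sector {m : ℕ} (hm : 3 ≤ m) (z : ℂ) :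
    ∃ k : ℕ, k < m ∧ ∃ a b : ℝ, 0 ≤ a ∧ 0 ≤ b ∧
      z = a • polygonVertex m k + b • polygonVertex m (k + 1) := by
  have hs := sin_two_pi_div_pos hm
  have hpi := Real.pi_pos
  have hm' : (0 : ℝ) < m := by exact_mod_cast (by omega : 0 < m)
  obtain ⟨r, θ, hr, h0, h1, hz⟩ : ∃ r θ : ℝ, 0 ≤ r ∧ 0 ≤ θ ∧ θ < 2 * Real.pi ∧
      z = r * Complex.exp (θ * Complex.I) := by
    by_cases harg : 0 ≤ z.arg
    · refine ⟨‖z‖, z.arg, norm_nonneg z, harg, ?_, (Complex.norm_mul_exp_arg_mul_I z).symm⟩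
      linarith [Complex.arg_le_pi z]
    · refine ⟨‖z‖, z.arg + 2 * Real.pi, norm_nonneg z, ?_, by linarith, ?_⟩
      · linarith [Complex.neg_pi_lt_arg z]
      · conv_lhs => rw [← Complex.norm_mul_exp_arg_mul_I z]
        congr 1
        push_cast
        rw [add_mul, Complex.exp_add, Complex.exp_two_pi_mul_I, mul_one]
  set t := 2 * Real.pi / m with ht
  have htpos : 0 < t := by positivity
  set k := ⌊θ / t⌋₊ with hk
  have hk0 : k * t ≤ θ := by
    have := Nat.floor_le (a := θ / t) (by positivity)
    rwa [le_div_iff₀ htpos] at this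
  have hk1 : θ < (k + 1) * t := by
    have := Nat.lt_floor_add_one (θ / t)
    rwa [div_lt_iff₀ htpos] at this
  have htpi : t ≤ Real.pi := by
    rw [ht, div_le_iff₀ hm']
    have : (3 : ℝ) ≤ m := by exact_mod_cast hm
    nlinarith
  -- The coefficients come from `sin t · e^{iu} = sin (t - u) + sin u · e^{it}`, where `u` is the
  -- angle past the vertex `k`.
  refine ⟨k, ?_, r * Real.sin ((k + 1) * t - θ) / Real.sin t, r * Real.sin (θ - k * t) / Real.sin t,
    ?_, ?_, ?_⟩
  · have : (k : ℝ) * t < m * t := by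
      have : m * t = 2 * Real.pi := by rw [ht]; field_simp
      linarith
    exact_mod_cast lt_of_mul_lt_mul_right this htpos.le
  · refine div_nonneg (mul_nonneg hr (Real.sin_nonneg_of_nonneg_of_le_pi ?_ ?_)) hs.le <;> linarith
  · refine div_nonneg (mul_nonneg hr (Real.sin_nonneg_of_nonneg_of_le_pi ?_ ?_)) hs.le <;> linarith
  · have e1 : 2 * Real.pi * k / m = k * t := by rw [ht]; ring
    have e2 : 2 * Real.pi * (k + 1 : ℕ) / m = k * t + t := by rw [ht]; push_cast; ring
    obtain ⟨u, hu⟩ : ∃ u, θ = k * t + u := ⟨θ - k * t, by ring⟩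
    have e3 : ((k : ℝ) + 1) * t - θ = t - u := by rw [hu]; ring
    have e4 : θ - k * t = u := by rw [hu]; ring
    rw [e3, e4]
    have hs' : Real.sin t ≠ 0 := hs.ne'
    apply Complex.ext
    · rw [hz, Complex.re_ofReal_mul, Complex.exp_ofReal_mul_I_re]
      simp only [Complex.add_re, Complex.real_smul, Complex.re_ofReal_mul, polygonVertex_re]
      rw [e1, e2, hu, Real.cos_add, Real.cos_add, Real.sin_sub]
      field_simp
      ring
    · rw [hz, Complex.im_ofReal_mul, Complex.exp_ofReal_mul_I_im]
      simp only [Complex.add_im, Complex.real_smul, Complex.im_ofReal_mul, polygonVertex_im]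
      rw [e1, e2, hu, Real.sin_add, Real.sin_add, Real.sin_sub]
      field_simp
      ring

/-- An odd multiple of `π / m` has cosine at most `cos (π / m)`. -/
theorem cos_odd_le {m : ℕ} (hm : 0 < m) {d : ℤ} (h0 : 1 ≤ d) (h1 : d + 1 ≤ 2 * m) :
    Real.cos (Real.pi * d / m) ≤ Real.cos (Real.pi / m) := by
  have hm' : (0 : ℝ) < m := by exact_mod_cast hm
  have hm1 : (1 : ℝ) ≤ m := by exact_mod_cast hm
  have hpi := Real.pi_pos
  have h0' : (1 : ℝ) ≤ d := by exact_mod_cast h0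
  have h1' : (d : ℝ) + 1 ≤ 2 * m := by exact_mod_cast h1
  have hle : Real.pi / m ≤ Real.pi := by
    rw [div_le_iff₀ hm']
    nlinarith
  by_cases h : Real.pi * d / m ≤ Real.pi
  · apply Real.cos_le_cos_of_nonneg_of_le_pi _ h
    · rw [div_le_div_iff_of_pos_right hm']
      nlinarith
    · positivity
  · rw [← Real.cos_two_pi_sub (Real.pi * d / m)]
    apply Real.cos_le_cos_of_nonneg_of_le_pi
    · positivity
    · linarith
    · rw [div_le_iff₀ hm', sub_mul, div_mul_cancel₀ _ hm'.ne']
      nlinarith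

/-- A point of a sector belongs to the polygon iff its coordinates add up to at most one. -/
theorem sector_mem_polygon_iff {m : ℕ} (hm : 3 ≤ m) {k : ℕ} (hk : k < m) {a b : ℝ} (ha : 0 ≤ a)
    (hb : 0 ≤ b) :
    a • polygonVertex m k + b • polygonVertex m (k + 1) ∈
      convexHull ℝ (Set.range (polygonVertex m)) ↔ a + b ≤ 1 := by
  have hpi := Real.pi_pos
  have hm' : (0 : ℝ) < m := by exact_mod_cast (by omega : 0 < m)
  constructor
  · intro h
    have hcos : 0 < Real.cos (Real.pi / m) := by
      apply Real.cos_pos_of_mem_Ioo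
      have : (3 : ℝ) ≤ m := by exact_mod_cast hm
      constructor
      · have : 0 < Real.pi / m := by positivity
        linarith
      · rw [div_lt_iff₀ hm']
        nlinarith
    -- The direction of the midpoint of the edge. The line through the edge bounds the half-plane
    -- `H`, which contains every vertex because the angle from `c` to a vertex is an odd multiple of
    -- `π / m`.
    let c : ℝ := Real.pi * (2 * k + 1) / m
    let H : Set ℂ := {z | z.re * Real.cos c + z.im * Real.sin c ≤ Real.cos (Real.pi / m)}
    have hH : Convex ℝ H := by
      have hlin : IsLinearMap ℝ fun z : ℂ => z.re * Real.cos c + z.im * Real.sin c :=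
        ⟨fun x y => by simp; ring, fun r x => by simp; ring⟩
      exact convex_halfSpace_le hlin _
    have hV : ∀ l : ℕ, (polygonVertex m l).re * Real.cos c + (polygonVertex m l).im * Real.sin c =
        Real.cos (Real.pi * (2 * (l : ℤ) - 2 * k - 1 : ℤ) / m) := by
      intro l
      rw [polygonVertex_re, polygonVertex_im, ← Real.cos_sub]
      congr 1
      push_cast
      simp only [c]
      ring
    have hsub : convexHull ℝ (Set.range (polygonVertex m)) ⊆ H := by
      apply convexHull_min _ hH
      rintro _ ⟨l, rfl⟩
      change (polygonVertex m l).re * _ + (polygonVertex m l).im * _ ≤ _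
      rw [← polygonVertex_mod (by omega) l, hV]
      have hl := Nat.mod_lt l (by omega : 0 < m)
      set l := l % m
      rcases lt_or_ge k l with h | h
      · exact cos_odd_le (by omega) (by omega) (by omega)
      · rw [← Real.cos_neg]
        convert cos_odd_le (m := m) (by omega) (d := -(2 * (l : ℤ) - 2 * k - 1)) (by omega)
          (by omega) using 2
        push_cast
        ring
    have h := hsub h
    have e1 := hV k
    have e2 := hV (k + 1)
    have h1 : Real.cos (Real.pi * (2 * (k : ℤ) - 2 * k - 1 : ℤ) / m) = Real.cos (Real.pi / m) := by
      rw [← Real.cos_neg]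
      congr 1
      push_cast
      ring
    have h2 : Real.cos (Real.pi * (2 * ((k + 1 : ℕ) : ℤ) - 2 * k - 1 : ℤ) / m) =
        Real.cos (Real.pi / m) := by
      congr 1
      push_cast
      ring
    rw [h1] at e1
    rw [h2] at e2
    have h : (a • polygonVertex m k + b • polygonVertex m (k + 1)).re * Real.cos c +
      (a • polygonVertex m k + b • polygonVertex m (k + 1)).im * Real.sin c ≤
        Real.cos (Real.pi / m) := h
    simp only [Complex.add_re, Complex.add_im, Complex.smul_re, Complex.smul_im, smul_eq_mul] at h
    have : (a + b) * Real.cos (Real.pi / m) ≤ 1 * Real.cos (Real.pi / m) := by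
      calc _ = a * ((polygonVertex m k).re * Real.cos c + (polygonVertex m k).im * Real.sin c) +
            b * ((polygonVertex m (k + 1)).re * Real.cos c +
              (polygonVertex m (k + 1)).im * Real.sin c) := by rw [e1, e2]; ring
        _ ≤ _ := by linarith
    exact le_of_mul_le_mul_right this hcos
  · intro h
    have hc := convex_convexHull ℝ (Set.range (polygonVertex m))
    have hmem : ∀ l, polygonVertex m l ∈ convexHull ℝ (Set.range (polygonVertex m)) :=
      fun l => subset_convexHull ℝ _ ⟨l, rfl⟩
    -- The center is the average of the vertices, since the `m`-th roots of unity add up to zero.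
    have hzero : (0 : ℂ) ∈ convexHull ℝ (Set.range (polygonVertex m)) := by
      have hprim := Complex.isPrimitiveRoot_exp m (by omega)
      have hpow : ∀ l : ℕ, polygonVertex m l = Complex.exp (2 * Real.pi * Complex.I / m) ^ l := by
        intro l
        rw [← Complex.exp_nat_mul, polygonVertex]
        congr 1
        ring
      have hsum : ∑ l ∈ Finset.range m, polygonVertex m l = 0 := by
        simp only [hpow]
        exact hprim.geom_sum_eq_zero (by omega)
      have := hc.sum_mem (t := Finset.range m) (w := fun _ => (1 : ℝ) / m) (z := polygonVertex m)
        (fun _ _ => by positivity) (by simp [hm'.ne']) (fun l _ => hmem l)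
      rwa [← Finset.smul_sum, hsum, smul_zero] at this
    have := hc.sum_mem (t := Finset.univ) (w := ![a, b, 1 - a - b])
      (z := ![polygonVertex m k, polygonVertex m (k + 1), 0])
      (by intro i _; fin_cases i <;> simp <;> linarith) (by simp [Fin.sum_univ_three])
      (by intro i _; fin_cases i <;> simp [hmem, hzero])
    simpa [Fin.sum_univ_three] using this

end PolygonGeometry

/-! ### The regular polygon and its edges -/

section PolygonEdges

/-- The cyclic successor on `Fin m`. -/
def cyclicSucc {m : ℕ} (j : Fin m) : Fin m := ⟨(j + 1) % m, Nat.mod_lt _ j.pos⟩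

theorem cyclicSucc_val {m : ℕ} (j : Fin m) :
    (cyclicSucc j : ℕ) = if (j : ℕ) + 1 = m then 0 else (j : ℕ) + 1 := by
  have := j.2
  unfold cyclicSucc
  split_ifs with h
  · simp [h]
  · exact Nat.mod_eq_of_lt (by omega)

theorem cyclicSucc_injective {m : ℕ} : Function.Injective (cyclicSucc (m := m)) := by
  intro i j h
  have h' := congrArg Fin.val h
  have := i.2
  have := j.2
  rw [cyclicSucc_val, cyclicSucc_val] at h'
  apply Fin.ext
  split_ifs at h' <;> omega

theorem cyclicSucc_surjective {m : ℕ} : Function.Surjective (cyclicSucc (m := m)) :=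
  Finite.surjective_of_injective cyclicSucc_injective

theorem cyclicSucc_ne {m : ℕ} (hm : 2 ≤ m) (j : Fin m) : cyclicSucc j ≠ j := by
  intro h
  have h' := congrArg Fin.val h
  rw [cyclicSucc_val] at h'
  split_ifs at h' <;> omega

theorem cyclicSucc_cyclicSucc_ne {m : ℕ} (hm : 3 ≤ m) (j : Fin m) :
    cyclicSucc (cyclicSucc j) ≠ j := by
  intro h
  have h' := congrArg Fin.val h
  rw [cyclicSucc_val, cyclicSucc_val] at h'
  split_ifs at h' <;> omega

theorem cyclicSucc_mod_two {m : ℕ} (hm : Even m) (j : Fin m) :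
    (cyclicSucc j : ℕ) % 2 = 1 - (j : ℕ) % 2 := by
  obtain ⟨r, rfl⟩ := hm
  rw [cyclicSucc_val]
  split_ifs <;> omega

theorem polygonVertex_cyclicSucc {m : ℕ} (j : Fin m) :
    polygonVertex m (cyclicSucc j) = polygonVertex m (j + 1) :=
  polygonVertex_mod j.pos.ne' _

theorem coneCoord_sector {m : ℕ} (hm : 4 ≤ m) (j k : Fin m) {a b : ℝ} (ha : 0 ≤ a) (hb : 0 ≤ b) :
    coneCoord m j (a • polygonVertex m k + b • polygonVertex m (k + 1)) =
      (if j = k then a else 0) + (if j = cyclicSucc k then b else 0) := by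
  have hk := k.2
  have hj := j.2
  by_cases h1 : j = k
  · subst h1
    rw [if_pos rfl, if_neg (cyclicSucc_ne (by omega) j).symm, add_zero]
    exact coneCoord_sector_self hm j ha hb
  rw [if_neg h1, zero_add]
  have h1' : (j : ℕ) ≠ k := fun h => h1 (Fin.ext h)
  split_ifs with h2
  · have h2' := congrArg Fin.val h2
    rw [cyclicSucc_val] at h2'
    split_ifs at h2' with h3
    · rw [← coneCoord_periodic (by omega), show ((j : ℕ) : ℤ) + m = (k : ℕ) + 1 by omega]
      exact coneCoord_sector_succ hm k ha hb
    · rw [show ((j : ℕ) : ℤ) = (k : ℕ) + 1 by omega]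
      exact coneCoord_sector_succ hm k ha hb
  · have h2' : (j : ℕ) ≠ cyclicSucc k := fun h => h2 (Fin.ext h)
    rw [cyclicSucc_val] at h2'
    rcases lt_or_gt_of_ne h1' with h | h
    · refine coneCoord_sector_other hm _ k ha hb (by omega) ?_
      split_ifs at h2' <;> omega
    · have e : ((j : ℕ) : ℤ) = (((j : ℕ) : ℤ) - m) + m := by ring
      rw [e, coneCoord_periodic (by omega)]
      refine coneCoord_sector_other hm _ k ha hb (by omega) ?_
      split_ifs at h2' <;> omega

theorem exists_sector_polygon {m : ℕ} (hm : 3 ≤ m) (p : RegularPolygon m) :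
    ∃ (k : Fin m) (a b : ℝ), 0 ≤ a ∧ 0 ≤ b ∧ a + b ≤ 1 ∧
      (p : ℂ) = a • polygonVertex m k + b • polygonVertex m (k + 1) := by
  obtain ⟨k, hk, a, b, ha, hb, h⟩ := exists_sector hm p
  refine ⟨⟨k, hk⟩, a, b, ha, hb, ?_, h⟩
  rw [← sector_mem_polygon_iff hm hk ha hb, ← h]
  exact p.2

theorem sum_coneCoord_smul {m : ℕ} (hm : 4 ≤ m) (z : ℂ) :
    ∑ j : Fin m, coneCoord m j z • polygonVertex m j = z := by
  obtain ⟨k, hk, a, b, ha, hb, rfl⟩ := exists_sector (by omega : 3 ≤ m) z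
  have := fun j => coneCoord_sector hm j ⟨k, hk⟩ ha hb
  simp only at this
  simp only [this, add_smul, ite_smul, zero_smul, Finset.sum_add_distrib, Finset.sum_ite_eq',
    Finset.mem_univ, if_true]
  rw [polygonVertex_cyclicSucc]

/-- In sector `k` only the coordinates `k` and `k + 1` can be nonzero, and their sum is at most 1.
Two consecutive coordinates reach the sum 1 only on edge `k` or, when they belong to a neighboring
edge, at the common vertex. -/
theorem mem_polygonEdge_iff {m : ℕ} (hm : 4 ≤ m) (j : Fin m) (p : RegularPolygon m) :
    p ∈ polygonEdge m j ↔ coneCoord m j p + coneCoord m (cyclicSucc j) p = 1 := by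
  have n1 := fun j : Fin m => cyclicSucc_ne (by omega) j
  have n2 := fun j : Fin m => cyclicSucc_cyclicSucc_ne (by omega) j
  constructor
  · rintro ⟨a, b, ha, hb, hab, h⟩
    rw [← h, coneCoord_sector hm _ _ ha hb, coneCoord_sector hm _ _ ha hb]
    simp [n1, (n1 _).symm, hab]
  · intro h
    obtain ⟨k, a, b, ha, hb, hab, hp⟩ := exists_sector_polygon (by omega) p
    change (p : ℂ) ∈ segment ℝ _ _
    rw [hp, coneCoord_sector hm _ _ ha hb, coneCoord_sector hm _ _ ha hb] at h
    by_cases h1 : j = k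
    · subst h1
      simp only [if_true, (n1 j).symm, n1, if_false, add_zero, zero_add] at h
      exact ⟨a, b, ha, hb, h, hp.symm⟩
    · by_cases h2 : j = cyclicSucc k
      · subst h2
        simp only [n1, n2, if_true, if_false, add_zero, zero_add] at h
        have ha0 : a = 0 := by linarith
        refine ⟨1, 0, by norm_num, le_rfl, by norm_num, ?_⟩
        rw [hp, ha0, h, polygonVertex_cyclicSucc]
        simp
      · by_cases h3 : cyclicSucc j = k
        · subst h3
          simp only [h1, h2, (n1 _).symm, if_true, if_false, add_zero, zero_add] at h
          have hb0 : b = 0 := by linarith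
          refine ⟨0, 1, le_rfl, by norm_num, by norm_num, ?_⟩
          rw [hp, hb0, h, polygonVertex_cyclicSucc]
          simp
        · rw [if_neg h1, if_neg h2, if_neg h3, if_neg (fun h => h1 (cyclicSucc_injective h))] at h
          norm_num at h

/-- In a polygon with an even number of edges, meeting edges of the same parity are equal. -/
theorem eq_of_mem_polygonEdge {m : ℕ} (hm : 4 ≤ m) (he : Even m) {j k : Fin m}
    {p : RegularPolygon m} (hj : p ∈ polygonEdge m j) (hk : p ∈ polygonEdge m k)
    (h : (j : ℕ) % 2 = (k : ℕ) % 2) : j = k := by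
  obtain ⟨a, b, ha, hb, hab, hp⟩ := hk
  rw [mem_polygonEdge_iff hm, ← hp, coneCoord_sector hm _ _ ha hb, coneCoord_sector hm _ _ ha hb]
    at hj
  by_contra hne
  have h1 : j ≠ cyclicSucc k := by
    rintro rfl
    rw [cyclicSucc_mod_two he] at h
    omega
  have h2 : cyclicSucc j ≠ k := by
    rintro rfl
    rw [cyclicSucc_mod_two he] at h
    omega
  rw [if_neg hne, if_neg h1, if_neg h2, if_neg (fun h => hne (cyclicSucc_injective h))] at hj
  norm_num at hj

/-- The common vertex of the edges `j` and `j + 1`. -/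
noncomputable def edgeEnd {m : ℕ} (j : Fin m) : RegularPolygon m :=
  ⟨polygonVertex m (j + 1), subset_convexHull ℝ _ ⟨_, rfl⟩⟩

theorem edgeEnd_mem {m : ℕ} (j : Fin m) : edgeEnd j ∈ polygonEdge m j :=
  right_mem_segment ℝ _ _

theorem edgeEnd_mem_cyclicSucc {m : ℕ} (j : Fin m) : edgeEnd j ∈ polygonEdge m (cyclicSucc j) := by
  change polygonVertex m (j + 1) ∈
    segment ℝ (polygonVertex m (cyclicSucc j)) (polygonVertex m (cyclicSucc j + 1))
  rw [← polygonVertex_cyclicSucc j]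
  exact left_mem_segment ℝ (polygonVertex m (cyclicSucc j)) (polygonVertex m (cyclicSucc j + 1))

theorem isClosed_polygonEdge {m : ℕ} (j : Fin m) : IsClosed (polygonEdge m j) := by
  have : IsClosed (segment ℝ (polygonVertex m j) (polygonVertex m (j + 1))) := by
    rw [← convexHull_pair]
    exact ((Set.toFinite {polygonVertex m j, polygonVertex m (j + 1)}).isClosed_convexHull ℝ)
  exact this.preimage continuous_subtype_val

theorem compactSpace_regularPolygon {m : ℕ} (hm : m ≠ 0) : CompactSpace (RegularPolygon m) := by
  rw [← isCompact_iff_compactSpace]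
  apply Set.Finite.isCompact_convexHull
  refine ((Finset.range m).finite_toSet.image (polygonVertex m)).subset ?_
  rintro _ ⟨k, rfl⟩
  exact ⟨k % m, by simpa using Nat.mod_lt k (by omega), polygonVertex_mod hm k⟩

instance (m : ℕ) : Nonempty (RegularPolygon m) :=
  ⟨⟨polygonVertex m 0, subset_convexHull ℝ _ ⟨_, rfl⟩⟩⟩

theorem isClosed_productFacet {n : ℕ} (m : Fin n → ℕ) (k : Facet m) :
    IsClosed (productFacet m k) :=
  (isClosed_polygonEdge k.2).preimage (continuous_apply k.1)

end PolygonEdges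

/-! ### Squares and square regroupings -/

section Square

/-- The two affine coordinates in which the square `P_4` is `[-1, 1] × [-1, 1]`. -/
def squareCoord (d : Fin 2) (z : ℂ) : ℝ := if d = 0 then z.re + z.im else z.im - z.re

theorem continuous_squareCoord (d : Fin 2) : Continuous (squareCoord d) := by
  unfold squareCoord
  split_ifs <;> fun_prop

theorem polygonVertex_four :
    polygonVertex 4 0 = 1 ∧ polygonVertex 4 1 = Complex.I ∧ polygonVertex 4 2 = -1 ∧
      polygonVertex 4 3 = -Complex.I ∧ polygonVertex 4 4 = 1 := by
  have h0 : polygonVertex 4 0 = 1 := by simp [polygonVertex]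
  have h1 : polygonVertex 4 1 = Complex.I := by
    rw [polygonVertex, show (2 * Real.pi * Complex.I * (1 : ℕ) / (4 : ℕ) : ℂ) =
      Real.pi / 2 * Complex.I by push_cast; ring, Complex.exp_pi_div_two_mul_I]
  have h : ∀ k, polygonVertex 4 k = polygonVertex 4 1 ^ k := by
    intro k
    rw [polygonVertex, polygonVertex, ← Complex.exp_nat_mul]
    congr 1
    push_cast
    ring
  refine ⟨h0, h1, ?_, ?_, ?_⟩
  · rw [h, h1, Complex.I_sq]
  · rw [h, h1, Complex.I_pow_three]
  · rw [h, h1, Complex.I_pow_four]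

theorem mem_square_iff {m : ℕ} (hm : m = 4) (z : ℂ) :
    z ∈ convexHull ℝ (Set.range (polygonVertex m)) ↔ ∀ d, |squareCoord d z| ≤ 1 := by
  subst hm
  obtain ⟨h0, h1, h2, h3, h4⟩ := polygonVertex_four
  obtain ⟨k, hk, a, b, ha, hb, rfl⟩ := exists_sector (by norm_num : 3 ≤ 4) z
  rw [sector_mem_polygon_iff (by norm_num) hk ha hb]
  simp only [squareCoord, Fin.forall_fin_two, abs_le]
  interval_cases k <;> simp [h0, h1, h2, h3, h4] <;> constructor <;> intros <;>
    (try constructor) <;> (try constructor) <;> linarith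

theorem mem_squareEdge_iff {m : ℕ} (hm : m = 4) (p : RegularPolygon m) (j : Fin m) :
    p ∈ polygonEdge m j ↔
      squareCoord ⟨j % 2, Nat.mod_lt _ two_pos⟩ p = (-1) ^ ((j : ℕ) / 2) := by
  have hp := (mem_square_iff hm _).1 p.2
  subst hm
  obtain ⟨z, hz⟩ := p
  obtain ⟨h0, h1, h2, h3, h4⟩ := polygonVertex_four
  change z ∈ segment ℝ _ _ ↔ _
  simp only [squareCoord, Fin.forall_fin_two, abs_le] at hp
  simp only [if_true, Fin.one_eq_zero_iff, OfNat.ofNat_ne_one, if_false] at hp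
  obtain ⟨⟨p1, p2⟩, p3, p4⟩ := hp
  constructor
  · rintro ⟨a, b, ha, hb, hab, rfl⟩
    fin_cases j <;> simp [squareCoord, h0, h1, h2, h3, h4] <;> linarith
  · intro h
    fin_cases j <;> simp [squareCoord] at h <;> simp [h0, h1, h2, h3, h4]
    · refine ⟨z.re, z.im, by linarith, by linarith, by linarith, ?_⟩
      apply Complex.ext <;> simp
    · refine ⟨z.im, -z.re, by linarith, by linarith, by linarith, ?_⟩
      apply Complex.ext <;> simp
    · refine ⟨-z.re, -z.im, by linarith, by linarith, by linarith, ?_⟩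
      apply Complex.ext <;> simp
    · refine ⟨-z.im, z.re, by linarith, by linarith, by linarith, ?_⟩
      apply Complex.ext <;> simp

/-- The point of the square with given coordinates. -/
noncomputable def squarePoint (u : Fin 2 → ℝ) : ℂ := ⟨(u 0 - u 1) / 2, (u 0 + u 1) / 2⟩

theorem squareCoord_squarePoint (u : Fin 2 → ℝ) (d : Fin 2) : squareCoord d (squarePoint u) = u d := by
  fin_cases d <;> simp [squareCoord, squarePoint] <;> ring

theorem squarePoint_squareCoord (z : ℂ) : squarePoint (fun d => squareCoord d z) = z := by
  apply Complex.ext <;> simp [squareCoord, squarePoint] <;> ring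

theorem continuous_squarePoint : Continuous squarePoint := by
  have : squarePoint = fun u => ((((u 0 - u 1) / 2 : ℝ) : ℂ) + ((u 0 + u 1) / 2 : ℝ) * Complex.I) := by
    funext u
    apply Complex.ext <;> simp [squarePoint]
  rw [this]
  fun_prop

variable {n : ℕ} {m : Fin n → ℕ}

/-- The coordinate of a point of the product in an interval direction. -/
def directionCoord (d : IntervalDirection m) (p : PolygonProduct m) : ℝ :=
  squareCoord d.2 (p d.1)

/-- The self-map of the product that permutes the interval directions. -/
noncomputable def regroupMap (π : Equiv.Perm (IntervalDirection m)) (p : PolygonProduct m) :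
    PolygonProduct m := fun i =>
  if h : m i = 4 then
    ⟨squarePoint fun d => directionCoord (π (⟨i, h⟩, d)) p, (mem_square_iff h _).2 fun d => by
      rw [squareCoord_squarePoint]
      exact (mem_square_iff (π (⟨i, h⟩, d)).1.2 _).1 (p (π (⟨i, h⟩, d)).1).2 _⟩
  else p i

theorem regroupMap_square (π : Equiv.Perm (IntervalDirection m)) (p : PolygonProduct m) {i : Fin n}
    (h : m i = 4) : (regroupMap π p i : ℂ) = squarePoint fun d => directionCoord (π (⟨i, h⟩, d)) p := by
  simp only [regroupMap, dif_pos h]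

theorem regroupMap_other (π : Equiv.Perm (IntervalDirection m)) (p : PolygonProduct m) {i : Fin n}
    (h : m i ≠ 4) : regroupMap π p i = p i := by
  simp only [regroupMap, dif_neg h]

theorem directionCoord_regroupMap (π : Equiv.Perm (IntervalDirection m)) (p : PolygonProduct m)
    (d : IntervalDirection m) : directionCoord d (regroupMap π p) = directionCoord (π d) p := by
  obtain ⟨⟨i, h⟩, d⟩ := d
  change squareCoord d (regroupMap π p i) = _
  rw [regroupMap_square π p h, squareCoord_squarePoint]

theorem regroupMap_regroupMap (π π' : Equiv.Perm (IntervalDirection m)) (h : π * π' = 1)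
    (p : PolygonProduct m) : regroupMap π' (regroupMap π p) = p := by
  funext i
  by_cases hi : m i = 4
  · apply Subtype.ext
    rw [regroupMap_square _ _ hi]
    simp only [directionCoord_regroupMap, ← Equiv.Perm.mul_apply, h]
    exact squarePoint_squareCoord _
  · rw [regroupMap_other _ _ hi, regroupMap_other _ _ hi]

theorem continuous_regroupMap (π : Equiv.Perm (IntervalDirection m)) : Continuous (regroupMap π) := by
  refine continuous_pi fun i => ?_
  by_cases hi : m i = 4
  · rw [continuous_induced_rng]
    have : (fun p => ((regroupMap π p i : RegularPolygon (m i)) : ℂ)) =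
        fun p => squarePoint fun d => directionCoord (π (⟨i, hi⟩, d)) p :=
      funext fun p => regroupMap_square π p hi
    change Continuous fun p => ((regroupMap π p i : RegularPolygon (m i)) : ℂ)
    rw [this]
    refine continuous_squarePoint.comp (continuous_pi fun d => ?_)
    exact (continuous_squareCoord _).comp (continuous_subtype_val.comp (continuous_apply _))
  · have : (fun p => regroupMap π p i) = fun p => p i := funext fun p => regroupMap_other π p hi
    rw [this]
    exact continuous_apply i

/-- The homeomorphism of the product that realizes a square regrouping. -/
noncomputable def regroupHomeo (π : Equiv.Perm (IntervalDirection m)) :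
    PolygonProduct m ≃ₜ PolygonProduct m where
  toFun := regroupMap π
  invFun := regroupMap π⁻¹
  left_inv := regroupMap_regroupMap π π⁻¹ (mul_inv_cancel π)
  right_inv := regroupMap_regroupMap π⁻¹ π (inv_mul_cancel π)
  continuous_toFun := continuous_regroupMap π
  continuous_invFun := continuous_regroupMap π⁻¹

theorem mem_productFacet_square (p : PolygonProduct m) (k : Facet m) (h : m k.1 = 4) :
    p ∈ productFacet m k ↔
      directionCoord (⟨k.1, h⟩, ⟨k.2 % 2, Nat.mod_lt _ two_pos⟩) p = (-1) ^ ((k.2 : ℕ) / 2) :=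
  mem_squareEdge_iff h (p k.1) k.2

theorem facet_ext {k l : Facet m} (h1 : k.1 = l.1) (h2 : (k.2 : ℕ) = l.2) : k = l := by
  obtain ⟨i, j⟩ := k
  obtain ⟨i', j'⟩ := l
  subst h1
  exact congrArg _ (Fin.ext h2)

theorem regroupFacet_square (π : Equiv.Perm (IntervalDirection m)) (k : Facet m) (h : m k.1 = 4) :
    (regroupFacet m π k).1 = (π (⟨k.1, h⟩, ⟨k.2 % 2, Nat.mod_lt _ two_pos⟩)).1.1 ∧
    ((regroupFacet m π k).2 : ℕ) =
      (π (⟨k.1, h⟩, ⟨k.2 % 2, Nat.mod_lt _ two_pos⟩)).2.val + 2 * (k.2.val / 2) := by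
  have hr : regroupFacet m π k = ⟨(π (⟨k.1, h⟩, ⟨k.2 % 2, Nat.mod_lt _ two_pos⟩)).1.1,
      ⟨(π (⟨k.1, h⟩, ⟨k.2 % 2, Nat.mod_lt _ two_pos⟩)).2.val + 2 * (k.2.val / 2), by
        have h1 := (π (⟨k.1, h⟩, ⟨k.2 % 2, Nat.mod_lt _ two_pos⟩)).1.2
        omega⟩⟩ := by
    simp only [regroupFacet, dif_pos h]
  rw [hr]
  exact ⟨rfl, rfl⟩

theorem regroupFacet_other (π : Equiv.Perm (IntervalDirection m)) (k : Facet m) (h : m k.1 ≠ 4) :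
    regroupFacet m π k = k := by
  simp only [regroupFacet, dif_neg h]

/-- The new coordinate in direction `d` is the old coordinate in direction `π d`. The parity of an
edge index is its direction, and its quotient by 2 is the side, which the relabelling keeps. -/
theorem regroupMap_mem_productFacet (π : Equiv.Perm (IntervalDirection m)) (p : PolygonProduct m)
    (k : Facet m) : regroupMap π p ∈ productFacet m k ↔ p ∈ productFacet m (regroupFacet m π k) := by
  by_cases h : m k.1 = 4
  · obtain ⟨h1, h2⟩ := regroupFacet_square π k h
    have hr : m (regroupFacet m π k).1 = 4 := h1 ▸ (π _).1.2
    rw [mem_productFacet_square _ _ h, directionCoord_regroupMap, mem_productFacet_square _ _ hr]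
    have e1 : (⟨⟨(regroupFacet m π k).1, hr⟩,
        ⟨(regroupFacet m π k).2 % 2, Nat.mod_lt _ two_pos⟩⟩ : IntervalDirection m) =
        π (⟨k.1, h⟩, ⟨k.2 % 2, Nat.mod_lt _ two_pos⟩) := by
      refine Prod.ext (Subtype.ext h1) (Fin.ext ?_)
      dsimp only
      omega
    have e2 : ((regroupFacet m π k).2 : ℕ) / 2 = (k.2 : ℕ) / 2 := by omega
    rw [e1, e2]
  · rw [regroupFacet_other _ _ h]
    change regroupMap π p k.1 ∈ polygonEdge _ _ ↔ p k.1 ∈ polygonEdge _ _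
    rw [regroupMap_other _ _ h]

theorem regroupFacet_regroupFacet (π π' : Equiv.Perm (IntervalDirection m)) (h : π' * π = 1)
    (k : Facet m) : regroupFacet m π' (regroupFacet m π k) = k := by
  by_cases hi : m k.1 = 4
  · obtain ⟨h1, h2⟩ := regroupFacet_square π k hi
    have hr : m (regroupFacet m π k).1 = 4 := h1 ▸ (π _).1.2
    obtain ⟨h3, h4⟩ := regroupFacet_square π' (regroupFacet m π k) hr
    have e1 : (⟨⟨(regroupFacet m π k).1, hr⟩,
        ⟨(regroupFacet m π k).2 % 2, Nat.mod_lt _ two_pos⟩⟩ : IntervalDirection m) =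
        π (⟨k.1, hi⟩, ⟨k.2 % 2, Nat.mod_lt _ two_pos⟩) := by
      refine Prod.ext (Subtype.ext h1) (Fin.ext ?_)
      dsimp only
      omega
    rw [e1, ← Equiv.Perm.mul_apply, h, Equiv.Perm.one_apply] at h3 h4
    refine facet_ext h3 ?_
    dsimp only at h4
    omega
  · rw [regroupFacet_other _ _ hi, regroupFacet_other _ _ hi]

/-- The permutation of the facets given by a square regrouping. -/
def regroupFacetEquiv (π : Equiv.Perm (IntervalDirection m)) : Facet m ≃ Facet m where
  toFun := regroupFacet m π
  invFun := regroupFacet m π⁻¹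
  left_inv := regroupFacet_regroupFacet π π⁻¹ (inv_mul_cancel π)
  right_inv := regroupFacet_regroupFacet π⁻¹ π (mul_inv_cancel π)

/-- The bijection of the facets given by a reordering of the factors. -/
def permuteFacetEquiv (s : Equiv.Perm (Fin n)) : Facet (m ∘ s) ≃ Facet m :=
  Equiv.sigmaCongrLeft (β := fun i => Fin (m i)) s

/-- The homeomorphism of products given by a reordering of the factors. -/
noncomputable def permuteHomeo (s : Equiv.Perm (Fin n)) : PolygonProduct m ≃ₜ PolygonProduct (m ∘ s) :=
  (Homeomorph.piCongrLeft (Y := fun i => RegularPolygon (m i)) s).symm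

/-- The relabelling of the facets by a regrouping and a reordering. -/
def relabelFacet (π : Equiv.Perm (IntervalDirection m)) (s : Equiv.Perm (Fin n)) :
    Facet (m ∘ s) ≃ Facet m :=
  (permuteFacetEquiv s).trans (regroupFacetEquiv π)

/-- The homeomorphism of products that realizes a regrouping and a reordering. -/
noncomputable def relabelHomeo (π : Equiv.Perm (IntervalDirection m)) (s : Equiv.Perm (Fin n)) :
    PolygonProduct m ≃ₜ PolygonProduct (m ∘ s) :=
  (regroupHomeo π).trans (permuteHomeo s)

theorem relabelHomeo_mem (π : Equiv.Perm (IntervalDirection m)) (s : Equiv.Perm (Fin n))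
    (p : PolygonProduct m) (k : Facet (m ∘ s)) :
    relabelHomeo π s p ∈ productFacet (m ∘ s) k ↔ p ∈ productFacet m (relabelFacet π s k) :=
  regroupMap_mem_productFacet π p (permuteFacet m s k)

theorem relabelHomeo_image (π : Equiv.Perm (IntervalDirection m)) (s : Equiv.Perm (Fin n))
    (k : Facet (m ∘ s)) :
    relabelHomeo π s '' productFacet m (relabelFacet π s k) = productFacet (m ∘ s) k := by
  ext q
  obtain ⟨p, rfl⟩ := (relabelHomeo π s).surjective q
  rw [relabelHomeo_mem]
  simp

end Square

/-! ### Normal form of a characteristic matrix with compatible factors -/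

section NormalForm

variable {n : ℕ} {m : Fin n → ℕ}

theorem zmod_two_cases (x : ZMod 2) : x = 0 ∨ x = 1 := by
  revert x
  decide

theorem zmod_two_add_self (x : ZMod 2) : x + x = 0 := by
  revert x
  decide

/-- The first two edges of a polygon. -/
def baseEdge (hm : ∀ i, 3 ≤ m i) (i : Fin n) (r : Fin 2) : Fin (m i) :=
  ⟨r, by have := hm i; have := r.2; omega⟩

theorem cyclicSucc_baseEdge (hm : ∀ i, 3 ≤ m i) (i : Fin n) :
    cyclicSucc (baseEdge hm i 0) = baseEdge hm i 1 := by
  apply Fin.ext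
  have := hm i
  rw [cyclicSucc_val]
  simp [baseEdge]
  omega

/-- A characteristic matrix on a product of polygons in coordinates in which the columns of the first
two edges of each polygon are the standard basis, and in which the factor weights are the sums of the
two rows of each block. -/
structure IsNormalized (hm : ∀ i, 3 ≤ m i) (M : Matrix (Fin n × Fin 2) (Facet m) (ZMod 2)) :
    Prop where
  isCharacteristic : IsCharacteristic (productFacet m) M
  row_add : ∀ i k, M (i, 0) k + M (i, 1) k = factorWeight m i k
  base : ∀ i r a, M a ⟨i, baseEdge hm i r⟩ = if a = (i, r) then 1 else 0

theorem sum_facet (f : Facet m → ZMod 2) (M : Facet m → ZMod 2) (c : Fin n → ZMod 2)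
    (j : ∀ i, Fin (m i))
    (hf : ∀ i q, f ⟨i, q⟩ = c i * ((if q = j i then 1 else 0) +
      if q = cyclicSucc (j i) then 1 else 0)) :
    ∑ k, M k * f k = ∑ i, c i * (M ⟨i, j i⟩ + M ⟨i, cyclicSucc (j i)⟩) := by
  rw [Fintype.sum_sigma]
  refine Finset.sum_congr rfl fun i _ => ?_
  simp only [hf, mul_add, mul_ite, mul_one, mul_zero, Finset.sum_add_distrib, Finset.sum_ite_eq',
    Finset.mem_univ, if_true]
  ring

/-- A square matrix formed by the columns at a vertex is invertible, so a characteristic matrix with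
compatible factors can be normalized. -/
theorem exists_isNormalized (hm : ∀ i, 3 ≤ m i) {L : Matrix (Fin n × Fin 2) (Facet m) (ZMod 2)}
    (hL : IsCharacteristic (productFacet m) L)
    (hw : ∀ i, factorWeight m i ∈ Submodule.span (ZMod 2) (Set.range L.row)) :
    ∃ (θ : (Fin n × Fin 2 → ZMod 2) ≃ₗ[ZMod 2] (Fin n × Fin 2 → ZMod 2))
      (M : Matrix (Fin n × Fin 2) (Facet m) (ZMod 2)),
      (∀ k, θ (L.col k) = M.col k) ∧ IsNormalized hm M := by
  classical
  let E : (Fin n × Fin 2 → ZMod 2) →ₗ[ZMod 2] (Fin n × Fin 2 → ZMod 2) :=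
    Fintype.linearCombination (ZMod 2) (fun a : Fin n × Fin 2 => L.col ⟨a.1, baseEdge hm a.1 a.2⟩)
  -- In each polygon the two base edges meet at `edgeEnd (baseEdge hm i 0)`, so all the chosen
  -- facets pass through one vertex of the product.
  have hE : Function.Injective E := by
    rw [injective_iff_map_eq_zero]
    intro x hx
    have h := (isCharacteristic_iff _ _).1 hL
      (fun k => ∑ r, if k.2 = baseEdge hm k.1 r then x (k.1, r) else 0)
      (fun i => edgeEnd (baseEdge hm i 0)) (by
        intro k hk
        obtain ⟨r, -, hr⟩ := Finset.exists_ne_zero_of_sum_ne_zero hk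
        have hr' : k.2 = baseEdge hm k.1 r := by
          by_contra h
          simp [h] at hr
        change edgeEnd (baseEdge hm k.1 0) ∈ polygonEdge (m k.1) k.2
        rw [hr']
        fin_cases r
        · exact edgeEnd_mem _
        · change _ ∈ polygonEdge _ (baseEdge hm k.1 1)
          rw [← cyclicSucc_baseEdge]
          exact edgeEnd_mem_cyclicSucc _) (by
        rw [← hx, mulVec_eq_sum_col, Fintype.sum_sigma, Fintype.linearCombination_apply,
          Fintype.sum_prod_type]
        refine Finset.sum_congr rfl fun i _ => ?_
        simp only [Finset.sum_smul]
        rw [Finset.sum_comm]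
        refine Finset.sum_congr rfl fun r _ => ?_
        simp only [ite_smul, zero_smul, Finset.sum_ite_eq', Finset.mem_univ, if_true])
    funext ⟨i, r⟩
    have h' := congrFun h ⟨i, baseEdge hm i r⟩
    have hinj : ∀ r', baseEdge hm i r = baseEdge hm i r' ↔ r = r' := by
      intro r'
      simp [baseEdge, Fin.ext_iff]
    simpa [hinj] using h'
  let e := LinearEquiv.ofInjectiveEndo E hE
  have he : ∀ x, e x = ∑ a, x a • L.col ⟨a.1, baseEdge hm a.1 a.2⟩ := fun x =>
    Fintype.linearCombination_apply _ _ _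
  refine ⟨e.symm, fun a k => e.symm (L.col k) a, fun k => rfl, ?_, ?_, ?_⟩
  · exact hL.transport id (Equiv.refl _) e.symm.toLinearMap e.symm.injective (fun k p h => h)
      (fun k => rfl)
  · intro i k
    obtain ⟨c, hc⟩ := (Submodule.mem_span_range_iff_exists_fun _).1 (hw i)
    have hc' : ∀ k, ∑ r, c r * L r k = factorWeight m i k := by
      intro k
      rw [← hc]
      simp
    -- The functional `c` that produces `χ_i`, written in the basis of base columns: `χ_i` is 1 on
    -- the two base facets of factor `i` and 0 on all other base facets.
    have key : ∀ x : Fin n × Fin 2 → ZMod 2, ∑ r, c r * e x r = x (i, 0) + x (i, 1) := by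
      intro x
      have : ∀ r, c r * e x r = ∑ a, x a * (c r * L r ⟨a.1, baseEdge hm a.1 a.2⟩) := by
        intro r
        rw [he, Finset.sum_apply, Finset.mul_sum]
        refine Finset.sum_congr rfl fun a _ => ?_
        simp
        ring
      simp only [this]
      rw [Finset.sum_comm]
      simp only [← Finset.mul_sum, hc']
      rw [Fintype.sum_prod_type]
      simp [factorWeight]
    have := key (e.symm (L.col k))
    rw [LinearEquiv.apply_symm_apply] at this
    rw [← hc' k, ← this]
    rfl
  · intro i r a
    have : L.col ⟨i, baseEdge hm i r⟩ = e (Pi.single (i, r) 1) := by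
      rw [he, Finset.sum_eq_single (i, r)]
      · simp
      · intro b _ hb
        simp [hb]
      · simp
    change e.symm (L.col ⟨i, baseEdge hm i r⟩) a = _
    rw [this, LinearEquiv.symm_apply_apply, Pi.single_apply]

namespace IsNormalized

variable {hm : ∀ i, 3 ≤ m i} {M : Matrix (Fin n × Fin 2) (Facet m) (ZMod 2)}

/-- The second row of block `t` of the sum of two adjacent columns of factor `i`. -/
def cornerEntry (M : Matrix (Fin n × Fin 2) (Facet m) (ZMod 2)) (t i : Fin n) (j : Fin (m i)) :
    ZMod 2 :=
  M (t, 1) ⟨i, j⟩ + M (t, 1) ⟨i, cyclicSucc j⟩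

/-- If all these row sums vanished, the columns of the chosen corners in `T` would add up to a
vector supported in the blocks outside `T`, with equal entries in the two rows of each block. Base
corners of the other factors cancel that vector. All the facets used pass through one vertex of the
product, contrary to nonsingularity. -/
theorem exists_sum_cornerEntry_ne_zero (h : IsNormalized hm M) (T : Finset (Fin n))
    (hT : T.Nonempty) (j : ∀ i, Fin (m i)) : ∃ t ∈ T, ∑ i ∈ T, cornerEntry M t i (j i) ≠ 0 := by
  classical
  by_contra! hcon
  let D : Fin n → ZMod 2 := fun t => ∑ i ∈ T, cornerEntry M t i (j i)
  let j' : ∀ i, Fin (m i) := fun i => if i ∈ T then j i else baseEdge hm i 0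
  -- Outside `T` the base corner of factor `i` contributes 1 in row `(i, 1)` and 0 in the second row
  -- of every other block, so the coefficient `D i` is the one that cancels.
  let c : Fin n → ZMod 2 := fun i => if i ∈ T then 1 else D i
  let w : Facet m → ZMod 2 := fun k => c k.1 * ((if k.2 = j' k.1 then 1 else 0) +
      if k.2 = cyclicSucc (j' k.1) then 1 else 0)
  have hne : ∀ i (q : Fin (m i)), q ≠ cyclicSucc q :=
    fun i q => (cyclicSucc_ne (by have := hm i; omega) q).symm
  have hone : ∀ t, ∑ i, c i * (M (t, 1) ⟨i, j' i⟩ + M (t, 1) ⟨i, cyclicSucc (j' i)⟩) = 0 := by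
    intro t
    have hterm : ∀ i, c i * (M (t, 1) ⟨i, j' i⟩ + M (t, 1) ⟨i, cyclicSucc (j' i)⟩) =
        (if i ∈ T then cornerEntry M t i (j i) else 0) +
          if i = t then (if t ∈ T then 0 else D t) else 0 := by
      intro i
      by_cases hi : i ∈ T
      · by_cases hit : i = t
        · subst hit
          simp [c, j', hi, cornerEntry]
        · simp [c, j', hi, hit, cornerEntry]
      · simp only [c, j', hi, if_false, cyclicSucc_baseEdge, h.base]
        by_cases hit : i = t
        · subst hit
          simp [hi]
        · simp [hit, Ne.symm hit]
    rw [Finset.sum_congr rfl fun i _ => hterm i, Finset.sum_add_distrib]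
    simp only [Finset.sum_ite_mem, Finset.univ_inter, Finset.sum_ite_eq', Finset.mem_univ, if_true]
    change D t + _ = 0
    by_cases ht : t ∈ T
    · simpa [ht] using hcon t ht
    · simp [ht, zmod_two_add_self]
  -- The rows of a block differ by a factor weight, which is equal on both edges of a corner. Hence
  -- the second rows suffice.
  have hrow : ∀ t k, M (t, 0) k = factorWeight m t k + M (t, 1) k := by
    intro t k
    rw [← h.row_add, add_assoc, zmod_two_add_self, add_zero]
  have hw := (isCharacteristic_iff _ _).1 h.isCharacteristic w (fun i => edgeEnd (j' i)) (by
    intro k hk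
    change edgeEnd (j' k.1) ∈ polygonEdge (m k.1) k.2
    by_cases h1 : k.2 = j' k.1
    · rw [h1]
      exact edgeEnd_mem _
    · by_cases h2 : k.2 = cyclicSucc (j' k.1)
      · rw [h2]
        exact edgeEnd_mem_cyclicSucc _
      · simp [w, h1, h2] at hk) (by
    funext ⟨t, r⟩
    change ∑ k, M (t, r) k * w k = 0
    rw [sum_facet w (M (t, r)) c j' (fun i q => rfl)]
    rw [← hone t]
    refine Finset.sum_congr rfl fun i _ => ?_
    congr 1
    fin_cases r
    · change M (t, 0) _ + M (t, 0) _ = _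
      rw [hrow, hrow]
      simp only [factorWeight]
      generalize (if i = t then (1 : ZMod 2) else 0) = x
      linear_combination zmod_two_add_self x
    · rfl)
  obtain ⟨i, hi⟩ := hT
  have := congrFun hw ⟨i, j i⟩
  simp [w, c, j', hi, hne] at this

/-- The case of a one-element set `T`, with the corner of that polygon arbitrary. -/
theorem cornerEntry_self (h : IsNormalized hm M) (i : Fin n) (j : Fin (m i)) :
    cornerEntry M i i j = 1 := by
  classical
  obtain ⟨t, ht, hne⟩ := h.exists_sum_cornerEntry_ne_zero {i} (Finset.singleton_nonempty i)
    (fun k => if hk : k = i then hk ▸ j else baseEdge hm k 0)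
  rw [Finset.mem_singleton] at ht
  subst ht
  rw [Finset.sum_singleton, dif_pos rfl] at hne
  exact (zmod_two_cases _).resolve_left hne

theorem apply_succ (M : Matrix (Fin n × Fin 2) (Facet m) (ZMod 2)) (t i : Fin n) (j : Fin (m i)) :
    M (t, 1) ⟨i, cyclicSucc j⟩ = M (t, 1) ⟨i, j⟩ + cornerEntry M t i j := by
  rw [cornerEntry, ← add_assoc, zmod_two_add_self, zero_add]

/-- The entry is 0 at the base edge, and each step to the next edge adds a diagonal corner entry,
which is 1. -/
theorem apply_self_one (h : IsNormalized hm M) (i : Fin n) (j : Fin (m i)) :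
    M (i, 1) ⟨i, j⟩ = ((j : ℕ) : ZMod 2) := by
  obtain ⟨j, hj⟩ := j
  induction j with
  | zero => simpa [baseEdge] using h.base i 0 (i, 1)
  | succ j ih =>
    have hs : (⟨j + 1, hj⟩ : Fin (m i)) = cyclicSucc ⟨j, by omega⟩ := by
      apply Fin.ext
      rw [cyclicSucc_val]
      simp
      omega
    rw [hs, apply_succ M i i, ih (by omega), h.cornerEntry_self, cyclicSucc_val]
    rw [if_neg]
    · push_cast
      rfl
    · simp
      omega

/-- The entry changes at every corner and must return to its initial value after one turn around the
polygon. -/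
theorem even_sides (h : IsNormalized hm M) (i : Fin n) : Even (m i) := by
  have hi := hm i
  have h1 := apply_succ M i i ⟨m i - 1, by omega⟩
  rw [h.apply_self_one, h.apply_self_one, h.cornerEntry_self, cyclicSucc_val, if_pos (by simp; omega)]
    at h1
  rw [← ZMod.natCast_eq_zero_iff_even, show m i = (m i - 1) + 1 by omega]
  push_cast
  exact h1.symm.trans (by simp)

theorem apply_self (h : IsNormalized hm M) (i : Fin n) (r : Fin 2) (j : Fin (m i)) :
    M (i, r) ⟨i, j⟩ = if (r : ℕ) = (j : ℕ) % 2 then 1 else 0 := by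
  have h1 := h.apply_self_one i j
  have h0 : M (i, 0) ⟨i, j⟩ = 1 + M (i, 1) ⟨i, j⟩ := by
    have := h.row_add i ⟨i, j⟩
    simp only [factorWeight, if_true] at this
    rw [← this, add_assoc, zmod_two_add_self, add_zero]
  rw [h1] at h0
  have hj : ((j : ℕ) : ZMod 2) = (((j : ℕ) % 2 : ℕ) : ZMod 2) := by simp
  rw [hj] at h0 h1
  rcases Nat.mod_two_eq_zero_or_one (j : ℕ) with e | e <;> rw [e] at h0 h1 ⊢ <;> fin_cases r
  · simpa using h0
  · simpa using h1
  · simp [h0]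
    decide
  · simpa using h1

/-- `Interacts M l k`: the columns of factor `k` have a nonconstant part in block `l ≠ k`. -/
def Interacts (M : Matrix (Fin n × Fin 2) (Facet m) (ZMod 2)) (l k : Fin n) : Prop :=
  l ≠ k ∧ ∃ q, cornerEntry M l k q ≠ 0

/-- Without interaction the second row is constant along the polygon `k`, and it vanishes at the
base edge. The first row agrees with it because `χ_l` is zero on factor `k`. -/
theorem apply_eq_zero (h : IsNormalized hm M) {l k : Fin n} (hlk : l ≠ k) (hn : ¬ Interacts M l k)
    (r : Fin 2) (j : Fin (m k)) : M (l, r) ⟨k, j⟩ = 0 := by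
  have hone : M (l, 1) ⟨k, j⟩ = 0 := by
    have hz : ∀ q, cornerEntry M l k q = 0 := by
      intro q
      by_contra hq
      exact hn ⟨hlk, q, hq⟩
    obtain ⟨j, hj⟩ := j
    induction j with
    | zero => simpa [baseEdge, hlk] using h.base k 0 (l, 1)
    | succ j ih =>
      have hs : (⟨j + 1, hj⟩ : Fin (m k)) = cyclicSucc ⟨j, by omega⟩ := by
        apply Fin.ext
        rw [cyclicSucc_val]
        simp
        omega
      rw [hs, apply_succ M l k, ih (by omega), hz, add_zero]
  fin_cases r
  · have := h.row_add l ⟨k, j⟩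
    rw [hone, add_zero] at this
    change M (l, 0) _ = 0
    rw [this, factorWeight, if_neg hlk.symm]
  · exact hone

/-- Strong induction on `T`. If `T` has no minimal factor while its smaller nonempty subsets do,
then the interactions inside `T` are those of a permutation without fixed points, and a suitable
choice of corners contradicts `exists_sum_cornerEntry_ne_zero`. -/
theorem exists_minimal (h : IsNormalized hm M) (T : Finset (Fin n)) (hT : T.Nonempty) :
    ∃ k ∈ T, ∀ l ∈ T, ¬ Interacts M l k := by
  classical
  induction T using Finset.strongInduction with
  | H T ih =>
    by_contra! hcon
    -- Take `k` minimal in `T` without `i`. Something in `T` interacts with `k`, and it can only be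
    -- `i`.
    have hstep : ∀ i : T, ∃ k : T, Interacts M i k ∧ ∀ l ∈ T, l ≠ i → ¬ Interacts M l k := by
      rintro ⟨i, hi⟩
      have hne : (T.erase i).Nonempty := by
        obtain ⟨l, hl, hil⟩ := hcon i hi
        exact ⟨l, Finset.mem_erase.2 ⟨hil.1, hl⟩⟩
      obtain ⟨k, hk, hmin⟩ := ih _ (Finset.erase_ssubset hi) hne
      have hkT := Finset.mem_of_mem_erase hk
      refine ⟨⟨k, hkT⟩, ?_, fun l hl hli => hmin l (Finset.mem_erase.2 ⟨hli, hl⟩)⟩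
      obtain ⟨l, hl, hlk⟩ := hcon k hkT
      by_cases hli : l = i
      · exact hli ▸ hlk
      · exact absurd hlk (hmin l (Finset.mem_erase.2 ⟨hli, hl⟩))
    choose f hf hf' using hstep
    -- The only factor of `T` that interacts with `f i` is `i`, so `f i` determines `i`.
    have hinj : Function.Injective f := by
      intro i i' hii
      by_contra hne
      exact hf' i' i i.2 (fun h => hne (Subtype.ext h)) (hii ▸ hf i)
    let e : T ≃ T := Equiv.ofBijective f (Finite.injective_iff_bijective.1 hinj)
    have hq : ∀ k : T, ∃ q, cornerEntry M (e.symm k) k q ≠ 0 := by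
      intro k
      obtain ⟨-, q, hq⟩ := hf (e.symm k)
      have hk : ∀ k', f (e.symm k) = k' → ∃ q, cornerEntry M (e.symm k) k' q ≠ 0 := by
        rintro _ rfl
        exact ⟨q, hq⟩
      exact hk k (e.apply_symm_apply k)
    choose q hq using hq
    -- Column `k` of the corner matrix depends only on the corner in polygon `k`, so the corners
    -- witnessing the interactions can be chosen simultaneously.
    obtain ⟨J, hJ⟩ : ∃ J : ∀ i, Fin (m i), ∀ k : T, J k = q k :=
      ⟨fun k => if hk : k ∈ T then q ⟨k, hk⟩ else baseEdge hm k 0, fun k => dif_pos k.2⟩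
    obtain ⟨t, ht, hne⟩ := h.exists_sum_cornerEntry_ne_zero T hT J
    apply hne
    rw [← Finset.sum_coe_sort]
    have hte : (⟨t, ht⟩ : T) ≠ e ⟨t, ht⟩ := fun hh => (hf ⟨t, ht⟩).1 (congrArg Subtype.val hh)
    -- Row `t` has exactly two nonzero entries, at `t` and at `e t`, and `1 + 1 = 0`.
    rw [Fintype.sum_eq_add _ _ hte]
    · have h1 := hq (e ⟨t, ht⟩)
      rw [e.symm_apply_apply] at h1
      have h1' := (zmod_two_cases _).resolve_left h1
      rw [hJ, hJ, h1', h.cornerEntry_self]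
      decide
    · rintro i ⟨hit, hie⟩
      by_contra hc
      have hk : f (e.symm i) = i := e.apply_symm_apply i
      have hti : t ≠ e.symm i := by
        intro hh
        apply hie
        have : (⟨t, ht⟩ : T) = e.symm i := Subtype.ext hh
        rw [this, e.apply_symm_apply]
      have := hf' (e.symm i) t ht hti
      rw [hk] at this
      exact this ⟨fun hh => hit (Subtype.ext hh.symm), _, hc⟩

theorem wellFounded_interacts (h : IsNormalized hm M) : WellFounded (Interacts M) := by
  classical
  rw [WellFounded.wellFounded_iff_has_min]
  intro S hS
  obtain ⟨k, hk, hmin⟩ := h.exists_minimal S.toFinset (by simpa using hS)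
  exact ⟨k, by simpa using hk, fun l hl => hmin l (by simpa using hl)⟩

/-- An order of the factors in which no factor interacts with an earlier block. -/
theorem exists_order (h : IsNormalized hm M) :
    ∃ s : Equiv.Perm (Fin n), ∀ a b, a < b → ∀ r (j : Fin (m (s b))), M (s a, r) ⟨s b, j⟩ = 0 := by
  have : IsWellFounded (Fin n) (Interacts M) := ⟨h.wellFounded_interacts⟩
  -- Sorting by decreasing rank: an interaction of `s a` with `s b` would make the rank of `s a` the
  -- smaller one, which is impossible for `a < b`.
  let f : Fin n → Ordinalᵒᵈ := fun i => OrderDual.toDual (IsWellFounded.rank (Interacts M) i)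
  refine ⟨Tuple.sort f, fun a b hab r j => ?_⟩
  refine h.apply_eq_zero (fun e => hab.ne ((Tuple.sort f).injective e)) (fun hint => ?_) r j
  have h1 := Tuple.monotone_sort f hab.le
  have h2 := IsWellFounded.rank_lt_of_rel hint
  exact absurd h2 (not_lt.2 h1)

end IsNormalized

end NormalForm

/-! ### Triangulated surfaces from flags -/

section ChamberSurface

/-- A triangulated oriented surface with vertices colored by `Fin 3`, described by its triangles
(flags), the vertex of each color of a flag, and the flag obtained by crossing the edge opposite to
the vertex of a given color. -/
structure ChamberSurface (Fl V : Type) where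
  vert : Fin 3 → Fl → V
  color : V → Fin 3
  flip : Fin 3 → Fl → Fl
  sign : Fl → Bool
  color_vert : ∀ i f, color (vert i f) = i
  vert_surj : ∀ v, ∃ i f, vert i f = v
  vert_flip : ∀ i k f, i ≠ k → vert i (flip k f) = vert i f
  vert_flip_self : ∀ k f, vert k (flip k f) ≠ vert k f
  eq_or_eq_flip : ∀ k f f', (∀ i, i ≠ k → vert i f' = vert i f) → f' = f ∨ f' = flip k f
  sign_flip : ∀ k f, sign (flip k f) = !sign f
  residue_induction : ∀ i f (S : Set Fl), f ∈ S → (∀ k g, k ≠ i → g ∈ S → flip k g ∈ S) →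
    ∀ f', vert i f' = vert i f → f' ∈ S
  flag_induction : ∀ f (S : Set Fl), f ∈ S → (∀ k g, g ∈ S → flip k g ∈ S) → ∀ f', f' ∈ S
  nonempty : Nonempty Fl

namespace ChamberSurface

variable {Fl V : Type} (C : ChamberSurface Fl V)

/-- Otherwise the second flag would be a flip of the first, but a flip changes a vertex. Thus flags
can be identified with triangles. -/
theorem eq_of_vert_eq {f f' : Fl} (h : ∀ i, C.vert i f' = C.vert i f) : f' = f := by
  rcases C.eq_or_eq_flip 0 f f' fun i _ => h i with h' | h'
  · exact h'
  · exact absurd (h' ▸ h 0) (C.vert_flip_self 0 f)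

theorem vert_ne {i j : Fin 3} (h : i ≠ j) (f : Fl) : C.vert i f ≠ C.vert j f := by
  intro h'
  exact h (by simpa [C.color_vert] using congrArg C.color h')

variable [DecidableEq V]

/-- The vertex set of a flag. -/
def tri (f : Fl) : Finset V := Finset.univ.image fun i => C.vert i f

theorem mem_tri {v : V} {f : Fl} : v ∈ C.tri f ↔ C.vert (C.color v) f = v := by
  simp only [tri, Finset.mem_image, Finset.mem_univ, true_and]
  constructor
  · rintro ⟨i, rfl⟩
    rw [C.color_vert]
  · intro h
    exact ⟨_, h⟩

theorem vert_mem_tri (i : Fin 3) (f : Fl) : C.vert i f ∈ C.tri f := by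
  rw [mem_tri, C.color_vert]

theorem vert_mem_tri_iff {i : Fin 3} {f f' : Fl} :
    C.vert i f ∈ C.tri f' ↔ C.vert i f' = C.vert i f := by
  rw [mem_tri, C.color_vert]

theorem card_tri (f : Fl) : (C.tri f).card = 3 := by
  rw [tri, Finset.card_image_of_injective]
  · simp
  · intro i j h
    simpa [C.color_vert] using congrArg C.color h

theorem eq_of_tri_subset {f f' : Fl} (h : C.tri f ⊆ C.tri f') : f' = f :=
  C.eq_of_vert_eq fun i => C.vert_mem_tri_iff.1 (h (C.vert_mem_tri i f))

theorem tri_injective : Function.Injective C.tri := fun _ _ h => C.eq_of_tri_subset h.symm.subset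

/-- The simplicial complex generated by the flags. -/
def complex : AbstractSimplicialComplex V where
  faces := {s | s.Nonempty ∧ ∃ f, s ⊆ C.tri f}
  isRelLowerSet_faces := by
    rintro s ⟨hs, f, hf⟩
    exact ⟨hs, fun t hts ht => ⟨ht, f, le_trans hts hf⟩⟩
  singleton_mem v := by
    obtain ⟨i, f, rfl⟩ := C.vert_surj v
    exact ⟨Finset.singleton_nonempty _, f, by simpa using C.vert_mem_tri i f⟩

theorem tri_mem_faces (f : Fl) : C.tri f ∈ C.complex.faces :=
  ⟨⟨_, C.vert_mem_tri 0 f⟩, f, le_rfl⟩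

theorem mem_realization_iff [Fintype V] {x : V → ℝ} : x ∈ realization C.complex ↔
    x ∈ stdSimplex ℝ V ∧ ∃ f, ∀ v, x v ≠ 0 → v ∈ C.tri f := by
  constructor
  · rintro ⟨hx, s, ⟨-, f, hf⟩, hs⟩
    exact ⟨hx, f, fun v hv => hf (hs v hv)⟩
  · rintro ⟨hx, f, hf⟩
    exact ⟨hx, _, C.tri_mem_faces f, hf⟩

theorem eq_tri_of_card {t : Finset V} (ht : t ∈ C.complex.faces) (h3 : t.card = 3) :
    ∃ f, t = C.tri f := by
  obtain ⟨-, f, hf⟩ := ht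
  exact ⟨f, Finset.eq_of_subset_of_card_le hf (by rw [C.card_tri, h3])⟩

theorem exists_missing_color {e : Finset V} {f : Fl} (he : e ⊆ C.tri f) (h2 : e.card = 2) :
    ∃ k, ∀ v, v ∈ e ↔ v ∈ C.tri f ∧ C.color v ≠ k := by
  have hc : (C.tri f \ e).card = 1 := by
    rw [Finset.card_sdiff_of_subset he, C.card_tri, h2]
  obtain ⟨u, hu⟩ := Finset.card_eq_one.1 hc
  have hu' : u ∈ C.tri f ∧ u ∉ e := Finset.mem_sdiff.1 (hu ▸ Finset.mem_singleton_self u)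
  refine ⟨C.color u, fun v => ⟨fun hv => ⟨he hv, fun hc => hu'.2 ?_⟩, fun ⟨hv, hc⟩ => ?_⟩⟩
  · rwa [← C.mem_tri.1 hu'.1, ← hc, C.mem_tri.1 (he hv)]
  · by_contra hve
    have : v ∈ C.tri f \ e := Finset.mem_sdiff.2 ⟨hv, hve⟩
    rw [hu, Finset.mem_singleton] at this
    exact hc (congrArg _ this)

/-- An edge lacks exactly one color `k`, and the flags sharing its two vertices are one flag and its
flip across `k`. -/
theorem edge_ncard {e : Finset V} (he : e ∈ C.complex.faces) (h2 : e.card = 2) :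
    {t ∈ C.complex.faces | e ⊆ t ∧ t.card = 3}.ncard = 2 := by
  obtain ⟨-, f, hf⟩ := he
  obtain ⟨k, hk⟩ := C.exists_missing_color hf h2
  have hset : {t ∈ C.complex.faces | e ⊆ t ∧ t.card = 3} = {C.tri f, C.tri (C.flip k f)} := by
    ext t
    constructor
    · rintro ⟨ht, het, h3⟩
      obtain ⟨f', rfl⟩ := C.eq_tri_of_card ht h3
      rcases C.eq_or_eq_flip k f f' fun i hi => C.vert_mem_tri_iff.1
        (het ((hk _).2 ⟨C.vert_mem_tri i f, by rwa [C.color_vert]⟩)) with rfl | rfl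
      · exact Or.inl rfl
      · exact Or.inr rfl
    · rintro (rfl | rfl)
      · exact ⟨C.tri_mem_faces _, hf, C.card_tri _⟩
      · refine ⟨C.tri_mem_faces _, fun v hv => ?_, C.card_tri _⟩
        obtain ⟨h1, h2⟩ := (hk v).1 hv
        rw [C.mem_tri, C.vert_flip _ _ _ h2]
        exact C.mem_tri.1 h1
  rw [hset, Set.ncard_pair]
  intro h
  exact C.vert_flip_self k f (C.vert_mem_tri_iff.1 (h ▸ C.vert_mem_tri k f))

theorem link_adj {i j k : Fin 3} (hij : i ≠ j) (hik : i ≠ k) (hjk : j ≠ k) (f : Fl) :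
    (linkGraph C.complex (C.vert i f)).Adj (C.vert j f) (C.vert k f) := by
  refine ⟨C.vert_ne hjk f, C.vert_ne hij.symm f, C.vert_ne hik.symm f, ⟨_, Finset.mem_insert_self _ _⟩, f, ?_⟩
  intro v hv
  simp only [Finset.mem_insert, Finset.mem_singleton] at hv
  rcases hv with rfl | rfl | rfl <;> exact C.vert_mem_tri _ _

theorem edge_adj {i j : Fin 3} (hij : i ≠ j) (f : Fl) :
    (edgeGraph C.complex).Adj (C.vert i f) (C.vert j f) := by
  refine ⟨C.vert_ne hij f, ⟨_, Finset.mem_insert_self _ _⟩, f, ?_⟩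
  intro v hv
  simp only [Finset.mem_insert, Finset.mem_singleton] at hv
  rcases hv with rfl | rfl <;> exact C.vert_mem_tri _ _

theorem exists_flag_of_adj {v a : V} (h : (edgeGraph C.complex).Adj v a) :
    ∃ (f : Fl) (i l : Fin 3), l ≠ i ∧ C.vert i f = v ∧ C.vert l f = a := by
  obtain ⟨hne, -, f, hf⟩ := h
  have hv := C.mem_tri.1 (hf (Finset.mem_insert_self v {a}))
  have ha := C.mem_tri.1 (hf (Finset.mem_insert_of_mem (Finset.mem_singleton_self a)))
  refine ⟨f, C.color v, C.color a, fun hc => hne ?_, hv, ha⟩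
  rw [← hv, ← ha, hc]

theorem link_reachable (v a b : V) (ha : (edgeGraph C.complex).Adj v a)
    (hb : (edgeGraph C.complex).Adj v b) : (linkGraph C.complex v).Reachable a b := by
  obtain ⟨f, i, l, hl, rfl, rfl⟩ := C.exists_flag_of_adj ha
  obtain ⟨f', i', l', hl', hv, rfl⟩ := C.exists_flag_of_adj hb
  obtain rfl : i' = i := by simpa [C.color_vert] using congrArg C.color hv
  have hthird : ∀ i k : Fin 3, ∃ l, l ≠ i ∧ l ≠ k := by decide
  -- The claim is strengthened to all vertices of `g` other than the center of the link, so that it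
  -- survives a flip: the replaced vertex is joined to the third vertex, which stays.
  have key := C.residue_induction i' f {g | C.vert i' g = C.vert i' f ∧ ∀ l', l' ≠ i' →
    (linkGraph C.complex (C.vert i' f)).Reachable (C.vert l f) (C.vert l' g)} ?_ ?_ f' hv
  · exact key.2 l' hl'
  · refine ⟨rfl, fun l' hl' => ?_⟩
    by_cases h : l' = l
    · rw [h]
    · exact (C.link_adj hl.symm hl'.symm (Ne.symm h) f).reachable
  · rintro k g hk ⟨hg, hreach⟩
    have hg' : C.vert i' (C.flip k g) = C.vert i' f := by rw [C.vert_flip _ _ _ hk.symm, hg]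
    refine ⟨hg', fun l' hl' => ?_⟩
    by_cases h : l' = k
    · subst h
      obtain ⟨c, hci, hcl⟩ := hthird i' l'
      refine (hreach c hci).trans ?_
      rw [← C.vert_flip c l' g hcl, ← hg']
      exact (C.link_adj hci.symm hk.symm hcl _).reachable
    · rw [C.vert_flip _ _ _ h]
      exact hreach l' hl'

theorem edgeGraph_connected : (edgeGraph C.complex).Connected := by
  obtain ⟨f₀⟩ := C.nonempty
  have hV : Nonempty V := ⟨C.vert 0 f₀⟩
  refine ⟨fun a b => ?_⟩
  obtain ⟨i, f, rfl⟩ := C.vert_surj a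
  obtain ⟨j, f', rfl⟩ := C.vert_surj b
  have hother : ∀ k : Fin 3, ∃ l, l ≠ k := by decide
  refine C.flag_induction f {g | ∀ l, (edgeGraph C.complex).Reachable (C.vert i f) (C.vert l g)}
    (fun l => ?_) (fun k g hg l => ?_) f' j
  · by_cases h : l = i
    · rw [h]
    · exact (C.edge_adj (Ne.symm h) f).reachable
  · by_cases h : l = k
    · subst h
      obtain ⟨c, hc⟩ := hother l
      refine (hg c).trans ?_
      rw [← C.vert_flip c l g hc]
      exact (C.edge_adj hc _).reachable
    · rw [C.vert_flip _ _ _ h]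
      exact hg l

theorem isClosedConnectedSurfaceComplex : IsClosedConnectedSurfaceComplex C.complex where
  card_le := by
    rintro s ⟨-, f, hf⟩
    exact C.card_tri f ▸ Finset.card_le_card hf
  pure := by
    rintro s ⟨-, f, hf⟩
    exact ⟨_, C.tri_mem_faces f, hf, C.card_tri f⟩
  edge e he h2 := C.edge_ncard he h2
  link := C.link_reachable
  connected := C.edgeGraph_connected

/-- The point of the realization with given barycentric coordinates in a flag. -/
def flagPoint (f : Fl) (c : Fin 3 → ℝ) (v : V) : ℝ :=
  if C.vert (C.color v) f = v then c (C.color v) else 0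

theorem flagPoint_vert (f : Fl) (c : Fin 3 → ℝ) (i : Fin 3) : C.flagPoint f c (C.vert i f) = c i := by
  simp [flagPoint, C.color_vert]

theorem eq_vert_of_flagPoint_ne_zero {f : Fl} {c : Fin 3 → ℝ} {v : V} (h : C.flagPoint f c v ≠ 0) :
    C.vert (C.color v) f = v := by
  by_contra h'
  exact h (if_neg h')

/-- The two flags differ only in the vertex of color `k`, which carries weight zero. -/
theorem flagPoint_flip (f : Fl) (c : Fin 3 → ℝ) {k : Fin 3} (hk : c k = 0) :
    C.flagPoint (C.flip k f) c = C.flagPoint f c := by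
  funext v
  by_cases h : C.color v = k
  · simp [flagPoint, h, hk]
  · simp [flagPoint, C.vert_flip _ _ _ h]

theorem sum_flagPoint [Fintype V] (f : Fl) (c : Fin 3 → ℝ) :
    ∑ v, C.flagPoint f c v = ∑ i, c i := by
  have h1 : ∑ v, C.flagPoint f c v = ∑ v ∈ C.tri f, C.flagPoint f c v := by
    refine (Finset.sum_subset (Finset.subset_univ _) fun v _ hv => ?_).symm
    rw [mem_tri] at hv
    exact if_neg hv
  rw [h1, tri, Finset.sum_image fun i _ j _ h => by simpa [C.color_vert] using congrArg C.color h]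
  exact Finset.sum_congr rfl fun i _ => C.flagPoint_vert f c i

theorem flagPoint_mem_realization [Fintype V] (f : Fl) {c : Fin 3 → ℝ} (h0 : ∀ i, 0 ≤ c i)
    (h1 : ∑ i, c i = 1) : C.flagPoint f c ∈ realization C.complex := by
  refine C.mem_realization_iff.2 ⟨⟨fun v => ?_, (C.sum_flagPoint f c).trans h1⟩, f, fun v hv =>
    C.mem_tri.2 (C.eq_vert_of_flagPoint_ne_zero hv)⟩
  unfold flagPoint
  split_ifs
  · exact h0 _
  · exact le_rfl

theorem exists_flagPoint_eq [Fintype V] {x : V → ℝ} (hx : x ∈ realization C.complex) :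
    ∃ (f : Fl) (c : Fin 3 → ℝ), (∀ i, 0 ≤ c i) ∧ ∑ i, c i = 1 ∧ x = C.flagPoint f c := by
  obtain ⟨⟨h0, h1⟩, f, hf⟩ := C.mem_realization_iff.1 hx
  have hxf : x = C.flagPoint f fun i => x (C.vert i f) := by
    funext v
    by_cases hv : C.vert (C.color v) f = v
    · simp [flagPoint, hv]
    · rw [flagPoint, if_neg hv]
      by_contra h
      exact hv (C.mem_tri.1 (hf v h))
  refine ⟨f, fun i => x (C.vert i f), fun i => h0 _, ?_, hxf⟩
  rw [← C.sum_flagPoint f, ← hxf, h1]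

/-- The positive vertex orders: colors increase cyclically in flags with positive sign and decrease
cyclically in the other flags. -/
def orientation (a b c : V) : Prop :=
  ∃ f, a ∈ C.tri f ∧ b ∈ C.tri f ∧ c ∈ C.tri f ∧
    ((C.sign f = true ∧ C.color b = C.color a + 1 ∧ C.color c = C.color b + 1) ∨
      (C.sign f = false ∧ C.color a = C.color b + 1 ∧ C.color b = C.color c + 1))

theorem eq_of_color_eq {a b : V} {f : Fl} (ha : a ∈ C.tri f) (hb : b ∈ C.tri f)
    (h : C.color a = C.color b) : a = b := by
  rw [← C.mem_tri.1 ha, ← C.mem_tri.1 hb, h]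

/-- Two triangles inducing the same directed edge with equal third colors have the same sign,
whereas flags adjacent across that edge have opposite signs. So the triangles coincide. The
remaining conditions are finite checks on colors. -/
theorem isCoherentOrientation : IsCoherentOrientation C.complex C.orientation where
  triangle := by
    rintro a b c ⟨f, ha, hb, hc, h⟩
    refine ⟨⟨⟨a, by simp⟩, f, ?_⟩, ?_⟩
    · intro v hv
      simp only [Finset.mem_insert, Finset.mem_singleton] at hv
      rcases hv with rfl | rfl | rfl <;> assumption
    · have hdec : ∀ x y z : Fin 3, (y = x + 1 ∧ z = y + 1) ∨ (x = y + 1 ∧ y = z + 1) →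
          x ≠ y ∧ y ≠ z ∧ z ≠ x := by decide
      obtain ⟨h1, h2, h3⟩ := hdec _ _ _ (h.imp And.right And.right)
      exact ⟨fun e => h1 (congrArg _ e), fun e => h2 (congrArg _ e), fun e => h3 (congrArg _ e)⟩
  cyclic := by
    rintro a b c ⟨f, ha, hb, hc, h⟩
    have hdec : ∀ x y z : Fin 3, y = x + 1 → z = y + 1 → x = z + 1 := by decide
    refine ⟨f, hb, hc, ha, h.imp ?_ ?_⟩
    · rintro ⟨hs, h1, h2⟩
      exact ⟨hs, h2, hdec _ _ _ h1 h2⟩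
    · rintro ⟨hs, h1, h2⟩
      exact ⟨hs, h2, hdec _ _ _ h2 h1⟩
  exactly_one := by
    rintro a b c ⟨-, f, hf⟩ hab hbc hca
    have ha : a ∈ C.tri f := hf (by simp)
    have hb : b ∈ C.tri f := hf (by simp)
    have hc : c ∈ C.tri f := hf (by simp)
    have cab : C.color a ≠ C.color b := fun h => hab (C.eq_of_color_eq ha hb h)
    have cbc : C.color b ≠ C.color c := fun h => hbc (C.eq_of_color_eq hb hc h)
    have cca : C.color c ≠ C.color a := fun h => hca (C.eq_of_color_eq hc ha h)
    have hall : ∀ x y z w : Fin 3, x ≠ y → y ≠ z → z ≠ x → w = x ∨ w = y ∨ w = z := by decide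
    have huniq : ∀ f', a ∈ C.tri f' → b ∈ C.tri f' → c ∈ C.tri f' → f' = f := by
      intro f' ha' hb' hc'
      refine C.eq_of_vert_eq fun i => ?_
      rcases hall _ _ _ i cab cbc cca with rfl | rfl | rfl
      · rw [C.mem_tri.1 ha, C.mem_tri.1 ha']
      · rw [C.mem_tri.1 hb, C.mem_tri.1 hb']
      · rw [C.mem_tri.1 hc, C.mem_tri.1 hc']
    have e1 : C.orientation a b c ↔
        ((C.sign f = true ∧ C.color b = C.color a + 1 ∧ C.color c = C.color b + 1) ∨
        (C.sign f = false ∧ C.color a = C.color b + 1 ∧ C.color b = C.color c + 1)) := by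
      constructor
      · rintro ⟨f', ha', hb', hc', h⟩
        rwa [huniq f' ha' hb' hc'] at h
      · intro h
        exact ⟨f, ha, hb, hc, h⟩
    have e2 : C.orientation b a c ↔
        ((C.sign f = true ∧ C.color a = C.color b + 1 ∧ C.color c = C.color a + 1) ∨
        (C.sign f = false ∧ C.color b = C.color a + 1 ∧ C.color a = C.color c + 1)) := by
      constructor
      · rintro ⟨f', hb', ha', hc', h⟩
        rwa [huniq f' ha' hb' hc'] at h
      · intro h
        exact ⟨f, hb, ha, hc, h⟩
    rw [e1, e2]
    have hdec : ∀ (s : Bool) (x y z : Fin 3), x ≠ y → y ≠ z → z ≠ x →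
        Xor ((s = true ∧ y = x + 1 ∧ z = y + 1) ∨ (s = false ∧ x = y + 1 ∧ y = z + 1))
          ((s = true ∧ x = y + 1 ∧ z = x + 1) ∨ (s = false ∧ y = x + 1 ∧ x = z + 1)) := by
      unfold Xor
      decide
    exact hdec _ _ _ _ cab cbc cca
  coherent := by
    rintro a b c d ⟨f, ha, hb, hc, h⟩ ⟨f', ha', hb', hd', h'⟩
    have hdec : ∀ (s s' : Bool) (x y z w : Fin 3),
        ((s = true ∧ y = x + 1 ∧ z = y + 1) ∨ (s = false ∧ x = y + 1 ∧ y = z + 1)) →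
        ((s' = true ∧ y = x + 1 ∧ w = y + 1) ∨ (s' = false ∧ x = y + 1 ∧ y = w + 1)) →
        s' = s ∧ z = w ∧ ∀ i, i ≠ z → i = x ∨ i = y := by decide
    obtain ⟨hs, hcd, hi⟩ := hdec _ _ _ _ _ _ h h'
    rcases C.eq_or_eq_flip (C.color c) f f' (fun i hi' => by
      rcases hi i hi' with rfl | rfl
      · rw [C.mem_tri.1 ha, C.mem_tri.1 ha']
      · rw [C.mem_tri.1 hb, C.mem_tri.1 hb']) with rfl | rfl
    · exact C.eq_of_color_eq hc hd' hcd
    · rw [C.sign_flip] at hs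
      simp at hs

/-! ### Counting simplices and the Euler characteristic -/

theorem ncard_vertices [Fintype V] : {s ∈ C.complex.faces | s.card = 1}.ncard = Fintype.card V := by
  have : {s ∈ C.complex.faces | s.card = 1} = Set.range (fun v : V => ({v} : Finset V)) := by
    ext s
    constructor
    · rintro ⟨-, h1⟩
      obtain ⟨v, rfl⟩ := Finset.card_eq_one.1 h1
      exact ⟨v, rfl⟩
    · rintro ⟨v, rfl⟩
      exact ⟨C.complex.singleton_mem v, by simp⟩
  rw [this, ← Set.image_univ, Set.ncard_image_of_injective _ (fun a b h => by simpa using h),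
    Set.ncard_univ, Nat.card_eq_fintype_card]

theorem ncard_triangles [Fintype Fl] : {s ∈ C.complex.faces | s.card = 3}.ncard = Fintype.card Fl := by
  have : {s ∈ C.complex.faces | s.card = 3} = Set.range C.tri := by
    ext s
    constructor
    · rintro ⟨hs, h3⟩
      obtain ⟨f, rfl⟩ := C.eq_tri_of_card hs h3
      exact ⟨f, rfl⟩
    · rintro ⟨f, rfl⟩
      exact ⟨C.tri_mem_faces f, C.card_tri f⟩
  rw [this, ← Set.image_univ, Set.ncard_image_of_injective _ C.tri_injective,
    Set.ncard_univ, Nat.card_eq_fintype_card]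

variable [Fintype V] [Fintype Fl]

/-- Double counting of incidences: every edge lies in two triangles and every triangle has three
edges. -/
theorem two_mul_ncard_edges :
    2 * {s ∈ C.complex.faces | s.card = 2}.ncard = 3 * Fintype.card Fl := by
  classical
  let E : Finset (Finset V) := Finset.univ.filter fun s => s ∈ C.complex.faces ∧ s.card = 2
  let T : Finset (Finset V) := Finset.univ.filter fun s => s ∈ C.complex.faces ∧ s.card = 3
  have hE : {s ∈ C.complex.faces | s.card = 2}.ncard = E.card := by
    rw [← Set.ncard_coe_finset]
    congr 1
    ext s
    simp [E]
  have hT : T.card = Fintype.card Fl := by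
    rw [← C.ncard_triangles, ← Set.ncard_coe_finset]
    congr 1
    ext s
    simp [T]
  have key := Finset.sum_card_bipartiteAbove_eq_sum_card_bipartiteBelow (s := E) (t := T)
    (fun e t => e ⊆ t)
  have h1 : ∀ e ∈ E, (T.bipartiteAbove (fun e t => e ⊆ t) e).card = 2 := by
    intro e he
    obtain ⟨he, h2⟩ : e ∈ C.complex.faces ∧ e.card = 2 := by simpa [E] using he
    rw [← C.edge_ncard he h2, ← Set.ncard_coe_finset]
    congr 1
    ext t
    simp [T, Finset.bipartiteAbove]
    tauto
  have h2 : ∀ t ∈ T, (E.bipartiteBelow (fun e t => e ⊆ t) t).card = 3 := by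
    intro t ht
    obtain ⟨ht, h3⟩ : t ∈ C.complex.faces ∧ t.card = 3 := by simpa [T] using ht
    have : E.bipartiteBelow (fun e t => e ⊆ t) t = t.powersetCard 2 := by
      ext e
      simp only [Finset.bipartiteBelow, E, Finset.mem_filter, Finset.mem_univ, true_and,
        Finset.mem_powersetCard]
      constructor
      · rintro ⟨⟨-, h2⟩, h⟩
        exact ⟨h, h2⟩
      · rintro ⟨h, h2⟩
        refine ⟨⟨⟨?_, ?_⟩, h2⟩, h⟩
        · rw [← Finset.card_pos, h2]
          norm_num
        · obtain ⟨-, f, hf⟩ := ht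
          exact ⟨f, h.trans hf⟩
    rw [this, Finset.card_powersetCard, h3]
    rfl
  rw [Finset.sum_congr rfl h1, Finset.sum_congr rfl h2] at key
  simp only [Finset.sum_const, smul_eq_mul] at key
  rw [hE, ← hT]
  linarith

/-- Since `2E = 3F`, twice the Euler characteristic is `2V - F`, so only vertices and flags have to
be counted. -/
theorem isClosedOrientableSurfaceOfGenus {X : Type} [TopologicalSpace X]
    (e : X ≃ₜ realization C.complex) {g : ℕ}
    (hg : 2 * (Fintype.card V : ℤ) - Fintype.card Fl = 4 - 4 * g) :
    IsClosedOrientableSurfaceOfGenus X g := by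
  refine ⟨V, inferInstance, inferInstance, C.complex, C.orientation,
    C.isClosedConnectedSurfaceComplex, C.isCoherentOrientation, ?_, ⟨e⟩⟩
  have h := C.two_mul_ncard_edges
  rw [C.ncard_vertices, C.ncard_triangles]
  have h' : 2 * ({s ∈ C.complex.faces | s.card = 2}.ncard : ℤ) = 3 * Fintype.card Fl := by
    exact_mod_cast h
  linarith

end ChamberSurface

end ChamberSurface

/-! ### The small cover of a polygon with alternating characteristic vectors -/

section AlternatingPolygon

/-- The `2 × m` matrix whose columns are alternately the two standard basis vectors. -/
def alternatingMatrix (m : ℕ) : Matrix (Fin 2) (Fin m) (ZMod 2) :=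
  fun r j => if (r : ℕ) = (j : ℕ) % 2 then 1 else 0

/-- Edges of equal parity through a common point coincide, so the row of the parity of `k` isolates
`w k`. -/
theorem isCharacteristic_alternatingMatrix {m : ℕ} (hm : 4 ≤ m) (he : Even m) :
    IsCharacteristic (polygonEdge m) (alternatingMatrix m) := by
  rw [isCharacteristic_iff]
  intro w p hp h0
  funext k
  by_contra hk
  have h := congrFun h0 ⟨(k : ℕ) % 2, Nat.mod_lt _ two_pos⟩
  change ∑ j, alternatingMatrix m ⟨(k : ℕ) % 2, Nat.mod_lt _ two_pos⟩ j * w j = 0 at h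
  rw [Finset.sum_eq_single k] at h
  · simp [alternatingMatrix] at h
    exact hk h
  · intro j _ hjk
    by_cases hj : w j = 0
    · rw [hj, mul_zero]
    · rw [alternatingMatrix, if_neg, zero_mul]
      intro hpar
      exact hjk (eq_of_mem_polygonEdge hm he (hp j hj) (hp k hk) hpar.symm)
  · simp

/-- The parity of an edge. -/
def edgeParity {m : ℕ} (j : Fin m) : Fin 2 := ⟨(j : ℕ) % 2, Nat.mod_lt _ two_pos⟩

theorem edgeParity_cyclicSucc {m : ℕ} (he : Even m) (j : Fin m) :
    edgeParity (cyclicSucc j) = edgeParity j + 1 := by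
  apply Fin.ext
  simp only [edgeParity, cyclicSucc_mod_two he, Fin.val_add]
  have := Nat.mod_lt (j : ℕ) two_pos
  simp
  omega

theorem alternatingMatrix_col {m : ℕ} (j : Fin m) :
    (alternatingMatrix m).col j = Pi.single (edgeParity j) 1 := by
  funext r
  simp [alternatingMatrix, Matrix.col, Pi.single_apply, edgeParity, Fin.ext_iff]

/-- The cyclic rotation of `Fin m`. -/
noncomputable def cyclicEquiv (m : ℕ) : Equiv.Perm (Fin m) :=
  Equiv.ofBijective cyclicSucc ⟨cyclicSucc_injective, cyclicSucc_surjective⟩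

theorem cyclicSucc_symm {m : ℕ} (j : Fin m) : cyclicSucc ((cyclicEquiv m).symm j) = j :=
  (cyclicEquiv m).apply_symm_apply j

theorem cyclic_induction {m : ℕ} {Q : Fin m → Prop} (j : Fin m) (h : Q j)
    (hs : ∀ i, Q i → Q (cyclicSucc i)) (i : Fin m) : Q i := by
  have key : ∀ d : ℕ, Q ⟨(j + d) % m, Nat.mod_lt _ j.pos⟩ := by
    intro d
    induction d with
    | zero => simpa [Nat.mod_eq_of_lt j.2] using h
    | succ d ih =>
      have := hs _ ih
      rwa [cyclicSucc, show (⟨((j + d) % m + 1) % m, Nat.mod_lt _ j.pos⟩ : Fin m) =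
        ⟨(j + (d + 1)) % m, Nat.mod_lt _ j.pos⟩ by simp [← add_assoc]] at this
  have := key (i + (m - j))
  rwa [show (⟨((j : ℕ) + (i + (m - j))) % m, Nat.mod_lt _ j.pos⟩ : Fin m) = i by
    apply Fin.ext
    have := j.2
    have := i.2
    simp only
    rw [show (j : ℕ) + (i + (m - j)) = i + m by omega, Nat.add_mod_right,
      Nat.mod_eq_of_lt i.2]] at this

/-- Flags of the barycentric subdivision of the small cover: a copy of the polygon, an edge, and one
of its two ends. -/
abbrev PolygonFlag (m : ℕ) : Type := (Fin 2 → ZMod 2) × Fin m × Bool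

/-- Vertices of the barycentric subdivision of the small cover: copies of the center, of the
midpoints of edges, and of the vertices of the polygon. -/
abbrev BarycentricVertex (m : ℕ) : Type := (Fin 2 → ZMod 2) ⊕ (Fin m × ZMod 2) ⊕ Fin m

/-- The end of an edge. -/
def flagEnd {m : ℕ} (j : Fin m) (ε : Bool) : Fin m := if ε then cyclicSucc j else j

theorem eq_or_eq_add_single : ∀ (q : Fin 2) (g g' : Fin 2 → ZMod 2), g' (q + 1) = g (q + 1) →
    g' = g ∨ g' = g + Pi.single q 1 := by decide

/-- The barycentric subdivision of the small cover of a polygon. -/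
noncomputable def barycentricSurface {m : ℕ} (hm : 4 ≤ m) (he : Even m) :
    ChamberSurface (PolygonFlag m) (BarycentricVertex m) where
  vert i f := match i with
    | 0 => Sum.inl f.1
    -- Along edge `j` the copies `g` and `g + Pi.single (edgeParity j) 1` are glued, so a midpoint
    -- remembers only the other coordinate of `g`. At a corner both parities meet and all four
    -- copies are glued.
    | 1 => Sum.inr (Sum.inl (f.2.1, f.1 (edgeParity f.2.1 + 1)))
    | 2 => Sum.inr (Sum.inr (flagEnd f.2.1 f.2.2))
  color v := match v with
    | Sum.inl _ => 0
    | Sum.inr (Sum.inl _) => 1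
    | Sum.inr (Sum.inr _) => 2
  flip k f := match k with
    | 0 => (f.1 + Pi.single (edgeParity f.2.1) 1, f.2.1, f.2.2)
    | 1 => if f.2.2 then (f.1, cyclicSucc f.2.1, false) else (f.1, (cyclicEquiv m).symm f.2.1, true)
    | 2 => (f.1, f.2.1, !f.2.2)
  -- Crossing an edge of the polygon changes `g 0 + g 1`; the other two flips change the end of the
  -- edge. So every flip reverses the sign.
  sign f := xor (decide (f.1 0 + f.1 1 = 0)) f.2.2
  color_vert i f := by fin_cases i <;> rfl
  vert_surj v := by
    rcases v with g | ⟨j, h⟩ | j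
    · exact ⟨0, (g, ⟨0, by omega⟩, false), rfl⟩
    · exact ⟨1, (fun _ => h, j, false), rfl⟩
    · exact ⟨2, (0, j, false), rfl⟩
  vert_flip i k f hik := by
    obtain ⟨g, j, ε⟩ := f
    fin_cases i <;> fin_cases k <;> simp at hik ⊢ <;> cases ε <;> simp [flagEnd, cyclicSucc_symm]
  vert_flip_self k f := by
    obtain ⟨g, j, ε⟩ := f
    have h1 := cyclicSucc_ne (by omega : 2 ≤ m) j
    have h2 := cyclicSucc_ne (by omega : 2 ≤ m) ((cyclicEquiv m).symm j)
    rw [cyclicSucc_symm] at h2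
    fin_cases k <;> cases ε <;> simp [flagEnd, h1, h1.symm, h2.symm]
  eq_or_eq_flip k f f' h := by
    obtain ⟨g, j, ε⟩ := f
    obtain ⟨g', j', ε'⟩ := f'
    have hinj := cyclicSucc_injective (m := m)
    have hne := cyclicSucc_ne (by omega : 2 ≤ m)
    have h0 := h 0
    have h1 := h 1
    have h2 := h 2
    fin_cases k
    · simp at h1 h2
      obtain ⟨rfl, h1⟩ := h1
      have hε : ε' = ε := by
        cases ε <;> cases ε' <;> simp [flagEnd, hne, (hne _).symm] at h2 ⊢
      subst hε
      rcases eq_or_eq_add_single _ g g' h1 with rfl | rfl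
      · exact Or.inl rfl
      · exact Or.inr rfl
    · simp at h0 h2
      subst h0
      cases ε <;> cases ε' <;> simp [flagEnd] at h2 ⊢
      · exact h2
      · rw [← h2]
        exact ((cyclicEquiv m).symm_apply_apply j').symm
      · exact h2
      · exact hinj h2
    · simp at h0 h1
      obtain ⟨rfl, -⟩ := h1
      subst h0
      cases ε <;> cases ε' <;> simp
  sign_flip k f := by
    obtain ⟨g, j, ε⟩ := f
    have hg : ∀ (g : Fin 2 → ZMod 2) (q : Fin 2),
        decide ((g + Pi.single q 1 : Fin 2 → ZMod 2) 0 + (g + Pi.single q 1 : Fin 2 → ZMod 2) 1 = 0) = !decide (g 0 + g 1 = 0) := by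
      decide
    fin_cases k
    · change xor _ _ = !(xor _ _)
      rw [hg, Bool.not_xor]
    · cases ε <;> simp
    · simp
  residue_induction i f S hf hS f' hi := by
    obtain ⟨g, j, ε⟩ := f
    obtain ⟨g', j', ε'⟩ := f'
    have h0 : ∀ g j ε, i ≠ 0 → (g, j, ε) ∈ S → (g + Pi.single (edgeParity j) 1, j, ε) ∈ S :=
      fun g j ε h hg => hS 0 _ h.symm hg
    have h1 : ∀ g j, i ≠ 1 → (g, j, true) ∈ S → (g, cyclicSucc j, false) ∈ S :=
      fun g j h hg => by simpa using hS 1 _ h.symm hg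
    have h1' : ∀ g j, i ≠ 1 → (g, cyclicSucc j, false) ∈ S → (g, j, true) ∈ S := fun g j h hg => by
      have hj : (cyclicEquiv m).symm (cyclicSucc j) = j := (cyclicEquiv m).symm_apply_apply j
      simpa [hj] using hS 1 _ h.symm hg
    have h2 : ∀ g j ε ε', i ≠ 2 → (g, j, ε) ∈ S → (g, j, ε') ∈ S := fun g j ε ε' h hg => by
      by_cases hε : ε' = ε
      · rwa [hε]
      · rw [Bool.eq_not_of_ne hε]
        exact hS 2 _ h.symm hg
    fin_cases i
    · simp at hi
      subst hi
      refine cyclic_induction (Q := fun j' => (g', j', ε') ∈ S) j (h2 _ _ _ _ (by decide) hf)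
        (fun i hi => ?_) j'
      exact h2 _ _ _ _ (by decide) (h1 _ _ (by decide) (h2 _ _ _ _ (by decide) hi))
    · simp at hi
      obtain ⟨rfl, hi⟩ := hi
      rcases eq_or_eq_add_single _ g g' hi with rfl | rfl
      · exact h2 _ _ _ _ (by decide) hf
      · exact h2 _ _ _ _ (by decide) (h0 _ _ _ (by decide) hf)
    · simp at hi
      have hpar := edgeParity_cyclicSucc he
      have hgen : ∀ (q : Fin 2) (A : (Fin 2 → ZMod 2) → Prop),
          (∀ g, A g → A (g + Pi.single q 1)) → (∀ g, A g → A (g + Pi.single (q + 1) 1)) →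
          ∀ g g', A g → A g' := by
        intro q A h1 h2 g g' hg
        have hcases : ∀ (q : Fin 2) (g g' : Fin 2 → ZMod 2), g' = g ∨ g' = g + Pi.single q 1 ∨
          g' = g + Pi.single (q + 1) 1 ∨ g' = g + Pi.single q 1 + Pi.single (q + 1) 1 := by decide
        rcases hcases q g g' with rfl | rfl | rfl | rfl
        · exact hg
        · exact h1 _ hg
        · exact h2 _ hg
        · exact h2 _ (h1 _ hg)
      -- Going around a corner crosses its two edges, which have different parities. The two
      -- translations generate all copies.
      have hall : ∀ j, (g, cyclicSucc j, false) ∈ S → ∀ g', (g', cyclicSucc j, false) ∈ S := by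
        intro j hj g'
        refine hgen (edgeParity j) (fun g => (g, cyclicSucc j, false) ∈ S) ?_ ?_ g g' hj
        · intro g hg
          exact h1 _ _ (by decide) (h0 _ _ _ (by decide) (h1' _ _ (by decide) hg))
        · intro g hg
          have := h0 _ _ _ (by decide) hg
          rwa [hpar] at this
      have hback : ∀ g j ε, (g, j, ε) ∈ S → (g, flagEnd j ε, false) ∈ S := by
        intro g j ε hg
        cases ε
        · exact hg
        · exact h1 _ _ (by decide) hg
      have hforth : ∀ g j ε, (g, flagEnd j ε, false) ∈ S → (g, j, ε) ∈ S := by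
        intro g j ε hg
        cases ε
        · exact hg
        · exact h1' _ _ (by decide) hg
      apply hforth
      have hb := hback _ _ _ hf
      rw [hi]
      rw [← cyclicSucc_symm (flagEnd j ε)] at hb ⊢
      exact hall _ hb g'
  flag_induction f S hf hS f' := by
    obtain ⟨g, j, ε⟩ := f
    obtain ⟨g', j', ε'⟩ := f'
    have h0 : ∀ g j ε, (g, j, ε) ∈ S → (g + Pi.single (edgeParity j) 1, j, ε) ∈ S :=
      fun g j ε hg => hS 0 _ hg
    have h1 : ∀ g j, (g, j, true) ∈ S → (g, cyclicSucc j, false) ∈ S :=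
      fun g j hg => by simpa using hS 1 _ hg
    have h2 : ∀ g j ε ε', (g, j, ε) ∈ S → (g, j, ε') ∈ S := fun g j ε ε' hg => by
      by_cases hε : ε' = ε
      · rwa [hε]
      · rw [Bool.eq_not_of_ne hε]
        exact hS 2 _ hg
    have hj : ∀ g j ε, (g, j, ε) ∈ S → ∀ j' ε', (g, j', ε') ∈ S := by
      intro g j ε hg j' ε'
      refine cyclic_induction (Q := fun j' => (g, j', ε') ∈ S) j (h2 _ _ _ _ hg)
        (fun i hi => ?_) j'
      exact h2 _ _ _ _ (h1 _ _ (h2 _ _ _ _ hi))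
    have hcases : ∀ (g g' : Fin 2 → ZMod 2), g' = g ∨ g' = g + Pi.single 0 1 ∨
      g' = g + Pi.single 1 1 ∨ g' = g + Pi.single 0 1 + Pi.single 1 1 := by decide
    have he0 : ∀ g, (∀ j ε, (g, j, ε) ∈ S) → ∀ j ε, (g + Pi.single 0 1, j, ε) ∈ S :=
      fun g hg => hj _ _ _ (h0 _ ⟨0, by omega⟩ true (hg _ _))
    have he1 : ∀ g, (∀ j ε, (g, j, ε) ∈ S) → ∀ j ε, (g + Pi.single 1 1, j, ε) ∈ S :=
      fun g hg => hj _ _ _ (h0 _ ⟨1, by omega⟩ true (hg _ _))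
    have hg := hj g j ε hf
    rcases hcases g g' with rfl | rfl | rfl | rfl
    · exact hg _ _
    · exact he0 _ hg _ _
    · exact he1 _ hg _ _
    · exact he1 _ (he0 _ hg) _ _
  nonempty := ⟨(0, ⟨0, by omega⟩, false)⟩

end AlternatingPolygon

/-! ### The triangulation of the small cover of a polygon -/

section Triangulation

variable {m : ℕ}

/-- The barycentric coordinate of the midpoint of an edge. -/
noncomputable def midCoord (j : Fin m) (z : ℂ) : ℝ :=
  2 * min (coneCoord m j z) (coneCoord m (cyclicSucc j) z)

/-- The barycentric coordinate of a vertex. -/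
noncomputable def cornerCoord (j : Fin m) (z : ℂ) : ℝ :=
  coneCoord m j z - midCoord j z / 2 - midCoord ((cyclicEquiv m).symm j) z / 2

/-- The barycentric coordinate of the center. -/
noncomputable def centerCoord (m : ℕ) (z : ℂ) : ℝ := 1 - ∑ j : Fin m, coneCoord m j z

theorem continuous_midCoord (j : Fin m) : Continuous (midCoord j) := by
  have := continuous_coneCoord m
  unfold midCoord
  fun_prop

theorem continuous_cornerCoord (j : Fin m) : Continuous (cornerCoord j) := by
  have := continuous_coneCoord m
  have := continuous_midCoord (m := m)
  unfold cornerCoord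
  fun_prop

theorem continuous_centerCoord : Continuous (centerCoord m) := by
  have := continuous_coneCoord m
  unfold centerCoord
  fun_prop

/-- The barycentric coordinates of a point of the copy `g` of the polygon. -/
noncomputable def barycentricMap (g : Fin 2 → ZMod 2) (z : ℂ) : BarycentricVertex m → ℝ
  | Sum.inl g' => if g = g' then centerCoord m z else 0
  | Sum.inr (Sum.inl (j, h)) => if g (edgeParity j + 1) = h then midCoord j z else 0
  | Sum.inr (Sum.inr j) => cornerCoord j z

theorem continuous_barycentricMap (g : Fin 2 → ZMod 2) :
    Continuous (barycentricMap (m := m) g) := by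
  refine continuous_pi fun v => ?_
  rcases v with g' | ⟨j, h⟩ | j
  · change Continuous fun z => if g = g' then centerCoord m z else 0
    split_ifs
    · exact continuous_centerCoord
    · exact continuous_const
  · change Continuous fun z => if g (edgeParity j + 1) = h then midCoord j z else 0
    split_ifs
    · exact continuous_midCoord j
    · exact continuous_const
  · exact continuous_cornerCoord j

/-- The barycentric coordinates determine the point. -/
theorem eq_of_barycentricMap_eq (hm : 4 ≤ m) {g h : Fin 2 → ZMod 2} {z w : ℂ}
    (H : barycentricMap (m := m) g z = barycentricMap h w) : z = w := by
  have hmid : ∀ j : Fin m, midCoord j z = midCoord j w := by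
    intro j
    -- Summing over the labels forgets which copies were glued and leaves the coordinate of the
    -- midpoint.
    have key : ∀ (g : Fin 2 → ZMod 2) (z : ℂ),
        ∑ x : ZMod 2, barycentricMap (m := m) g z (Sum.inr (Sum.inl (j, x))) = midCoord j z := by
      intro g z
      simp [barycentricMap]
    rw [← key g z, H, key]
  have hcor : ∀ j : Fin m, cornerCoord j z = cornerCoord j w := fun j =>
    congrFun H (Sum.inr (Sum.inr j))
  have hcone : ∀ j : Fin m, coneCoord m j z = coneCoord m j w := by
    intro j
    have := hcor j
    rw [cornerCoord, cornerCoord, hmid, hmid] at this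
    linarith
  rw [← sum_coneCoord_smul hm z, ← sum_coneCoord_smul hm w]
  exact Finset.sum_congr rfl fun j _ => by rw [hcone]

/-- The point of the polygon with given barycentric coordinates in the triangle spanned by the
center, the midpoint of an edge and one of its ends. -/
noncomputable def subdivisionPoint (j : Fin m) (ε : Bool) (x y : ℝ) : ℂ :=
  (x / 2 + if ε then 0 else y) • polygonVertex m j +
    (x / 2 + if ε then y else 0) • polygonVertex m (j + 1)

theorem exists_subdivisionPoint (hm : 4 ≤ m) (p : RegularPolygon m) : ∃ (j : Fin m) (ε : Bool) (x y : ℝ),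
    0 ≤ x ∧ 0 ≤ y ∧ x + y ≤ 1 ∧ (p : ℂ) = subdivisionPoint j ε x y := by
  obtain ⟨k, a, b, ha, hb, hab, hp⟩ := exists_sector_polygon (by omega) p
  -- For `b ≤ a`, the point `a v_k + b v_{k+1}` is `2b` times the midpoint plus `(a - b) v_k`; the
  -- other case is symmetric.
  rcases le_total b a with h | h
  · refine ⟨k, false, 2 * b, a - b, by linarith, by linarith, by linarith, ?_⟩
    rw [hp]
    simp [subdivisionPoint]
  · refine ⟨k, true, 2 * a, b - a, by linarith, by linarith, by linarith, ?_⟩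
    rw [hp]
    simp [subdivisionPoint]

theorem midCoord_sector (hm : 4 ≤ m) (j k : Fin m) {a b : ℝ} (ha : 0 ≤ a) (hb : 0 ≤ b) :
    midCoord j (a • polygonVertex m k + b • polygonVertex m (k + 1)) =
      if j = k then 2 * min a b else 0 := by
  have hne := cyclicSucc_ne (by omega : 2 ≤ m)
  have hne2 := cyclicSucc_cyclicSucc_ne (by omega : 3 ≤ m)
  rw [midCoord, coneCoord_sector hm _ _ ha hb, coneCoord_sector hm _ _ ha hb]
  by_cases h1 : j = k
  · subst h1
    simp [hne, (hne _).symm]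
  · have h2 : cyclicSucc j ≠ cyclicSucc k := fun h => h1 (cyclicSucc_injective h)
    by_cases h3 : j = cyclicSucc k
    · subst h3
      simp [hne, hne2, hb]
    · by_cases h4 : cyclicSucc j = k
      · simp [h1, h3, h4, ha, (hne k).symm]
      · simp [h1, h2, h3, h4]

/-- On the sector of edge `j` only the cone coordinates of its two ends survive. Their minimum is
half the weight of the midpoint, the remainder is the weight of the end selected by `ε`, and what is
missing from 1 belongs to the center. -/
theorem barycentricMap_subdivisionPoint (hm : 4 ≤ m) (he : Even m) (g : Fin 2 → ZMod 2) (j : Fin m) (ε : Bool) {x y : ℝ}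
    (hx : 0 ≤ x) (hy : 0 ≤ y) :
    barycentricMap g (subdivisionPoint j ε x y) =
      (barycentricSurface hm he).flagPoint (g, j, ε) ![1 - x - y, x, y] := by
  have ha : 0 ≤ x / 2 + if ε then 0 else y := by split_ifs <;> positivity
  have hb : 0 ≤ x / 2 + if ε then y else 0 := by split_ifs <;> positivity
  have hmin : min (x / 2 + if ε then 0 else y) (x / 2 + if ε then y else 0) = x / 2 := by
    cases ε <;> simp [hy]
  have hne := cyclicSucc_ne (by omega : 2 ≤ m)
  have hcone := fun i => coneCoord_sector hm i j ha hb
  have hmid := fun i => midCoord_sector hm i j ha hb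
  rw [hmin] at hmid
  simp only [mul_div_cancel₀ x (two_ne_zero' ℝ)] at hmid
  rw [subdivisionPoint]
  set z := (x / 2 + if ε then 0 else y) • polygonVertex m j +
    (x / 2 + if ε then y else 0) • polygonVertex m (j + 1)
  have hsymm : ∀ i : Fin m, (cyclicEquiv m).symm i = j ↔ i = cyclicSucc j := fun i =>
    (cyclicEquiv m).symm_apply_eq
  funext v
  rcases v with g' | ⟨i, h⟩ | i
  · have : centerCoord m z = 1 - x - y := by
      simp only [centerCoord, hcone, Finset.sum_add_distrib, Finset.sum_ite_eq', Finset.mem_univ,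
        if_true]
      cases ε <;> simp <;> ring
    simp [barycentricMap, ChamberSurface.flagPoint, barycentricSurface, this]
  · simp only [barycentricMap, ChamberSurface.flagPoint, barycentricSurface, hmid]
    by_cases hi : i = j
    · subst hi
      simp
    · simp [hi, Ne.symm hi]
  · simp only [barycentricMap, ChamberSurface.flagPoint, barycentricSurface, cornerCoord, hcone, hmid,
      hsymm, flagEnd]
    by_cases hi : i = j
    · subst hi
      cases ε <;> simp [hne, (hne _).symm]
    · by_cases hi' : i = cyclicSucc j
      · subst hi'
        cases ε <;> simp [hne, (hne _).symm]
      · cases ε <;> simp [hi, hi', Ne.symm hi, Ne.symm hi']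

theorem barycentricMap_mem (hm : 4 ≤ m) (he : Even m) (g : Fin 2 → ZMod 2) (p : RegularPolygon m) :
    barycentricMap g (p : ℂ) ∈ realization (barycentricSurface hm he).complex := by
  obtain ⟨j, ε, x, y, hx, hy, hxy, hp⟩ := exists_subdivisionPoint hm p
  rw [hp, barycentricMap_subdivisionPoint hm he g j ε hx hy]
  apply ChamberSurface.flagPoint_mem_realization
  · intro i
    fin_cases i <;> simp <;> linarith
  · rw [Fin.sum_univ_three]
    simp
    ring

theorem subdivisionPoint_mem (j : Fin m) (ε : Bool) {x y : ℝ} (hx : 0 ≤ x) (hy : 0 ≤ y)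
    (hm : 4 ≤ m) (hxy : x + y ≤ 1) :
    subdivisionPoint j ε x y ∈ convexHull ℝ (Set.range (polygonVertex m)) := by
  refine (sector_mem_polygon_iff (by omega) j.2 ?_ ?_).2 ?_ <;> cases ε <;> simp <;> linarith

theorem exists_barycentricMap_eq (hm : 4 ≤ m) (he : Even m) {u : BarycentricVertex m → ℝ}
    (hu : u ∈ realization (barycentricSurface hm he).complex) :
    ∃ (g : Fin 2 → ZMod 2) (p : RegularPolygon m), barycentricMap g (p : ℂ) = u := by
  obtain ⟨⟨g, j, ε⟩, c, h0, h1, rfl⟩ := ChamberSurface.exists_flagPoint_eq _ hu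
  rw [Fin.sum_univ_three] at h1
  have h00 := h0 0
  refine ⟨g, ⟨subdivisionPoint j ε (c 1) (c 2), subdivisionPoint_mem j ε (h0 1) (h0 2) hm
    (by linarith)⟩, ?_⟩
  rw [barycentricMap_subdivisionPoint hm he g j ε (h0 1) (h0 2)]
  congr 1
  funext i
  fin_cases i
  · simp
    linarith
  · rfl
  · rfl

/-- On an edge the center has weight zero, and adding the vector of the edge is the flip opposite to
the center. -/
theorem barycentricMap_add_single (hm : 4 ≤ m) (he : Even m) (g : Fin 2 → ZMod 2) {p : RegularPolygon m} {j : Fin m}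
    (hp : p ∈ polygonEdge m j) :
    barycentricMap (m := m) (g + Pi.single (edgeParity j) 1) (p : ℂ) = barycentricMap g (p : ℂ) := by
  obtain ⟨ε, x, y, hx, hy, hxy, hp⟩ : ∃ (ε : Bool) (x y : ℝ), 0 ≤ x ∧ 0 ≤ y ∧ x + y = 1 ∧
      (p : ℂ) = subdivisionPoint j ε x y := by
    obtain ⟨a, b, ha, hb, hab, hp⟩ := hp
    rcases le_total b a with h | h
    · refine ⟨false, 2 * b, a - b, by linarith, by linarith, by linarith, ?_⟩
      rw [← hp]
      simp [subdivisionPoint]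
    · refine ⟨true, 2 * a, b - a, by linarith, by linarith, by linarith, ?_⟩
      rw [← hp]
      simp [subdivisionPoint]
  rw [hp, barycentricMap_subdivisionPoint hm he _ j ε hx hy,
    barycentricMap_subdivisionPoint hm he _ j ε hx hy]
  have h0 : (![1 - x - y, x, y] : Fin 3 → ℝ) 0 = 0 := by
    change 1 - x - y = 0
    linarith
  exact (barycentricSurface hm he).flagPoint_flip (g, j, ε) _ h0

/-- A nonzero center weight determines the copy. On an edge away from its ends, the midpoint weight
determines the copy up to the vector of that edge. At a corner two edges of different parity are
available, and their vectors span the whole group. -/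
theorem barycentricMap_eq_iff (hm : 4 ≤ m) (he : Even m) (g h : Fin 2 → ZMod 2) (p : RegularPolygon m) :
    barycentricMap (m := m) g (p : ℂ) = barycentricMap h (p : ℂ) ↔ g - h ∈
      Submodule.span (ZMod 2) ((alternatingMatrix m).col '' {k | p ∈ polygonEdge m k}) := by
  constructor
  · intro H
    obtain ⟨j, ε, x, y, hx, hy, hxy, hp⟩ := exists_subdivisionPoint hm p
    rw [hp, barycentricMap_subdivisionPoint hm he g j ε hx hy,
      barycentricMap_subdivisionPoint hm he h j ε hx hy] at H
    have hcol : ∀ k, p ∈ polygonEdge m k → (Pi.single (edgeParity k) 1 : Fin 2 → ZMod 2) ∈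
        Submodule.span (ZMod 2) ((alternatingMatrix m).col '' {k | p ∈ polygonEdge m k}) := by
      intro k hk
      rw [← alternatingMatrix_col]
      exact Submodule.subset_span ⟨k, hk, rfl⟩
    by_cases h0 : 1 - x - y = 0
    · by_cases h1 : x = 0
      · have hend : ∃ i : Fin m, p = edgeEnd i := by
          have hy1 : y = 1 := by linarith
          refine ⟨if ε then j else (cyclicEquiv m).symm j, Subtype.ext ?_⟩
          rw [hp, edgeEnd]
          cases ε
          · change _ = polygonVertex m (((cyclicEquiv m).symm j : Fin m) + 1)
            rw [← polygonVertex_cyclicSucc ((cyclicEquiv m).symm j), cyclicSucc_symm]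
            simp [subdivisionPoint, h1, hy1]
          · simp [subdivisionPoint, h1, hy1]
        obtain ⟨i, hi⟩ := hend
        have c1 := hcol i (hi ▸ edgeEnd_mem i)
        have c2 := hcol (cyclicSucc i) (hi ▸ edgeEnd_mem_cyclicSucc i)
        rw [edgeParity_cyclicSucc he] at c2
        have hdec : ∀ (q : Fin 2) (d : Fin 2 → ZMod 2),
            d = d q • Pi.single q 1 + d (q + 1) • Pi.single (q + 1) 1 := by decide
        rw [hdec (edgeParity i) (g - h)]
        exact Submodule.add_mem _ (Submodule.smul_mem _ _ c1) (Submodule.smul_mem _ _ c2)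
      · have hpj : p ∈ polygonEdge m j := by
          refine ⟨_, _, ?_, ?_, ?_, hp.symm⟩ <;> cases ε <;> simp <;> linarith
        have h1' := congrFun H ((barycentricSurface hm he).vert 1 (g, j, ε))
        rw [ChamberSurface.flagPoint_vert] at h1'
        have hv := (barycentricSurface hm he).eq_vert_of_flagPoint_ne_zero
          (h1'.symm.trans_ne (by simpa using h1))
        have hv' : h (edgeParity j + 1) = g (edgeParity j + 1) := by
          simpa [barycentricSurface] using hv
        rcases eq_or_eq_add_single _ _ _ hv' with e | e
        · rw [e, sub_self]
          exact Submodule.zero_mem _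
        · rw [e, sub_add_cancel_left]
          exact Submodule.neg_mem _ (hcol j hpj)
    · have h1' := congrFun H ((barycentricSurface hm he).vert 0 (g, j, ε))
      rw [ChamberSurface.flagPoint_vert] at h1'
      have hv := (barycentricSurface hm he).eq_vert_of_flagPoint_ne_zero
        (h1'.symm.trans_ne (by simpa using h0))
      have hv' : h = g := by simpa [barycentricSurface] using hv
      rw [hv', sub_self]
      exact Submodule.zero_mem _
  · intro H
    have key : ∀ d ∈ Submodule.span (ZMod 2)
        ((alternatingMatrix m).col '' {k | p ∈ polygonEdge m k}),
        ∀ h, barycentricMap (m := m) (h + d) (p : ℂ) = barycentricMap h (p : ℂ) := by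
      intro d hd
      induction hd using Submodule.span_induction with
      | mem d hd =>
        obtain ⟨k, hk, rfl⟩ := hd
        intro h
        rw [alternatingMatrix_col]
        exact barycentricMap_add_single hm he h hk
      | zero => intro h; rw [add_zero]
      | add d d' _ _ h1 h2 => intro h; rw [← add_assoc, h2, h1]
      | smul c d _ h1 =>
        intro h
        rcases zmod_two_cases c with rfl | rfl
        · rw [zero_smul, add_zero]
        · rw [one_smul, h1]
    have := key _ H h
    rwa [add_sub_cancel] at this

/-- The homeomorphism from the small cover to the realization of its barycentric subdivision. -/
noncomputable def smallCoverHomeo (hm : 4 ≤ m) (he : Even m) :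
    SmallCover (polygonEdge m) (alternatingMatrix m) ≃ₜ
      realization (barycentricSurface hm he).complex := by
  have := compactSpace_regularPolygon (m := m) (by omega)
  let φ : (Fin 2 → ZMod 2) × RegularPolygon m → realization (barycentricSurface hm he).complex :=
    fun a => ⟨barycentricMap a.1 (a.2 : ℂ), barycentricMap_mem hm he a.1 a.2⟩
  have hφ : Continuous φ := by
    refine Continuous.subtype_mk ?_ _
    refine continuous_prod_of_discrete_left.2 fun g => ?_
    exact (continuous_barycentricMap g).comp continuous_subtype_val
  have hiff : ∀ a b, φ a = φ b ↔ (smallCoverSetoid (polygonEdge m) (alternatingMatrix m)).r a b := by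
    rintro ⟨g, p⟩ ⟨h, q⟩
    rw [Subtype.ext_iff]
    constructor
    · intro H
      obtain rfl : p = q := Subtype.ext (eq_of_barycentricMap_eq hm H)
      exact ⟨rfl, (barycentricMap_eq_iff hm he g h p).1 H⟩
    · rintro ⟨h1, h2⟩
      obtain rfl : p = q := h1
      exact (barycentricMap_eq_iff hm he g h p).2 h2
  let ψ : SmallCover (polygonEdge m) (alternatingMatrix m) →
      realization (barycentricSurface hm he).complex :=
    Quotient.lift (s := smallCoverSetoid (polygonEdge m) (alternatingMatrix m)) φ
      fun a b h => (hiff a b).2 h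
  have hψ : Continuous ψ := (SmallCover.isQuotientMap_mk _ _).continuous_iff.2 hφ
  have hbij : Function.Bijective ψ := by
    constructor
    · intro x y
      obtain ⟨a, rfl⟩ := SmallCover.mk_surjective _ _ x
      obtain ⟨b, rfl⟩ := SmallCover.mk_surjective _ _ y
      intro h
      exact Quotient.sound ((hiff a b).1 h)
    · rintro ⟨u, hu⟩
      obtain ⟨g, p, hgp⟩ := exists_barycentricMap_eq hm he hu
      exact ⟨SmallCover.mk _ _ (g, p), Subtype.ext hgp⟩
  -- A continuous bijection from a compact space to a Hausdorff space.
  exact Continuous.homeoOfEquivCompactToT2 (f := Equiv.ofBijective ψ hbij) hψ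

/-- The small cover of an even polygon with alternating characteristic vectors is the closed
orientable surface of genus `(m - 2) / 2`. -/
theorem isClosedOrientableSurfaceOfGenus_alternating (hm : 4 ≤ m) (he : Even m) :
    IsClosedOrientableSurfaceOfGenus (SmallCover (polygonEdge m) (alternatingMatrix m))
      ((m - 2) / 2) := by
  refine (barycentricSurface hm he).isClosedOrientableSurfaceOfGenus (smallCoverHomeo hm he) ?_
  obtain ⟨r, rfl⟩ := he
  -- There are `4 + 2m + m` vertices and `8m` triangles, so `2V - F = 8 - 2m`.
  simp only [Fintype.card_sum, Fintype.card_prod, Fintype.card_fun, Fintype.card_fin, ZMod.card,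
    Fintype.card_bool]
  have : (r + r - 2) / 2 = r - 1 := by omega
  rw [this]
  push_cast [show 1 ≤ r by omega]
  ring

end Triangulation

/-! ### The tower of a block lower triangular matrix -/

section Tower

variable {n : ℕ} {m : Fin n → ℕ}

/-- Forward substitution: once the coefficients of the earlier factors vanish, block `i` of the
relation involves only the diagonal block. -/
theorem IsBlockLowerTriangular.isCharacteristic
    {lam : Matrix (Fin n × Fin 2) (Facet m) (ZMod 2)} (h : IsBlockLowerTriangular lam)
    (hdiag : ∀ i, IsCharacteristic (polygonEdge (m i)) (diagonalBlock lam i)) :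
    IsCharacteristic (productFacet m) lam := by
  rw [isCharacteristic_iff]
  intro w p hp h0
  have key : ∀ i, (fun j => w ⟨i, j⟩) = 0 := by
    intro i
    induction i using WellFoundedLT.induction with
    | ind i ih =>
      refine (isCharacteristic_iff _ _).1 (hdiag i) (fun j => w ⟨i, j⟩) (p i)
        (fun j hj => hp ⟨i, j⟩ hj) ?_
      funext r
      have hr := congrFun h0 (i, r)
      change ∑ k, lam (i, r) k * w k = 0 at hr
      rw [Fintype.sum_sigma, Finset.sum_eq_single i] at hr
      · exact hr
      · intro b _ hb
        refine Finset.sum_eq_zero fun j _ => ?_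
        rcases lt_or_gt_of_ne hb with hlt | hlt
        · have := congrFun (ih b hlt) j
          simp only [Pi.zero_apply] at this
          rw [this, mul_zero]
        · rw [h i b hlt, zero_mul]
      · simp
  funext ⟨i, j⟩
  exact congrFun (key i) j

theorem IsBlockLowerTriangular.truncate
    {lam : Matrix (Fin n × Fin 2) (Facet m) (ZMod 2)} (h : IsBlockLowerTriangular lam) (t : ℕ)
    (ht : t ≤ n) : IsBlockLowerTriangular (truncation lam t ht) :=
  fun a b hab r j => h (a.castLE ht) (b.castLE ht) hab r j

/-- Splitting off the last factor of a product of polygons. -/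
def lastFactorHomeo (m : Fin n → ℕ) (i : Fin n) :
    PolygonProduct (firstSides m (i.val + 1) i.isLt) ≃ₜ
      PolygonProduct (firstSides m i.val i.isLt.le) × RegularPolygon (m i) where
  toFun p := (fun a => p a.castSucc, p (Fin.last i.val))
  invFun q := Fin.snoc (α := fun a => RegularPolygon (firstSides m (i.val + 1) i.isLt a)) q.1 q.2
  left_inv p := by
    funext a
    refine Fin.lastCases ?_ (fun a => ?_) a <;> simp
  right_inv q := by
    refine Prod.ext (funext fun a => ?_) ?_ <;> simp
  continuous_toFun := by fun_prop
  continuous_invFun := by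
    refine continuous_pi fun a => ?_
    refine Fin.lastCases ?_ (fun a => ?_) a
    · simp only [Fin.snoc_last]
      exact continuous_snd
    · simp only [Fin.snoc_castSucc]
      exact (continuous_apply a).comp continuous_fst

/-- Splitting off the last block of rows. -/
def lastBlockSplit (t : ℕ) : (Fin (t + 1) × Fin 2 → ZMod 2) ≃ₗ[ZMod 2]
    (Fin t × Fin 2 → ZMod 2) × (Fin 2 → ZMod 2) where
  toFun g := (fun a => g (a.1.castSucc, a.2), fun r => g (Fin.last t, r))
  invFun g a := Fin.lastCases (motive := fun _ => ZMod 2) (g.2 a.2) (fun b => g.1 (b, a.2)) a.1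
  left_inv g := by
    funext ⟨a, r⟩
    refine Fin.lastCases ?_ (fun a => ?_) a <;> simp
  right_inv g := by
    refine Prod.ext (funext fun a => ?_) (funext fun r => ?_) <;> simp
  map_add' _ _ := rfl
  map_smul' _ _ := rfl

/-- Splitting off the facets of the last factor. -/
noncomputable def lastFactorFacets (m : Fin n → ℕ) (i : Fin n) :
    Facet (firstSides m i.val i.isLt.le) ⊕ Fin (m i) ≃ Facet (firstSides m (i.val + 1) i.isLt) :=
  Equiv.ofBijective
    (Sum.elim (fun k => ⟨k.1.castSucc, k.2⟩) (fun j => ⟨Fin.last i.val, j⟩)) (by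
    constructor
    · rintro (⟨a, j⟩ | j) (⟨b, k⟩ | k) h
      · have h1 := congrArg Sigma.fst h
        have h1' : a = b := Fin.castSucc_injective _ h1
        subst h1'
        have h2 : j = k := by simpa using h
        rw [h2]
      · exact absurd (congrArg Sigma.fst h) (Fin.castSucc_ne_last a)
      · exact absurd (congrArg Sigma.fst h) (Fin.castSucc_ne_last b).symm
      · have h2 : j = k := by simpa using h
        rw [h2]
    · rintro ⟨a, j⟩
      induction a using Fin.lastCases with
      | last => exact ⟨Sum.inr j, rfl⟩
      | cast a => exact ⟨Sum.inl ⟨a, j⟩, rfl⟩)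

/-- A stage of the tower over a block lower triangular matrix splits over the previous one. -/
noncomputable def IsBlockLowerTriangular.blockSplitting
    {lam : Matrix (Fin n × Fin 2) (Facet m) (ZMod 2)} (h : IsBlockLowerTriangular lam) (i : Fin n) :
    BlockSplitting (productFacet (firstSides m (i.val + 1) i.isLt))
      (productFacet (firstSides m i.val i.isLt.le)) (polygonEdge (m i))
      (truncation lam (i.val + 1) i.isLt) (truncation lam i.val i.isLt.le)
      (diagonalBlock lam i) where
  homeo := lastFactorHomeo m i
  split := lastBlockSplit i.val
  facets := lastFactorFacets m i
  mem_left _ _ := Iff.rfl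
  mem_right _ _ := Iff.rfl
  col_left _ := rfl
  col_right j := by
    refine Prod.ext (funext fun a => ?_) rfl
    exact h (a.1.castSucc.castLE i.isLt) i a.1.2 a.2 j

end Tower

theorem corollary6p6 (n : ℕ) (m : Fin n → ℕ) (hm : ∀ i, 3 ≤ m i)
    (lam : Matrix (Fin n × Fin 2) (Facet m) (ZMod 2))
    (hlam : IsCharacteristic (productFacet m) lam) (hfc : FactorCompatible m lam) :
    (∃ π : Equiv.Perm (IntervalDirection m), IsCompatibleRegrouping m lam π) ∧
    ∀ π : Equiv.Perm (IntervalDirection m), IsCompatibleRegrouping m lam π →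
      ∃ (s : Equiv.Perm (Fin n)) (lam' : Matrix (Fin n × Fin 2) (Facet (m ∘ s)) (ZMod 2)),
        -- the regrouped small cover is the original one, with its facets relabelled
        IsCharacteristic (productFacet (m ∘ s))
          (lam.submatrix id (regroupFacet m π ∘ permuteFacet m s)) ∧
        (∃ φ : PolygonProduct m ≃ₜ PolygonProduct (m ∘ s),
          (∀ k, φ '' productFacet m (regroupFacet m π (permuteFacet m s k)) =
            productFacet (m ∘ s) k) ∧
          WeaklyEquivariantlyHomeomorphicOver (productFacet m) (productFacet (m ∘ s)) lam
            (lam.submatrix id (regroupFacet m π ∘ permuteFacet m s)) φ) ∧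
        -- over the regrouped product it is D-J equivalent to the top `M_n` of a tower
        DJEquivalent (productFacet (m ∘ s)) (productFacet (m ∘ s))
          (lam.submatrix id (regroupFacet m π ∘ permuteFacet m s)) lam' ∧
        IsBlockLowerTriangular lam' ∧
        (∀ (t : ℕ) (ht : t ≤ n),
          IsCharacteristic (productFacet (firstSides (m ∘ s) t ht)) (truncation lam' t ht)) ∧
        -- the tower ends in a point
        Nonempty (Unique (TowerStage lam' 0 (Nat.zero_le n))) ∧
        -- every step is an equivariant bundle over the projection of polytopes, and its fiber is
        -- an orientable small cover over a polygon
        ∀ i : Fin n,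
          (∃ (f : TowerStage lam' (i.val + 1) i.isLt → TowerStage lam' i.val i.isLt.le)
            (ρ : (Fin (i.val + 1) × Fin 2 → ZMod 2) →+ (Fin i.val × Fin 2 → ZMod 2))
            (ι : (Fin 2 → ZMod 2) →+ (Fin (i.val + 1) × Fin 2 → ZMod 2)),
            IsEquivariantBundle
              (Y := SmallCover (polygonEdge ((m ∘ s) i)) (diagonalBlock lam' i)) f ρ ι ∧
            ∀ (x : TowerStage lam' (i.val + 1) i.isLt) (a : Fin i.val),
              SmallCover.orbitMap _ _ (f x) a = SmallCover.orbitMap _ _ x a.castSucc) ∧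
          IsCharacteristic (polygonEdge ((m ∘ s) i)) (diagonalBlock lam' i) ∧
          Even ((m ∘ s) i) ∧
          IsClosedOrientableSurfaceOfGenus
            (SmallCover (polygonEdge ((m ∘ s) i)) (diagonalBlock lam' i))
            (((m ∘ s) i - 2) / 2) := by
  classical
  refine ⟨hfc, fun π hπ => ?_⟩
  have hL : IsCharacteristic (productFacet m) (lam.submatrix id (regroupFacet m π)) :=
    hlam.transport (regroupHomeo π).symm (regroupFacetEquiv π) LinearMap.id
      (fun _ _ h => h) (fun k p hp => by
        refine (regroupMap_mem_productFacet π _ k).1 ?_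
        have : regroupMap π ((regroupHomeo π).symm p) = p := (regroupHomeo π).apply_symm_apply p
        rwa [this]) (fun k => rfl)
  obtain ⟨θ, M, hθM, hM⟩ := exists_isNormalized hm hL hπ
  obtain ⟨s, hs⟩ := hM.exists_order
  -- Row blocks and column blocks are reordered simultaneously, so that diagonal blocks of `M`
  -- remain diagonal.
  let lam' : Matrix (Fin n × Fin 2) (Facet (m ∘ s)) (ZMod 2) :=
    M.submatrix (Prod.map s id) (permuteFacet m s)
  have htri : IsBlockLowerTriangular lam' := fun a b hab r j => hs a b hab r j
  have hdiag : ∀ i, diagonalBlock lam' i = alternatingMatrix (m (s i)) := by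
    intro i
    funext r j
    exact hM.apply_self (s i) r j
  have heven : ∀ i, Even (m (s i)) := fun i => hM.even_sides (s i)
  -- Evenness excludes triangles, so the cone coordinates are available for every factor.
  have hfour : ∀ i, 4 ≤ m (s i) := by
    intro i
    have h3 := hm (s i)
    obtain ⟨r, hr⟩ := heven i
    omega
  have hchar : ∀ i, IsCharacteristic (polygonEdge ((m ∘ s) i)) (diagonalBlock lam' i) := by
    intro i
    rw [hdiag]
    exact isCharacteristic_alternatingMatrix (hfour i) (heven i)
  have htrunc : ∀ (t : ℕ) (ht : t ≤ n),
      IsCharacteristic (productFacet (firstSides (m ∘ s) t ht)) (truncation lam' t ht) :=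
    fun t ht => (htri.truncate t ht).isCharacteristic fun i => hchar (i.castLE ht)
  refine ⟨s, lam', ?_, ⟨relabelHomeo π s, relabelHomeo_image π s, ?_⟩, ?_, htri, htrunc, ?_,
    fun i => ⟨?_, hchar i, heven i, ?_⟩⟩
  · refine hlam.transport (relabelHomeo π s).symm (relabelFacet π s) LinearMap.id
      (fun _ _ h => h) (fun k p hp => ?_) (fun k => rfl)
    rw [← relabelHomeo_mem, Homeomorph.apply_symm_apply]
    exact hp
  · exact weaklyEquivariantlyHomeomorphicOver_of_matching _ (relabelFacet π s)
      (LinearEquiv.refl _ _) (relabelHomeo_image π s) (fun k => rfl)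
  -- The automorphism of the group is the normalization `θ` followed by the reordering of the row
  -- blocks; the polytope and its facets stay fixed.
  · refine weaklyEquivariantlyHomeomorphicOver_of_matching _ (Equiv.refl _)
      (θ.trans (LinearEquiv.funCongrLeft (ZMod 2) (ZMod 2) (s.prodCongr (Equiv.refl (Fin 2)))))
      (fun k => by simp) (fun k => ?_)
    funext a
    exact congrFun (hθM (permuteFacet m s k)) (s a.1, a.2)
  · refine ⟨⟨⟨SmallCover.mk _ _ (0, fun i => i.elim0)⟩, fun x => ?_⟩⟩
    obtain ⟨a, rfl⟩ := SmallCover.mk_surjective _ _ x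
    refine congrArg _ (Prod.ext (funext fun r => r.1.elim0) (funext fun i => i.elim0))
  · refine ⟨_, _, _, (htri.blockSplitting i).isEquivariantBundle_proj
      (isClosed_productFacet _) isClosed_polygonEdge (htrunc _ _), fun x a => ?_⟩
    obtain ⟨b, rfl⟩ := SmallCover.mk_surjective _ _ x
    rfl
  · rw [hdiag]
    exact isClosedOrientableSurfaceOfGenus_alternating (hfour i) (heven i)
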